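/- Let $\mathcal X$ be a compact metric space, $\varepsilon>0$, and let $c\in C(\mathcal X\times\mathcal X)$ be symmetric and non-negative, such that $k_c=\exp(-c/\varepsilon)$ is a positive definite universal kernel (i.e. its reproducing kernel Hilbert space $\mathcal H_c$ is dense in $C(\mathcal X)$; "positive definite" means $\sum_{i,j}\lambda_i\lambda_jk_c(x_i,x_j)\ge 0$ for all finite families of points and reals). Let $\mathcal P(\mathcal X)$ be the Borel probability measures on $\mathcal X$ with the weak-* topology. *Notation.* For $\mu\in\mathcal P(\mathcal X)$ let $f_\mu\in C(\mathcal X)$ be the (unique) solution of $f_\mu(y)=-\varepsilon\log\int \exp\big((f_\mu(x)-c(x,y))/\varepsilon\big)\,d\mu(x)$ for all $y$, let $k_\mu(x,y)=\exp\big((f_\mu(x)+f_\mu(y)-c(x,y))/\varepsilon\big)$ with reproducing kernel Hilbert space $\mathcal H_\mu$, let $H_\mu:\mathcal H_\mu^*\to\mathcal H_\mu$ be the Riesz isomorphism, $K_\mu[\phi](y)=\int k_\mu(x,y)\phi(x)\,d\mu(x)$, and $T_\mu=\{\sigma\in\mathcal H_\mu^*:\langle\sigma,1\rangle=0\}$.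 The operator $\mathrm{Id}-K_\mu^2$ is invertible modulo constants, and for $\sigma_1,\sigma_2\in T_\mu$ put $$g_\mu(\sigma_1,\sigma_2)=\tfrac{\varepsilon}{2}\big\langle\sigma_1,(\mathrm{Id}-K_\mu^2)^{-1}H_\mu[\sigma_2]\big\rangle .$$ Let $B(\mu)=\exp(-f_\mu/\varepsilon)=\int \exp(f_\mu(x)/\varepsilon)\,k_c(x,\cdot)\,d\mu(x)\in\mathcal H_c$. A curve $(\mu_t)$ in $\mathcal P(\mathcal X)$ has derivative $\dot\mu_t\in T_{\mu_t}$ at $t$ if $\frac{d}{ds}\int\phi\,d\mu_s\big|_{s=t}=\langle\dot\mu_t,\phi\rangle$ for all $\phi\in\mathcal H_{\mu_t}$. Let $\mathsf d_S(\mu,\nu)^2=\inf\int_0^1 g_{\mu_t}(\dot\mu_t,\dot\mu_t)\,dt$ over the curves $(\mu_t)_{t\in[0,1]}$ from $\mu$ to $\nu$ with $(B(\mu_t))_t\in H^1([0,1];\mathcal H_c)$. For $V\in C(\mathcal X)$ and $\bar\mu_0\in\mathcal P(\mathcal X)$, a *Sinkhorn potential flow* of $V$ starting at $\bar\mu_0$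 is a curve $(\mu_t)_{t\ge0}$ in $AC^2_{\mathrm{loc}}([0,\infty);(\mathcal P(\mathcal X),\mathsf d_S))$ with $\mu_0=\bar\mu_0$ such that for a.e. $t$ there is $p_t\in C(\mathcal X)$ with $p_t\le0$, $p_t=0$ on $\operatorname{supp}\mu_t$, and $$\tfrac{\varepsilon}{2}(\mathrm{Id}-K_{\mu_t}^2)^{-1}H_{\mu_t}[\dot\mu_t]+V+p_t=0\quad\text{in } C(\mathcal X)/\mathbb R .$$ **Theorem.** For every $V\in C(\mathcal X)$ and $\bar\mu_0\in\mathcal P(\mathcal X)$ there is a unique Sinkhorn potential flow $(\mu_t)_{t\ge0}$ of $V$ starting at $\bar\mu_0$. With $E(\mu)=\int V\,d\mu$: 1. (Energy dissipation) $t\mapsto E(\mu_t)$ is absolutely continuous on $[0,\infty)$ and non-increasing, and $\frac{d}{dt}E(\mu_t)=-g_{\mu_t}(\dot\mu_t,\dot\mu_t)$ for a.e. $t$. 2. (Long-term behavior) $\lim_{t\to\infty}E(\mu_t)=\min_{\mathcal P(\mathcal X)}E=\min_{\mathcal X}V$. If $V$ has a unique minimizer $x^\star$, then $\mu_t\to\delta_{x^\star}$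 weakly-* as $t\to\infty$. 3. (Non-expansiveness) If $(\mu^1_t)_{t\ge0}$ and $(\mu^2_t)_{t\ge0}$ are two Sinkhorn potential flows of $V$, then $t\mapsto\|B(\mu^1_t)-B(\mu^2_t)\|_{\mathcal H_c}$ is non-increasing. -/

import Mathlib

open MeasureTheory Filter Topology Set
open scoped ENNReal NNReal

noncomputable section

namespace Sinkhorn

/-! ### Reproducing kernel Hilbert space of a real positive semidefinite kernel -/

section RKHSpace

variable {X : Type*}

/-- The scalar kernel `k`, seen as a kernel with values in the operators `ℝ →L[ℝ] ℝ`. -/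
def opKernel (k : Matrix X X ℝ) : Matrix X X (ℝ →L[ℝ] ℝ) :=
  Matrix.of fun x y => k x y • ContinuousLinearMap.id ℝ ℝ

theorem opKernel_posSemidef {k : Matrix X X ℝ} (hk : k.PosSemidef) :
    (opKernel k).PosSemidef := by
  have key := (RKHS.posSemidef_tfae (K := opKernel k)).out 0 2
  refine key.mpr ⟨?_, ?_⟩
  · ext1 x y
    have h := hk.isHermitian.apply x y
    simp only [star_trivial] at h
    ext
    simp [opKernel, h, ← ContinuousLinearMap.one_def]
  · intro f
    have h := hk.2 f
    simp only [Finsupp.sum, star_trivial] at h ⊢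
    simp only [RCLike.re_to_real]
    rw [Finset.sum_comm]
    refine h.trans_eq (Finset.sum_congr rfl fun x _ => Finset.sum_congr rfl fun y _ => ?_)
    simp [opKernel]
    ring

/-- The reproducing kernel Hilbert space of a real positive semidefinite kernel `k`: the
completion of the span of the functions `k x ·`. -/
def RKHSpace (k : Matrix X X ℝ) (hk : k.PosSemidef) : Type _ :=
  haveI : Fact (opKernel k).PosSemidef := ⟨opKernel_posSemidef hk⟩
  RKHS.OfKernel (opKernel k)

variable (k : Matrix X X ℝ) (hk : k.PosSemidef)

instance : NormedAddCommGroup (RKHSpace k hk) :=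
  haveI : Fact (opKernel k).PosSemidef := ⟨opKernel_posSemidef hk⟩
  inferInstanceAs (NormedAddCommGroup (RKHS.OfKernel (opKernel k)))

instance : InnerProductSpace ℝ (RKHSpace k hk) :=
  haveI : Fact (opKernel k).PosSemidef := ⟨opKernel_posSemidef hk⟩
  inferInstanceAs (InnerProductSpace ℝ (RKHS.OfKernel (opKernel k)))

instance : CompleteSpace (RKHSpace k hk) :=
  haveI : Fact (opKernel k).PosSemidef := ⟨opKernel_posSemidef hk⟩
  inferInstanceAs (CompleteSpace (RKHS.OfKernel (opKernel k)))

instance : RKHS ℝ (RKHSpace k hk) X ℝ :=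
  haveI : Fact (opKernel k).PosSemidef := ⟨opKernel_posSemidef hk⟩
  inferInstanceAs (RKHS ℝ (RKHS.OfKernel (opKernel k)) X ℝ)

/-- The function `k x ·`, as an element of the reproducing kernel Hilbert space of `k`. -/
def kerSection (x : X) : RKHSpace k hk := RKHS.kerFun (RKHSpace k hk) x 1

/-- Reproducing property. -/
theorem inner_kerSection (x : X) (φ : RKHSpace k hk) :
    inner ℝ (kerSection k hk x) φ = φ x := by
  simp [kerSection]

theorem kerSection_apply (x y : X) : kerSection k hk x y = k x y := by
  have : Fact (opKernel k).PosSemidef := ⟨opKernel_posSemidef hk⟩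
  have h : RKHS.kernel (RKHSpace k hk) = opKernel k :=
    RKHS.OfKernel.kernel_ofKernel (K := opKernel k)
  have hs := hk.isHermitian.apply x y
  simp only [star_trivial] at hs
  simp [kerSection, RKHS.kerFun_apply, h, opKernel, hs]

end RKHSpace

/-! ### Absolutely continuous curves -/

/-- The curve `y`, on the interval `I` of the real line, is `p`-absolutely continuous for the
(extended) distance `d`: for some `m ∈ L^p(I)` one has `d (y s) (y t) ≤ ∫ₛᵗ m` whenever `s ≤ t`. -/
def IsACCurve {Y : Type*} (p : ℝ≥0∞) (I : Set ℝ) (d : Y → Y → ℝ≥0∞) (y : ℝ → Y) : Prop :=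
  ∃ m : ℝ → ℝ, MemLp m p (volume.restrict I) ∧
    ∀ s ∈ I, ∀ t ∈ I, s ≤ t → d (y s) (y t) ≤ ENNReal.ofReal (∫ r in s..t, m r)

/-- The curve `x` on `[a, b]` is (the continuous representative of) an element of the Sobolev
space `H¹([a, b]; H)`: it is a primitive of an element of `L²([a, b]; H)`. -/
def IsSobolevCurve {H : Type*} [NormedAddCommGroup H] [NormedSpace ℝ H] (a b : ℝ)
    (x : ℝ → H) : Prop :=
  ∃ v : ℝ → H, MemLp v 2 (volume.restrict (Icc a b)) ∧
    ∀ t ∈ Icc a b, x t = x a + ∫ s in a..t, v s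

/-! ### The cost, the Schrödinger potential and the kernels -/

/-- The regularization parameter `ε > 0` and a continuous, symmetric, non-negative cost `c` such
that `exp (-c / ε)` is a positive (semi)definite kernel. -/
structure Cost (X : Type*) [TopologicalSpace X] where
  ε : ℝ
  ε_pos : 0 < ε
  c : C(X × X, ℝ)
  symm : ∀ x y, c (x, y) = c (y, x)
  nonneg : ∀ x y, 0 ≤ c (x, y)
  posSemidef : Matrix.PosSemidef (Matrix.of fun x y : X => Real.exp (-c (x, y) / ε))

namespace Cost

variable {X : Type*} [MetricSpace X]
variable (S : Cost X)

/-- The kernel `k_c = exp (-c / ε)`. -/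
def kc : Matrix X X ℝ := Matrix.of fun x y : X => Real.exp (-S.c (x, y) / S.ε)

theorem kc_posSemidef : S.kc.PosSemidef := S.posSemidef

/-- The reproducing kernel Hilbert space `H_c` of `k_c`. -/
abbrev Hc : Type _ := RKHSpace S.kc S.kc_posSemidef

/-- `k_c` is universal: `H_c` is dense in `C(X)` for the uniform norm. -/
def IsUniversal : Prop :=
  ∀ ψ : C(X, ℝ), ∀ δ > 0, ∃ φ : S.Hc, ∀ x, |φ x - ψ x| < δ

variable [MeasurableSpace X]

/-- The Sinkhorn mapping
`T_ε(f, μ)(y) = -ε log ∫ exp ((f(x) - c(x, y)) / ε) dμ(x)`. -/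
def sinkhornMap (f : X → ℝ) (μ : ProbabilityMeasure X) (y : X) : ℝ :=
  -S.ε * Real.log (∫ x, Real.exp ((f x - S.c (x, y)) / S.ε) ∂(μ : Measure X))

open Classical in
/-- The self-transport Schrödinger potential `f_μ`: the continuous function with
`f_μ = T_ε(f_μ, μ)`, that is, the common value of the two Schrödinger potentials from `μ` to `μ`
when these are normalized to have the same integral. -/
def potential (μ : ProbabilityMeasure X) : C(X, ℝ) :=
  if h : ∃ f : C(X, ℝ), ∀ y, f y = S.sinkhornMap f μ y then h.choose else 0

/-- The self-transport kernel `k_μ(x, y) = exp ((f_μ(x) + f_μ(y) - c(x, y)) / ε)`. -/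
def kμ (μ : ProbabilityMeasure X) : Matrix X X ℝ :=
  Matrix.of fun x y => Real.exp ((S.potential μ x + S.potential μ y - S.c (x, y)) / S.ε)

theorem kμ_posSemidef (μ : ProbabilityMeasure X) : (S.kμ μ).PosSemidef := by
  set e : X → ℝ := fun x => Real.exp (S.potential μ x / S.ε) with he
  have hk : ∀ x y, S.kμ μ x y = e x * S.kc x y * e y := by
    intro x y
    simp only [kμ, kc, he, Matrix.of_apply, ← Real.exp_add]
    congr 1
    ring
  have hc : S.kc.PosSemidef := S.posSemidef
  refine ⟨?_, fun f => ?_⟩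
  · ext1 x y
    have h := hc.isHermitian.apply x y
    simp only [star_trivial] at h
    simp only [Matrix.conjTranspose_apply, star_trivial, hk, h]
    ring
  · have hne : ∀ x, e x ≠ 0 := fun x => (Real.exp_pos _).ne'
    have h := hc.2 (Finsupp.onFinset f.support (fun x => e x * f x) (by
      intro x hx
      simp only [ne_eq, mul_eq_zero, not_or] at hx
      simpa using hx.2))
    rw [Finsupp.onFinset_sum _ (by simp)] at h
    simp only [star_trivial] at h
    refine h.trans_eq ?_
    rw [Finsupp.sum]
    refine Finset.sum_congr rfl fun x _ => ?_
    rw [Finsupp.onFinset_sum _ (by simp), Finsupp.sum]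
    refine Finset.sum_congr rfl fun y _ => ?_
    rw [hk]
    simp
    ring

/-- The reproducing kernel Hilbert space `H_μ` of `k_μ`. -/
abbrev Hμ (μ : ProbabilityMeasure X) : Type _ := RKHSpace (S.kμ μ) (S.kμ_posSemidef μ)

/-- The integral operator `K_μ[φ](y) = ∫ k_μ(x, y) φ(x) dμ(x)`. -/
def K (μ : ProbabilityMeasure X) (φ : X → ℝ) (y : X) : ℝ :=
  ∫ x, S.kμ μ x y * φ x ∂(μ : Measure X)

/-- The Riesz representative `H_μ[σ] ∈ H_μ` of a continuous linear form `σ` on `H_μ`. -/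
def riesz (μ : ProbabilityMeasure X) (σ : StrongDual ℝ (S.Hμ μ)) : S.Hμ μ :=
  (InnerProductSpace.toDual ℝ (S.Hμ μ)).symm σ

/-- Modulo constants, `u = (Id - K_μ²)⁻¹ h`, i.e. `(Id - K_μ²) u = h` up to an additive constant.
The operator `Id - K_μ²` is a bijection modulo constants. -/
def IsInvIdSubKSq (μ : ProbabilityMeasure X) (u h : X → ℝ) : Prop :=
  ∃ a : ℝ, ∀ x, u x - S.K μ (S.K μ u) x = h x + a

/-- The embedding `B(μ) = H_c[exp (f_μ / ε) μ]` of the probability measures into `H_c`, as a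
Bochner integral in `H_c`. As a function on `X` it is `exp (-f_μ / ε)`. -/
def B (μ : ProbabilityMeasure X) : S.Hc :=
  ∫ x, Real.exp (S.potential μ x / S.ε) • kerSection S.kc S.kc_posSemidef x ∂(μ : Measure X)

/-! ### Tangent spaces, metric tensor and Riemannian distance -/

/-- The tangent space at `μ`: the continuous linear forms on `H_μ` that vanish on the constant
function `1` (which belongs to `H_μ`). -/
def tangentSpace (μ : ProbabilityMeasure X) : Set (StrongDual ℝ (S.Hμ μ)) :=
  {σ | ∀ φ : S.Hμ μ, (∀ x, φ x = 1) → σ φ = 0}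

open Classical in
/-- The metric tensor `g_μ(σ₁, σ₂) = (ε / 2) ⟨σ₁, (Id - K_μ²)⁻¹ H_μ[σ₂]⟩` for `σ₁, σ₂` in the
tangent space at `μ`. The inverse is taken modulo constants, which `σ₁` does not see. -/
def metricTensor (μ : ProbabilityMeasure X) (σ₁ σ₂ : StrongDual ℝ (S.Hμ μ)) : ℝ :=
  if h : ∃ u : S.Hμ μ, S.IsInvIdSubKSq μ u (S.riesz μ σ₂) then S.ε / 2 * σ₁ h.choose else 0

/-- The curve `γ` of probability measures has at time `t` the derivative `σ`, in the tangent space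
at `γ t`: for all `φ ∈ H_{γ t}`, the derivative at `t` of `s ↦ ∫ φ dγ_s` is `⟨σ, φ⟩`. -/
def HasVelocity (γ : ℝ → ProbabilityMeasure X) (t : ℝ)
    (σ : StrongDual ℝ (S.Hμ (γ t))) : Prop :=
  σ ∈ S.tangentSpace (γ t) ∧
    ∀ φ : S.Hμ (γ t), HasDerivAt (fun s => ∫ x, φ x ∂(γ s : Measure X)) (σ φ) t

/-- The Riemannian distance: `d_S(μ, ν)²` is the infimum of `∫₀¹ g_{γ_t}(γ'_t, γ'_t) dt` among the
curves `γ` from `μ` to `ν` with `B ∘ γ ∈ H¹([0, 1]; H_c)`. -/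
def dS (μ ν : ProbabilityMeasure X) : ℝ≥0∞ :=
  (sInf {A : ℝ≥0∞ | ∃ (γ : ℝ → ProbabilityMeasure X) (σ : ∀ t, StrongDual ℝ (S.Hμ (γ t))),
    IsSobolevCurve 0 1 (fun t => S.B (γ t)) ∧ γ 0 = μ ∧ γ 1 = ν ∧
    (∀ᵐ t ∂(volume.restrict (Icc (0 : ℝ) 1)), S.HasVelocity γ t (σ t)) ∧
    A = ∫⁻ t in Icc (0 : ℝ) 1, ENNReal.ofReal (S.metricTensor (γ t) (σ t) (σ t))}) ^ (1 / 2 : ℝ)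

/-! ### The flow -/

/-- The set `P μ` of admissible pressures: continuous functions `p ≤ 0` that vanish on the
support of `μ`. -/
def pressures (μ : ProbabilityMeasure X) : Set C(X, ℝ) :=
  {p | (∀ x, p x ≤ 0) ∧ ∀ x ∈ (μ : Measure X).support, p x = 0}

/-- A curve indexed by `[0, ∞)`, extended to a curve on the real line (constant for `t ≤ 0`). -/
def extend (μ : ℝ≥0 → ProbabilityMeasure X) (t : ℝ) : ProbabilityMeasure X := μ t.toNNReal

/-- `μ` is a Sinkhorn potential flow of `V` starting from `μ₀`: it is in
`AC²_loc([0, ∞); (P(X), d_S))`, starts at `μ₀`, and for almost every `t` its derivative `σ` at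
`t` lies in the tangent space at `μ_t` and satisfies
`(ε / 2) (Id - K_{μ_t}²)⁻¹ H_{μ_t}[σ] + V + P μ_t ∋ 0` in `C(X) / ℝ`. -/
structure IsFlow (V : C(X, ℝ)) (μ₀ : ProbabilityMeasure X)
    (μ : ℝ≥0 → ProbabilityMeasure X) : Prop where
  ac : ∀ T : ℝ, 0 ≤ T → IsACCurve 2 (Icc 0 T) S.dS (extend μ)
  init : μ 0 = μ₀
  eq : ∀ᵐ t : ℝ, 0 < t → ∃ σ : StrongDual ℝ (S.Hμ (extend μ t)),
    S.HasVelocity (extend μ) t σ ∧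
    ∃ u : C(X, ℝ), S.IsInvIdSubKSq (extend μ t) u (S.riesz (extend μ t) σ) ∧
    ∃ p ∈ pressures (extend μ t), ∃ C : ℝ, ∀ x, S.ε / 2 * u x + V x + p x = C

end Cost

/-- The potential energy `E(μ) = ∫ V dμ`. -/
def energy {X : Type*} [MetricSpace X] [MeasurableSpace X] (V : C(X, ℝ))
    (μ : ProbabilityMeasure X) : ℝ :=
  ∫ x, V x ∂(μ : Measure X)

end Sinkhorn

end

/-!
The map `B` embeds the probability measures homeomorphically onto a closed part of the unit sphere
of `H_c`: it is `B μ = emb (alpha μ)` with `alpha μ = exp (f_μ / ε) μ` and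
`emb α = ∫ k_c(x, ·) dα(x)`, and `exists_alpha_eq` shows that every positive measure `α` with
`‖emb α‖ = 1` is `alpha μ` for the measure `μ = emb(α) α`. In this picture the flow is the
gradient-like flow of a maximal monotone operator in the Hilbert space `H_c`, which is why it is
unique and non-expansive.

More precisely, multiplication by `exp (f_μ / ε) = 1 / B(μ)` is an isometry `Theta` of `H_c` onto
`H_μ`, which conjugates `K_μ` with the operator `T`. If `B ∘ γ` has derivative `w` at `t`, the
velocity of `γ` at `t` exists, and its Riesz representative is `Theta (w + T w)`
(`hasVelocity_iff`). Hence `(Id - K_μ²)⁻¹` applied to it is `Theta U` with `U - T U = w`. The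
kernel of `K_μ` is bounded from below, so that `T` has a spectral gap on the orthogonal of `B(μ)`
which does not depend on `μ`, and the metric tensor is comparable with `‖w‖²`. Therefore absolutely
continuous curves for `d_S` are absolutely continuous curves for the distance of the embeddings,
and conversely, after a reparametrization. Inserting the formula for `U` in the equation of the
flow turns it into the condition `IsFlowDirection`: with `α = alpha μ`,
`w + (2 / ε) (V emb α - ∫ V(x) k_c(x, ·) dα(x)) ≥ 0` on `X` and `⟪w, emb α⟫ = 0`. The operator
`emb α ↦ V emb α - ∫ V(x) k_c(x, ·) dα(x)` is antisymmetric, and the inequality and the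
orthogonality express that the remainder is in the normal cone of the cone of all `emb α`. This is
monotone (`IsFlowDirection.inner_sub_nonpos`), which gives the contraction property
`IsEvolution.norm_sub_le`.

Applied to time translates of one curve, contraction shows that the speed is non-increasing, so the
curve is Lipschitz away from `t = 0`. For a flow direction `w` at `μ` the function
`V + (ε / 2) Theta U` is non-negative and vanishes on the support of `μ`; thus
`s ↦ E(γ_s) + (ε / 2) ∫ Theta U dγ_s` is minimal at `s = t`, and its derivative vanishes, which is
the energy identity. It bounds `‖w_t‖²` by a multiple of `1 / t`. Evaluating the inequality of a
flow direction at a minimizer of `V` bounds `E(γ_t) - min V` by a multiple of `‖w_t‖`, whence the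
long-term behavior.

For existence, the resolvent equation is a linear complementarity problem when the measures are
restricted to finitely many points. It is solved by Banach's fixed point theorem after a small
coercive perturbation, and a compactness argument removes both restrictions (`exists_resolvent`).
Implicit Euler schemes from an initial point that admits a flow direction have non-increasing speed
and converge, along an ultrafilter, to an evolution. Such initial points are dense, and contraction
together with the uniform smoothing bound allows to pass to arbitrary initial measures
(`exists_isEvolution`).
-/

open MeasureTheory Filter Topology Set
open scoped ENNReal NNReal

set_option linter.unusedSectionVars false

noncomputable section

namespace Sinkhorn

/-! ### Kernel sections and rescaled kernels -/

section RKHSpace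

variable {X : Type*} (k : Matrix X X ℝ) (hk : k.PosSemidef)

theorem inner_kerSection_kerSection (x y : X) :
    inner ℝ (kerSection k hk x) (kerSection k hk y) = k x y := by
  rw [inner_kerSection, kerSection_apply]
  simpa using hk.isHermitian.apply x y

theorem denseRange_linearCombination_kerSection {e : X → ℝ} (he : ∀ x, e x ≠ 0) :
    DenseRange (Finsupp.linearCombination ℝ fun x => e x • kerSection k hk x) := by
  have h : (LinearMap.range
      (Finsupp.linearCombination ℝ fun x => e x • kerSection k hk x)).topologicalClosure = ⊤ := by
    rw [Submodule.topologicalClosure_eq_top_iff, Submodule.eq_bot_iff]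
    intro φ hφ
    refine RKHS.ext fun x => ?_
    have h1 : inner ℝ (e x • kerSection k hk x) φ = 0 := by
      refine (Submodule.mem_orthogonal _ _).1 hφ _ ⟨Finsupp.single x 1, ?_⟩
      simp
    rw [inner_smul_left, inner_kerSection] at h1
    simpa [he x] using h1
  have h2 := Submodule.dense_iff_topologicalClosure_eq_top.2 h
  simpa only [DenseRange, LinearMap.coe_range] using h2

variable {k' : Matrix X X ℝ} (hk' : k'.PosSemidef)

theorem norm_linearCombination_rescale {e : X → ℝ}
    (h : ∀ x y, k' x y = e x * k x y * e y) (f : X →₀ ℝ) :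
    ‖Finsupp.linearCombination ℝ (fun x => (1 : ℝ) • kerSection k' hk' x)
        (LinearEquiv.refl ℝ (X →₀ ℝ) f)‖ =
      ‖Finsupp.linearCombination ℝ (fun x => e x • kerSection k hk x) f‖ := by
  have h2 : ∀ (K : Matrix X X ℝ) (hK : K.PosSemidef) (d : X → ℝ),
      ‖Finsupp.linearCombination ℝ (fun x => d x • kerSection K hK x) f‖ ^ 2 =
      f.sum fun x a => f.sum fun y c => a * c * (d x * K x y * d y) := by
    intro K hK d
    rw [← real_inner_self_eq_norm_sq, Finsupp.linearCombination_apply]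
    simp only [Finsupp.sum, sum_inner, inner_sum, inner_smul_left, inner_smul_right,
      inner_kerSection_kerSection, conj_trivial, Finset.mul_sum]
    rw [Finset.sum_comm]
    refine Finset.sum_congr rfl fun x _ => Finset.sum_congr rfl fun y _ => ?_
    ring
  rw [← sq_eq_sq₀ (norm_nonneg _) (norm_nonneg _), h2, LinearEquiv.refl_apply, h2]
  simp [h]

variable {k} in
/-- If `k' x y = e x * k x y * e y` with `e` nowhere zero, multiplication by `e` is an isometry
between the reproducing kernel Hilbert spaces of `k` and `k'`. -/
def rescale {e : X → ℝ} (he : ∀ x, e x ≠ 0) (h : ∀ x y, k' x y = e x * k x y * e y) :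
    RKHSpace k hk ≃ₗᵢ[ℝ] RKHSpace k' hk' :=
  LinearEquiv.extendOfIsometry (LinearEquiv.refl ℝ (X →₀ ℝ))
    (Finsupp.linearCombination ℝ fun x => e x • kerSection k hk x)
    (Finsupp.linearCombination ℝ fun x => (1 : ℝ) • kerSection k' hk' x)
    (denseRange_linearCombination_kerSection k hk he)
    (denseRange_linearCombination_kerSection k' hk' fun _ => one_ne_zero)
    (norm_linearCombination_rescale k hk hk' h)

theorem rescale_apply {e : X → ℝ} (he : ∀ x, e x ≠ 0)
    (h : ∀ x y, k' x y = e x * k x y * e y) (φ : RKHSpace k hk) (x : X) :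
    rescale hk hk' he h φ x = e x * φ x := by
  have h1 : rescale hk hk' he h (e x • kerSection k hk x) = kerSection k' hk' x := by
    have h2 := LinearEquiv.extendOfIsometry_eq (LinearEquiv.refl ℝ (X →₀ ℝ)) _ _
      (denseRange_linearCombination_kerSection k hk he)
      (denseRange_linearCombination_kerSection k' hk' fun _ => one_ne_zero)
      (norm_linearCombination_rescale k hk hk' h) (Finsupp.single x 1)
    simpa [rescale] using h2
  rw [← inner_kerSection k' hk', ← h1, LinearIsometryEquiv.inner_map_map, inner_smul_left,
    inner_kerSection]
  simp

end RKHSpace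

/-! ### Integration of continuous functions against finite measures -/

section Pairing

variable {X : Type*} [MetricSpace X] [CompactSpace X] [MeasurableSpace X] [BorelSpace X]

theorem integrable_continuousMap (α : FiniteMeasure X) (ψ : C(X, ℝ)) :
    Integrable ψ (α : Measure X) :=
  ψ.continuous.integrable_of_hasCompactSupport (HasCompactSupport.of_compactSpace _)

theorem abs_integral_le (α : FiniteMeasure X) (ψ : C(X, ℝ)) :
    |∫ x, ψ x ∂(α : Measure X)| ≤ α.mass * ‖ψ‖ := by
  have h := norm_integral_le_of_norm_le_const (μ := (α : Measure X))
    (Eventually.of_forall fun x => ψ.norm_coe_le_norm x)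
  rw [Real.norm_eq_abs] at h
  rw [mul_comm]
  exact h

/-- The pairing of finite measures and continuous functions is jointly continuous. -/
theorem continuous_integral_pairing :
    Continuous fun p : FiniteMeasure X × C(X, ℝ) => ∫ x, p.2 x ∂(p.1 : Measure X) := by
  rw [continuous_iff_continuousAt]
  rintro ⟨α, ψ⟩
  have h1 : Tendsto (fun p : FiniteMeasure X × C(X, ℝ) => (p.1.mass : ℝ) * ‖p.2 - ψ‖)
      (𝓝 (α, ψ)) (𝓝 0) := by
    have : Continuous fun p : FiniteMeasure X × C(X, ℝ) => (p.1.mass : ℝ) * ‖p.2 - ψ‖ := by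
      have := FiniteMeasure.continuous_mass (Ω := X)
      fun_prop
    simpa using this.tendsto (α, ψ)
  have h2 : Tendsto (fun p : FiniteMeasure X × C(X, ℝ) => ∫ x, ψ x ∂(p.1 : Measure X))
      (𝓝 (α, ψ)) (𝓝 (∫ x, ψ x ∂(α : Measure X))) :=
    ((FiniteMeasure.continuous_integral_continuousMap ψ).comp continuous_fst).tendsto (α, ψ)
  have h3 : Tendsto (fun p : FiniteMeasure X × C(X, ℝ) => ∫ x, (p.2 - ψ) x ∂(p.1 : Measure X))
      (𝓝 (α, ψ)) (𝓝 0) :=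
    squeeze_zero_norm (fun p => abs_integral_le p.1 (p.2 - ψ)) h1
  have h4 := h3.add h2
  rw [zero_add] at h4
  refine h4.congr fun p => ?_
  have h5 : ∫ x, (p.2 - ψ) x ∂(p.1 : Measure X) =
      ∫ x, p.2 x ∂(p.1 : Measure X) - ∫ x, ψ x ∂(p.1 : Measure X) :=
    integral_sub (integrable_continuousMap p.1 p.2) (integrable_continuousMap p.1 ψ)
  rw [h5]; ring

theorem finiteMeasure_ext_of_integral_eq {α β : FiniteMeasure X}
    (h : ∀ ψ : C(X, ℝ), ∫ x, ψ x ∂(α : Measure X) = ∫ x, ψ x ∂(β : Measure X)) : α = β :=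
  FiniteMeasure.ext_of_forall_integral_eq fun f => h f.toContinuousMap

theorem integral_const_one (α : FiniteMeasure X) :
    ∫ _x, (1 : ℝ) ∂(α : Measure X) = α.mass := by
  simp [FiniteMeasure.mass]

/-- Finite measures of bounded mass form a compact set for the weak topology. -/
theorem exists_tendsto_ultrafilter {ι : Type*} (l : Ultrafilter ι) (α : ι → FiniteMeasure X)
    (C : ℝ) (h : ∀ i, (α i).mass ≤ C) : ∃ β, Tendsto α l (𝓝 β) := by
  have hc := isCompact_setOfPred_finiteMeasure_le_of_compactSpace X C.toNNReal
  obtain ⟨β, -, hβ⟩ := hc.ultrafilter_le_nhds' (l.map α) (by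
    refine Ultrafilter.mem_map.2 (Filter.univ_mem' fun i => ?_)
    exact NNReal.le_toNNReal_of_coe_le (h i))
  exact ⟨β, hβ⟩

end Pairing

namespace Cost

variable {X : Type*} [MetricSpace X] (S : Cost X)

/-! ### The kernel `k_c` and its reproducing kernel Hilbert space -/

theorem kc_apply (x y : X) : S.kc x y = Real.exp (-S.c (x, y) / S.ε) := rfl

theorem kc_symm (x y : X) : S.kc x y = S.kc y x := by
  rw [kc_apply, kc_apply, S.symm]

theorem kc_pos (x y : X) : 0 < S.kc x y := Real.exp_pos _

theorem kc_le_one (x y : X) : S.kc x y ≤ 1 := by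
  rw [kc_apply, Real.exp_le_one_iff]
  exact div_nonpos_of_nonpos_of_nonneg (neg_nonpos.2 (S.nonneg x y)) S.ε_pos.le

/-- The kernel section `k_c(x, ·)`, as an element of `H_c`. -/
abbrev sec (x : X) : S.Hc := kerSection S.kc S.kc_posSemidef x

theorem inner_sec (x : X) (φ : S.Hc) : inner ℝ (S.sec x) φ = φ x := inner_kerSection _ _ _ _

theorem inner_sec_sec (x y : X) : inner ℝ (S.sec x) (S.sec y) = S.kc x y :=
  inner_kerSection_kerSection _ _ _ _

theorem continuous_kc : Continuous fun p : X × X => S.kc p.1 p.2 := by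
  simp only [kc_apply]
  have := S.c.continuous
  fun_prop

theorem continuous_sec : Continuous S.sec := by
  rw [continuous_iff_continuousAt]
  intro x
  have hk := S.continuous_kc
  have h : Tendsto (fun y => S.kc y y - 2 * S.kc y x + S.kc x x) (𝓝 x) (𝓝 0) := by
    have h1 : Continuous fun y => S.kc y y - 2 * S.kc y x + S.kc x x :=
      ((hk.comp (continuous_id.prodMk continuous_id)).sub
        (continuous_const.mul (hk.comp (continuous_id.prodMk continuous_const)))).add
        continuous_const
    have h2 := h1.tendsto x
    rwa [show S.kc x x - 2 * S.kc x x + S.kc x x = 0 by ring] at h2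
  rw [ContinuousAt, tendsto_iff_norm_sub_tendsto_zero]
  have h3 : ∀ y, ‖S.sec y - S.sec x‖ = Real.sqrt (S.kc y y - 2 * S.kc y x + S.kc x x) := by
    intro y
    rw [← inner_sec_sec, ← inner_sec_sec, ← inner_sec_sec, real_inner_self_eq_norm_sq,
      real_inner_self_eq_norm_sq, ← norm_sub_sq_real, Real.sqrt_sq (norm_nonneg _)]
  simp only [h3]
  simpa using h.sqrt

theorem norm_sec_le (x : X) : ‖S.sec x‖ ≤ 1 := by
  have h : ‖S.sec x‖ ^ 2 ≤ 1 := by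
    rw [← real_inner_self_eq_norm_sq, inner_sec_sec]
    exact S.kc_le_one x x
  nlinarith [norm_nonneg (S.sec x)]

theorem abs_apply_le (φ : S.Hc) (x : X) : |φ x| ≤ ‖φ‖ := by
  rw [← inner_sec]
  refine (abs_real_inner_le_norm _ _).trans ?_
  have := S.norm_sec_le x
  nlinarith [norm_nonneg φ]

theorem continuous_coe (φ : S.Hc) : Continuous φ := by
  have : (φ : X → ℝ) = fun x => inner ℝ (S.sec x) φ := by
    ext x; rw [inner_sec]
  rw [this]
  exact S.continuous_sec.inner continuous_const

variable [CompactSpace X]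

/-- The inclusion of `H_c` in `C(X)`. -/
def toC : S.Hc →L[ℝ] C(X, ℝ) :=
  LinearMap.mkContinuous
    { toFun := fun φ => ⟨φ, S.continuous_coe φ⟩
      map_add' := fun φ ψ => by ext x; simp
      map_smul' := fun a φ => by ext x; simp } 1 fun φ => by
    rw [one_mul]
    exact (ContinuousMap.norm_le _ (norm_nonneg _)).2 fun x => S.abs_apply_le φ x

@[simp]
theorem toC_apply (φ : S.Hc) (x : X) : S.toC φ x = φ x := rfl

theorem norm_toC_le (φ : S.Hc) : ‖S.toC φ‖ ≤ ‖φ‖ :=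
  (ContinuousMap.norm_le _ (norm_nonneg _)).2 fun x => S.abs_apply_le φ x

theorem denseRange_toC (hS : S.IsUniversal) : DenseRange S.toC := by
  intro ψ
  rw [Metric.mem_closure_iff]
  intro δ hδ
  obtain ⟨φ, hφ⟩ := hS ψ δ hδ
  refine ⟨S.toC φ, ⟨φ, rfl⟩, ?_⟩
  rw [dist_comm]
  exact (ContinuousMap.dist_lt_iff hδ).2 fun x => by
    rw [Real.dist_eq]; exact hφ x

instance : TopologicalSpace.SeparableSpace S.Hc := by
  have h1 : TopologicalSpace.IsSeparable (range S.sec) :=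
    TopologicalSpace.isSeparable_range S.continuous_sec
  have h2 := (h1.span (R := ℝ)).closure
  have h3 := denseRange_linearCombination_kerSection S.kc S.kc_posSemidef
    (e := fun _ => 1) fun _ => one_ne_zero
  simp only [one_smul] at h3
  have h4 : closure (Submodule.span ℝ (range S.sec) : Set S.Hc) = univ := by
    rw [← Finsupp.range_linearCombination, LinearMap.coe_range]
    exact h3.closure_range
  rw [h4] at h2
  exact TopologicalSpace.isSeparable_univ_iff.1 h2

/-- A positive lower bound of the kernel `k_c`. -/
def kmin : ℝ := Real.exp (-‖S.c‖ / S.ε)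

theorem kmin_pos : 0 < S.kmin := Real.exp_pos _

theorem kmin_le_kc (x y : X) : S.kmin ≤ S.kc x y := by
  rw [kc_apply, kmin, Real.exp_le_exp]
  have h := S.ε_pos
  have h1 := S.c.norm_coe_le_norm (x, y)
  have h2 := le_abs_self (S.c (x, y))
  rw [Real.norm_eq_abs] at h1
  gcongr
  linarith

theorem kmin_le_one [Nonempty X] : S.kmin ≤ 1 := by
  obtain ⟨x⟩ := ‹Nonempty X›
  exact (S.kmin_le_kc x x).trans (S.kc_le_one x x)

variable [MeasurableSpace X] [BorelSpace X]

/-! ### Kernel embeddings of measures with a continuous density -/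

/-- The kernel embedding `∫ ρ(x) k_c(x, ·) dα(x) ∈ H_c` of the signed measure `ρ α`. -/
def dens (α : FiniteMeasure X) (ρ : C(X, ℝ)) : S.Hc := ∫ x, ρ x • S.sec x ∂(α : Measure X)

/-- The kernel embedding `∫ k_c(x, ·) dα(x) ∈ H_c` of the measure `α`. -/
def emb (α : FiniteMeasure X) : S.Hc := S.dens α 1

theorem integrable_smul_sec (α : FiniteMeasure X) (ρ : C(X, ℝ)) :
    Integrable (fun x => ρ x • S.sec x) (α : Measure X) :=
  (ρ.continuous.smul S.continuous_sec).integrable_of_hasCompactSupport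
    (HasCompactSupport.of_compactSpace _)

theorem inner_dens (α : FiniteMeasure X) (ρ : C(X, ℝ)) (φ : S.Hc) :
    inner ℝ (S.dens α ρ) φ = ∫ x, ρ x * φ x ∂(α : Measure X) := by
  rw [real_inner_comm, dens, ← integral_inner (S.integrable_smul_sec α ρ)]
  refine integral_congr_ae (Eventually.of_forall fun x => ?_)
  simp only
  rw [inner_smul_right, real_inner_comm, inner_sec]

theorem inner_dens' (α : FiniteMeasure X) (ρ : C(X, ℝ)) (φ : S.Hc) :
    inner ℝ (S.dens α ρ) φ = ∫ x, (ρ * S.toC φ) x ∂(α : Measure X) := S.inner_dens α ρ φ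

theorem inner_emb (α : FiniteMeasure X) (φ : S.Hc) :
    inner ℝ (S.emb α) φ = ∫ x, φ x ∂(α : Measure X) := by
  rw [emb, inner_dens]; simp

theorem dens_apply (α : FiniteMeasure X) (ρ : C(X, ℝ)) (y : X) :
    S.dens α ρ y = ∫ x, ρ x * S.kc x y ∂(α : Measure X) := by
  rw [← inner_sec, real_inner_comm, inner_dens]
  simp only [sec, kerSection_apply, S.kc_symm y]

theorem emb_apply (α : FiniteMeasure X) (y : X) :
    S.emb α y = ∫ x, S.kc x y ∂(α : Measure X) := by
  rw [emb, dens_apply]; simp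

theorem dens_add (α : FiniteMeasure X) (ρ ρ' : C(X, ℝ)) :
    S.dens α (ρ + ρ') = S.dens α ρ + S.dens α ρ' := by
  simp only [dens, ContinuousMap.add_apply, add_smul]
  exact integral_add (S.integrable_smul_sec α ρ) (S.integrable_smul_sec α ρ')

theorem dens_smul (α : FiniteMeasure X) (a : ℝ) (ρ : C(X, ℝ)) :
    S.dens α (a • ρ) = a • S.dens α ρ := by
  simp only [dens, ContinuousMap.smul_apply, smul_assoc]
  exact integral_smul a _

theorem dens_sub (α : FiniteMeasure X) (ρ ρ' : C(X, ℝ)) :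
    S.dens α (ρ - ρ') = S.dens α ρ - S.dens α ρ' := by
  simp only [dens, ContinuousMap.sub_apply, sub_smul]
  exact integral_sub (S.integrable_smul_sec α ρ) (S.integrable_smul_sec α ρ')

theorem continuous_toC_dens :
    Continuous fun p : FiniteMeasure X × C(X, ℝ) => S.toC (S.dens p.1 p.2) := by
  refine ContinuousMap.continuous_of_continuous_uncurry _ ?_
  have h : (Function.uncurry fun (p : FiniteMeasure X × C(X, ℝ)) (y : X) =>
      S.toC (S.dens p.1 p.2) y) = fun q : (FiniteMeasure X × C(X, ℝ)) × X =>
        ∫ x, (q.1.2 * S.toC (S.sec q.2)) x ∂(q.1.1 : Measure X) := by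
    ext ⟨p, y⟩
    simp only [Function.uncurry_apply_pair, toC_apply]
    rw [← inner_dens', real_inner_comm, inner_sec]
  rw [h]
  have h2 : Continuous fun y : X => S.toC (S.sec y) := S.toC.continuous.comp S.continuous_sec
  exact continuous_integral_pairing.comp
    ((continuous_fst.comp continuous_fst).prodMk
      ((continuous_snd.comp continuous_fst).mul (h2.comp continuous_snd)))

theorem continuous_dens :
    Continuous fun p : FiniteMeasure X × C(X, ℝ) => S.dens p.1 p.2 := by
  rw [continuous_iff_continuousAt]
  intro p₀
  have h1 : Continuous fun p : FiniteMeasure X × C(X, ℝ) =>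
      inner ℝ (S.dens p.1 p.2) (S.dens p.1 p.2) := by
    simp only [inner_dens']
    exact continuous_integral_pairing.comp
      (continuous_fst.prodMk (continuous_snd.mul S.continuous_toC_dens))
  have h2 : Continuous fun p : FiniteMeasure X × C(X, ℝ) =>
      inner ℝ (S.dens p.1 p.2) (S.dens p₀.1 p₀.2) := by
    simp only [inner_dens']
    exact continuous_integral_pairing.comp
      (continuous_fst.prodMk (continuous_snd.mul continuous_const))
  rw [ContinuousAt, tendsto_iff_norm_sub_tendsto_zero]
  have h3 : ∀ p : FiniteMeasure X × C(X, ℝ), ‖S.dens p.1 p.2 - S.dens p₀.1 p₀.2‖ =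
      Real.sqrt (inner ℝ (S.dens p.1 p.2) (S.dens p.1 p.2) -
        2 * inner ℝ (S.dens p.1 p.2) (S.dens p₀.1 p₀.2) +
        inner ℝ (S.dens p₀.1 p₀.2) (S.dens p₀.1 p₀.2)) := by
    intro p
    rw [real_inner_self_eq_norm_sq, real_inner_self_eq_norm_sq, ← norm_sub_sq_real,
      Real.sqrt_sq (norm_nonneg _)]
  -- the squared distance is a combination of pairings that are continuous in `p`
  simp only [h3]
  have h4 := (((h1.sub ((continuous_const (y := (2 : ℝ))).mul h2)).add
    (continuous_const (y := inner ℝ (S.dens p₀.1 p₀.2) (S.dens p₀.1 p₀.2)))).sqrt).tendsto p₀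
  simp only [Pi.add_apply, Pi.sub_apply, Pi.mul_apply] at h4
  rwa [Real.sqrt_eq_zero'.2 (by linarith)] at h4

theorem continuous_emb : Continuous S.emb :=
  S.continuous_dens.comp (continuous_id.prodMk continuous_const)

/-- Universality of the kernel is used here. -/
theorem emb_injective (hS : S.IsUniversal) : Function.Injective S.emb := by
  intro α β h
  refine finiteMeasure_ext_of_integral_eq fun ψ => ?_
  have hc : ∀ γ : FiniteMeasure X, Continuous fun ψ : C(X, ℝ) => ∫ x, ψ x ∂(γ : Measure X) :=
    fun γ => continuous_integral_pairing.comp (continuous_const.prodMk continuous_id)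
  refine (S.denseRange_toC hS).induction_on ψ (isClosed_eq (hc α) (hc β)) fun φ => ?_
  have := congrArg (fun z => inner ℝ z φ) h
  simp only [inner_emb] at this
  exact this

theorem kmin_mul_mass_le_emb (α : FiniteMeasure X) (y : X) : S.kmin * α.mass ≤ S.emb α y := by
  rw [emb_apply, ← integral_const_one, ← integral_const_mul]
  refine integral_mono (integrable_const _) ?_ fun x => ?_
  · exact integrable_continuousMap α ⟨fun x => S.kc x y,
      S.continuous_kc.comp (continuous_id.prodMk continuous_const)⟩
  · simpa using S.kmin_le_kc x y

theorem kmin_mul_mass_sq_le (α : FiniteMeasure X) : S.kmin * α.mass ^ 2 ≤ ‖S.emb α‖ ^ 2 := by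
  rw [← real_inner_self_eq_norm_sq, inner_emb]
  calc S.kmin * (α.mass : ℝ) ^ 2 = ∫ _x, S.kmin * α.mass ∂(α : Measure X) := by
        rw [integral_const, smul_eq_mul]
        simp only [measureReal_def]
        change _ = (α.mass : ℝ) * _
        ring
    _ ≤ _ := integral_mono (integrable_const _) (integrable_continuousMap α (S.toC (S.emb α)))
        fun x => S.kmin_mul_mass_le_emb α x

theorem norm_emb_le (α : FiniteMeasure X) : ‖S.emb α‖ ≤ α.mass := by
  have h := norm_integral_le_of_norm_le_const (μ := (α : Measure X)) (C := 1)
    (f := fun x => (1 : C(X, ℝ)) x • S.sec x)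
    (Eventually.of_forall fun x => by simpa using S.norm_sec_le x)
  rw [one_mul] at h
  exact h

/-- A bound for the mass of a measure with kernel embedding of norm at most `r`. -/
theorem mass_le (α : FiniteMeasure X) {r : ℝ} (h : ‖S.emb α‖ ≤ r) :
    α.mass ≤ r / Real.sqrt S.kmin := by
  have hk := S.kmin_pos
  rw [le_div_iff₀ (Real.sqrt_pos.2 hk)]
  have h1 := S.kmin_mul_mass_sq_le α
  refine le_trans ?_ h
  refine abs_le_of_sq_le_sq' ?_ (norm_nonneg _) |>.2
  rw [mul_pow, Real.sq_sqrt hk.le]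
  linarith

end Cost

/-! ### Measures with a continuous density -/

section WithDens

variable {X : Type*} [MetricSpace X] [CompactSpace X] [MeasurableSpace X] [BorelSpace X]

/-- The finite measure `ρ α`, for a continuous density `ρ ≥ 0`. -/
def withDens (α : FiniteMeasure X) (ρ : C(X, ℝ)) : FiniteMeasure X :=
  ⟨(α : Measure X).withDensity fun x => ENNReal.ofReal (ρ x),
    isFiniteMeasure_withDensity_ofReal (integrable_continuousMap α ρ).2⟩

theorem integral_withDens (α : FiniteMeasure X) {ρ : C(X, ℝ)} (hρ : ∀ x, 0 ≤ ρ x) (ψ : X → ℝ) :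
    ∫ x, ψ x ∂(withDens α ρ : Measure X) = ∫ x, ρ x * ψ x ∂(α : Measure X) := by
  have h : ((withDens α ρ : FiniteMeasure X) : Measure X) =
      (α : Measure X).withDensity fun x => ENNReal.ofReal (ρ x) := rfl
  rw [h, integral_withDensity_eq_integral_toReal_smul
    (f := fun x => ENNReal.ofReal (ρ x))
    (ENNReal.measurable_ofReal.comp ρ.continuous.measurable) (by simp)]
  simp only [ENNReal.toReal_ofReal (hρ _), smul_eq_mul]

end WithDens

namespace Cost

variable {X : Type*} [MetricSpace X] [CompactSpace X] [MeasurableSpace X] [BorelSpace X]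
variable (S : Cost X)

/-! ### The Schrödinger potential -/

/-- The function `exp (f / ε)`. -/
def expC (f : C(X, ℝ)) : C(X, ℝ) := ⟨fun x => Real.exp (f x / S.ε), by fun_prop⟩

theorem expC_apply (f : C(X, ℝ)) (x : X) : S.expC f x = Real.exp (f x / S.ε) := rfl

theorem expC_pos (f : C(X, ℝ)) (x : X) : 0 < S.expC f x := Real.exp_pos _

theorem sinkhornMap_eq (f : C(X, ℝ)) (μ : ProbabilityMeasure X) (y : X) :
    S.sinkhornMap f μ y = -S.ε * Real.log (S.dens μ.toFiniteMeasure (S.expC f) y) := by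
  rw [sinkhornMap, dens_apply]
  congr 2
  refine integral_congr_ae (Eventually.of_forall fun x => ?_)
  simp only [expC_apply, kc_apply, ← Real.exp_add]
  congr 1
  ring

theorem dens_mono_of_nonneg (α : FiniteMeasure X) {ρ : C(X, ℝ)} (hρ : ∀ x, 0 ≤ ρ x) (y y' : X) :
    S.kmin * S.dens α ρ y' ≤ S.dens α ρ y := by
  have hi : ∀ y, Integrable (fun x => ρ x * S.kc x y) (α : Measure X) := fun y =>
    integrable_continuousMap α (ρ * ⟨fun x => S.kc x y,
      S.continuous_kc.comp (continuous_id.prodMk continuous_const)⟩)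
  rw [dens_apply, dens_apply, ← integral_const_mul]
  refine integral_mono ((hi y').const_mul _) (hi y) fun x => ?_
  have h1 := S.kmin_le_kc x y
  have h2 := S.kc_le_one x y'
  have h3 := S.kmin_pos
  have h4 := hρ x
  have h5 : S.kmin * S.kc x y' ≤ S.kc x y := by nlinarith
  calc S.kmin * (ρ x * S.kc x y') = ρ x * (S.kmin * S.kc x y') := by ring
    _ ≤ ρ x * S.kc x y := by gcongr

theorem dens_pos (μ : ProbabilityMeasure X) {ρ : C(X, ℝ)} (hρ : ∀ x, 0 < ρ x) (y : X) :
    0 < S.dens μ.toFiniteMeasure ρ y := by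
  rw [dens_apply]
  have hc : Continuous fun x => ρ x * S.kc x y :=
    ρ.continuous.mul (S.continuous_kc.comp (continuous_id.prodMk continuous_const))
  have hp : ∀ x, 0 < ρ x * S.kc x y := fun x => mul_pos (hρ x) (S.kc_pos x y)
  rw [integral_pos_iff_support_of_nonneg (fun x => (hp x).le)
    (integrable_continuousMap μ.toFiniteMeasure ⟨_, hc⟩)]
  have : Function.support (fun x => ρ x * S.kc x y) = univ := by
    ext x; simp [(hρ x).ne', (S.kc_pos x y).ne']
  rw [this]
  simp

/-- The Sinkhorn mapping contracts the oscillation. The probability measures with density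
`exp (g / ε) k_c(·, y)` with respect to `μ`, normalized, are for varying `y` bounded from below
by `kmin ^ 2` times one another. -/
theorem sinkhornMap_contraction (μ : ProbabilityMeasure X) (f g : C(X, ℝ)) {m M : ℝ}
    (hm : ∀ x, m ≤ f x - g x) (hM : ∀ x, f x - g x ≤ M) (y y' : X) :
    (S.sinkhornMap f μ y - S.sinkhornMap g μ y) -
      (S.sinkhornMap f μ y' - S.sinkhornMap g μ y') ≤ (1 - S.kmin ^ 2) * (M - m) := by
  have hε := S.ε_pos
  have : Nonempty X := ⟨y⟩
  have hk0 := S.kmin_pos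
  have hk1 := S.kmin_le_one
  set F := S.dens μ.toFiniteMeasure (S.expC f) with hF
  set G := S.dens μ.toFiniteMeasure (S.expC g) with hG
  have hFp : ∀ y, 0 < F y := S.dens_pos μ (S.expC_pos f)
  have hGp : ∀ y, 0 < G y := S.dens_pos μ (S.expC_pos g)
  set em := Real.exp (m / S.ε) with hem
  set eM := Real.exp (M / S.ε) with heM
  have hem0 : 0 < em := Real.exp_pos _
  have heM0 : 0 < eM := Real.exp_pos _
  have hlow : ∀ x, em * S.expC g x ≤ S.expC f x := by
    intro x
    rw [hem, expC_apply, expC_apply, ← Real.exp_add, Real.exp_le_exp, ← add_div]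
    have := hm x
    gcongr; linarith
  have hupp : ∀ x, S.expC f x ≤ eM * S.expC g x := by
    intro x
    rw [heM, expC_apply, expC_apply, ← Real.exp_add, Real.exp_le_exp, ← add_div]
    have := hM x
    gcongr; linarith
  -- the difference `F - em G` is the embedding of a positive measure
  have h1 : ∀ y y', S.kmin * (F y' - em * G y') ≤ F y - em * G y := by
    intro y y'
    have := S.dens_mono_of_nonneg μ.toFiniteMeasure (ρ := S.expC f - em • S.expC g)
      (fun x => by simpa using hlow x) y y'
    rw [dens_sub, dens_smul] at this
    simpa using this
  have h2 : S.kmin * G y ≤ G y' :=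
    S.dens_mono_of_nonneg μ.toFiniteMeasure (fun x => (S.expC_pos g x).le) y' y
  have h3 : F y' ≤ eM * G y' := by
    have : 0 ≤ S.dens μ.toFiniteMeasure (eM • S.expC g - S.expC f) y' := by
      rw [dens_apply]
      refine integral_nonneg fun x => mul_nonneg ?_ (S.kc_pos _ _).le
      simpa using hupp x
    rw [dens_sub, dens_smul] at this
    simpa using this
  have h0 : ∀ y, 0 ≤ F y - em * G y := by
    intro y
    have : 0 ≤ S.dens μ.toFiniteMeasure (S.expC f - em • S.expC g) y := by
      rw [dens_apply]
      refine integral_nonneg fun x => mul_nonneg ?_ (S.kc_pos _ _).le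
      simpa using hlow x
    rw [dens_sub, dens_smul] at this
    simpa using this
  have h4 : S.kmin ^ 2 * (F y' / G y') + (1 - S.kmin ^ 2) * em ≤ F y / G y := by
    have h5 : S.kmin ^ 2 * ((F y' - em * G y') / G y') ≤ (F y - em * G y) / G y := by
      rw [← mul_div_assoc, div_le_div_iff₀ (hGp y') (hGp y)]
      calc S.kmin ^ 2 * (F y' - em * G y') * G y
          = (S.kmin * (F y' - em * G y')) * (S.kmin * G y) := by ring
        _ ≤ (F y - em * G y) * G y' := by
          have := h0 y
          have := h0 y'
          have := (hGp y).le
          gcongr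
          exact h1 y y'
    have h6 : (F y' - em * G y') / G y' = F y' / G y' - em := by
      have := (hGp y').ne'; field_simp
    have h7 : (F y - em * G y) / G y = F y / G y - em := by
      have := (hGp y).ne'; field_simp
    rw [h6, h7] at h5
    linarith
  set r := F y / G y with hr
  set r' := F y' / G y' with hr'
  have hrp : 0 < r := div_pos (hFp y) (hGp y)
  have hrp' : 0 < r' := div_pos (hFp y') (hGp y')
  have h8 : r' ≤ eM := by rw [hr', div_le_iff₀ (hGp y')]; exact h3
  -- convexity of the exponential
  have h9 : Real.exp ((1 - S.kmin ^ 2) * ((m - M) / S.ε)) ≤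
      S.kmin ^ 2 + (1 - S.kmin ^ 2) * Real.exp ((m - M) / S.ε) := by
    have := convexOn_exp.2 (mem_univ 0) (mem_univ ((m - M) / S.ε)) (sq_nonneg S.kmin)
      (show 0 ≤ 1 - S.kmin ^ 2 by nlinarith) (by ring)
    simpa using this
  have h10 : r' * Real.exp ((1 - S.kmin ^ 2) * ((m - M) / S.ε)) ≤ r := by
    refine le_trans ?_ h4
    calc r' * Real.exp ((1 - S.kmin ^ 2) * ((m - M) / S.ε))
        ≤ r' * (S.kmin ^ 2 + (1 - S.kmin ^ 2) * Real.exp ((m - M) / S.ε)) := by gcongr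
      _ = S.kmin ^ 2 * r' + (1 - S.kmin ^ 2) * (r' * Real.exp ((m - M) / S.ε)) := by ring
      _ ≤ S.kmin ^ 2 * r' + (1 - S.kmin ^ 2) * (eM * Real.exp ((m - M) / S.ε)) := by
        have : 0 ≤ 1 - S.kmin ^ 2 := by nlinarith
        gcongr
      _ = _ := by
        rw [heM, hem, ← Real.exp_add]
        congr 3
        ring
  have h11 := Real.log_le_log (by positivity) h10
  rw [Real.log_mul hrp'.ne' (Real.exp_pos _).ne', Real.log_exp, hr, hr',
    Real.log_div (hFp y).ne' (hGp y).ne', Real.log_div (hFp y').ne' (hGp y').ne'] at h11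
  rw [sinkhornMap_eq, sinkhornMap_eq, sinkhornMap_eq, sinkhornMap_eq]
  simp only [← hF, ← hG]
  have h12 : S.ε * ((1 - S.kmin ^ 2) * ((m - M) / S.ε)) = (1 - S.kmin ^ 2) * (m - M) := by
    field_simp
  nlinarith

theorem sinkhornMap_contraction' (μ : ProbabilityMeasure X) (f g : C(X, ℝ)) {D : ℝ}
    (hD : ∀ x x', (f x - g x) - (f x' - g x') ≤ D) (y y' : X) :
    (S.sinkhornMap f μ y - S.sinkhornMap g μ y) -
      (S.sinkhornMap f μ y' - S.sinkhornMap g μ y') ≤ (1 - S.kmin ^ 2) * D := by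
  have : Nonempty X := ⟨y⟩
  obtain ⟨x₁, -, h1⟩ := isCompact_univ.exists_isMinOn univ_nonempty (f - g).continuous.continuousOn
  obtain ⟨x₂, -, h2⟩ := isCompact_univ.exists_isMaxOn univ_nonempty (f - g).continuous.continuousOn
  refine (S.sinkhornMap_contraction μ f g (fun x => isMinOn_iff.1 h1 x (mem_univ x))
    (fun x => isMaxOn_iff.1 h2 x (mem_univ x)) y y').trans ?_
  have h3 : 0 ≤ 1 - S.kmin ^ 2 := by
    have := S.kmin_pos; have := S.kmin_le_one; nlinarith
  exact mul_le_mul_of_nonneg_left (hD x₂ x₁) h3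

theorem sinkhornMap_add_const (μ : ProbabilityMeasure X) (f g : C(X, ℝ)) (a : ℝ)
    (h : ∀ x, f x = g x + a) (y : X) : S.sinkhornMap f μ y = S.sinkhornMap g μ y - a := by
  have hε := S.ε_pos.ne'
  have h1 : S.expC f = Real.exp (a / S.ε) • S.expC g := by
    ext x
    rw [ContinuousMap.smul_apply, expC_apply, expC_apply, h, smul_eq_mul, ← Real.exp_add]
    congr 1; ring
  rw [sinkhornMap_eq, sinkhornMap_eq, h1, dens_smul, RKHS.coe_smul, Pi.smul_apply, smul_eq_mul,
    Real.log_mul (Real.exp_pos _).ne' (S.dens_pos μ (S.expC_pos g) y).ne', Real.log_exp]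
  field_simp
  ring

theorem sinkhornMap_unique {μ : ProbabilityMeasure X} {f g : C(X, ℝ)}
    (hf : ∀ y, f y = S.sinkhornMap f μ y) (hg : ∀ y, g y = S.sinkhornMap g μ y) : f = g := by
  rcases isEmpty_or_nonempty X with h | h
  · ext x; exact (h.false x).elim
  obtain ⟨x₁, -, h1⟩ := isCompact_univ.exists_isMinOn univ_nonempty (f - g).continuous.continuousOn
  obtain ⟨x₂, -, h2⟩ := isCompact_univ.exists_isMaxOn univ_nonempty (f - g).continuous.continuousOn
  have h1' : ∀ x, f x₁ - g x₁ ≤ f x - g x := fun x => isMinOn_iff.1 h1 x (mem_univ x)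
  have h2' : ∀ x, f x - g x ≤ f x₂ - g x₂ := fun x => isMaxOn_iff.1 h2 x (mem_univ x)
  have h3 := S.sinkhornMap_contraction μ f g h1' h2' x₂ x₁
  rw [← hf, ← hf, ← hg, ← hg] at h3
  have h4 : (f x₂ - g x₂) - (f x₁ - g x₁) ≤ 0 := by
    have := S.kmin_pos
    by_contra! h5
    nlinarith [mul_pos (pow_pos this 2) h5]
  have h5 : ∀ x, f x = g x + (f x₁ - g x₁) := fun x => by
    have := h1' x; have := h2' x; linarith
  have h6 := S.sinkhornMap_add_const μ f g _ h5 x₁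
  rw [← hf, ← hg] at h6
  ext x
  have := h5 x
  linarith

/-- The Sinkhorn mapping as a self-map of `C(X)`, normalized to vanish at `x₀`. -/
def sinkhornC (μ : ProbabilityMeasure X) (x₀ : X) (f : C(X, ℝ)) : C(X, ℝ) :=
  ⟨fun y => S.sinkhornMap f μ y - S.sinkhornMap f μ x₀, by
    have : ∀ y, S.dens μ.toFiniteMeasure (S.expC f) y ≠ 0 :=
      fun y => (S.dens_pos μ (S.expC_pos f) y).ne'
    have h2 := S.continuous_coe (S.dens μ.toFiniteMeasure (S.expC f))
    simp only [sinkhornMap_eq]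
    exact (continuous_const.mul (h2.log this)).sub continuous_const⟩

/-- An iterate of the normalized Sinkhorn mapping is a contraction of `C(X)`, because the mapping
contracts the oscillation and its values vanish at a fixed point of `X`. -/
theorem exists_sinkhornMap_eq (μ : ProbabilityMeasure X) :
    ∃ f : C(X, ℝ), ∀ y, f y = S.sinkhornMap f μ y := by
  obtain ⟨x₀⟩ : Nonempty X := μ.nonempty
  have : Nonempty X := ⟨x₀⟩
  set Φ := S.sinkhornC μ x₀ with hΦ
  have hΦa : ∀ f y, Φ f y = S.sinkhornMap f μ y - S.sinkhornMap f μ x₀ := fun f y => rfl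
  set q := 1 - S.kmin ^ 2 with hq
  have hk0 := S.kmin_pos
  have hk1 := S.kmin_le_one
  have hq0 : 0 ≤ q := by nlinarith
  have hq1 : q < 1 := by nlinarith
  have hosc : ∀ n (f g : C(X, ℝ)) (x x' : X),
      (Φ^[n] f x - Φ^[n] g x) - (Φ^[n] f x' - Φ^[n] g x') ≤ q ^ n * (2 * ‖f - g‖) := by
    intro n
    induction n with
    | zero =>
      intro f g x x'
      have h1 := (abs_le.1 ((f - g).norm_coe_le_norm x)).2
      have h2 := (abs_le.1 ((f - g).norm_coe_le_norm x')).1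
      simp only [ContinuousMap.sub_apply] at h1 h2
      simp only [Function.iterate_zero, id_eq, pow_zero, one_mul]
      linarith
    | succ n ih =>
      intro f g x x'
      have h1 := S.sinkhornMap_contraction' μ _ _ (ih f g) x x'
      simp only [Function.iterate_succ', Function.comp, hΦa]
      rw [pow_succ]
      linarith
  have hzero : ∀ n f, Φ^[n + 1] f x₀ = 0 := by
    intro n f
    simp only [Function.iterate_succ', Function.comp, hΦa, sub_self]
  obtain ⟨n, hn⟩ := exists_pow_lt_of_lt_one (show (0 : ℝ) < 1 / 4 by norm_num) hq1
  have hn' : q ^ (n + 1) ≤ 1 / 4 := by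
    rw [pow_succ]
    nlinarith [pow_nonneg hq0 n]
  have hc : ContractingWith (1 / 2 : ℝ≥0) (Φ^[n + 1]) := by
    refine ⟨by norm_num [← NNReal.coe_lt_coe], LipschitzWith.of_dist_le_mul fun f g => ?_⟩
    rw [dist_eq_norm, dist_eq_norm]
    refine (ContinuousMap.norm_le _ (by positivity)).2 fun x => ?_
    have h1 := hosc (n + 1) f g x x₀
    have h2 := hosc (n + 1) f g x₀ x
    rw [hzero, hzero] at h1 h2
    have h3 : q ^ (n + 1) * (2 * ‖f - g‖) ≤ 1 / 4 * (2 * ‖f - g‖) := by gcongr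
    rw [ContinuousMap.sub_apply, Real.norm_eq_abs, abs_le]
    push_cast
    constructor <;> linarith
  obtain ⟨g, hg⟩ : ∃ g, Φ g = g := ⟨_, hc.isFixedPt_fixedPoint_iterate⟩
  have hg' : ∀ y, S.sinkhornMap g μ y - S.sinkhornMap g μ x₀ = g y := fun y => by
    rw [← hΦa, hg]
  -- `g` solves the equation up to a constant `a`, and `g + a / 2` solves it
  refine ⟨g + ContinuousMap.const X (S.sinkhornMap g μ x₀ / 2), fun y => ?_⟩
  rw [S.sinkhornMap_add_const μ (g + ContinuousMap.const X (S.sinkhornMap g μ x₀ / 2)) g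
    (S.sinkhornMap g μ x₀ / 2) (fun x => rfl)]
  have := hg' y
  simp only [ContinuousMap.add_apply, ContinuousMap.const_apply]
  linarith

theorem potential_eq (μ : ProbabilityMeasure X) (y : X) :
    S.potential μ y = S.sinkhornMap (S.potential μ) μ y := by
  have h := S.exists_sinkhornMap_eq μ
  have h2 : S.potential μ = h.choose := by rw [potential, dif_pos h]
  rw [h2]
  exact h.choose_spec y

/-! ### The embedding `B` of the probability measures in the unit sphere of `H_c` -/

/-- The measure `exp (f_μ / ε) μ`, whose kernel embedding is `B(μ)`. -/
def alpha (μ : ProbabilityMeasure X) : FiniteMeasure X :=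
  withDens μ.toFiniteMeasure (S.expC (S.potential μ))

theorem integral_alpha (μ : ProbabilityMeasure X) (ψ : X → ℝ) :
    ∫ x, ψ x ∂(S.alpha μ : Measure X) =
      ∫ x, S.expC (S.potential μ) x * ψ x ∂(μ : Measure X) :=
  integral_withDens _ (fun x => (S.expC_pos _ x).le) ψ

theorem dens_alpha (μ : ProbabilityMeasure X) (ρ : C(X, ℝ)) :
    S.dens (S.alpha μ) ρ = S.dens μ.toFiniteMeasure (S.expC (S.potential μ) * ρ) := by
  refine ext_inner_right ℝ fun φ => ?_
  rw [inner_dens, inner_dens, integral_alpha]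
  simp only [ContinuousMap.mul_apply, mul_assoc]
  rfl

theorem emb_alpha (μ : ProbabilityMeasure X) : S.emb (S.alpha μ) = S.B μ := by
  rw [emb, dens_alpha, mul_one]
  rfl

theorem B_apply (μ : ProbabilityMeasure X) (y : X) :
    S.B μ y = Real.exp (-S.potential μ y / S.ε) := by
  have h : S.dens μ.toFiniteMeasure (S.expC (S.potential μ)) = S.B μ := rfl
  have h1 := S.potential_eq μ y
  have hp := S.dens_pos μ (S.expC_pos (S.potential μ)) y
  rw [sinkhornMap_eq] at h1
  rw [h1, ← h]
  have hε := S.ε_pos.ne'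
  rw [show -(-S.ε * Real.log (S.dens μ.toFiniteMeasure (S.expC (S.potential μ)) y)) / S.ε =
    Real.log (S.dens μ.toFiniteMeasure (S.expC (S.potential μ)) y) by field_simp, Real.exp_log hp]

theorem B_pos (μ : ProbabilityMeasure X) (y : X) : 0 < S.B μ y := by
  rw [B_apply]; exact Real.exp_pos _

theorem expC_potential_mul_B (μ : ProbabilityMeasure X) (x : X) :
    S.expC (S.potential μ) x * S.B μ x = 1 := by
  rw [B_apply, expC_apply, ← Real.exp_add, ← add_div, add_neg_cancel, zero_div, Real.exp_zero]

/-- The measure `μ` is `B(μ) α` where `α = exp (f_μ / ε) μ`. -/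
theorem integral_eq_integral_alpha (μ : ProbabilityMeasure X) (ψ : X → ℝ) :
    ∫ x, ψ x ∂(μ : Measure X) = ∫ x, ψ x * S.B μ x ∂(S.alpha μ : Measure X) := by
  rw [integral_alpha]
  refine integral_congr_ae (Eventually.of_forall fun x => ?_)
  have := S.expC_potential_mul_B μ x
  linear_combination (-ψ x) * this

theorem norm_B (μ : ProbabilityMeasure X) : ‖S.B μ‖ = 1 := by
  have h : ‖S.B μ‖ ^ 2 = 1 := by
    rw [← real_inner_self_eq_norm_sq]
    nth_rw 1 [← emb_alpha]
    rw [inner_emb]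
    have := S.integral_eq_integral_alpha μ fun _ => 1
    simp only [one_mul] at this
    rw [← this]
    simp
  nlinarith [norm_nonneg (S.B μ)]

theorem norm_emb_alpha (μ : ProbabilityMeasure X) : ‖S.emb (S.alpha μ)‖ = 1 := by
  rw [emb_alpha, norm_B]

theorem B_le_one (μ : ProbabilityMeasure X) (y : X) : S.B μ y ≤ 1 := by
  rw [← S.norm_B μ]
  exact (le_abs_self _).trans (S.abs_apply_le _ _)

theorem one_le_mass_alpha (μ : ProbabilityMeasure X) : 1 ≤ ((S.alpha μ).mass : ℝ) := by
  rw [← S.norm_emb_alpha μ]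
  exact S.norm_emb_le _

theorem mass_alpha_le (μ : ProbabilityMeasure X) :
    (S.alpha μ).mass ≤ 1 / Real.sqrt S.kmin := S.mass_le _ (S.norm_emb_alpha μ).le

theorem kmin_le_B (μ : ProbabilityMeasure X) (y : X) : S.kmin ≤ S.B μ y := by
  rw [← emb_alpha]
  refine le_trans ?_ (S.kmin_mul_mass_le_emb _ y)
  have := S.one_le_mass_alpha μ
  have := S.kmin_pos
  nlinarith

/-- If the kernel embedding of `α` has norm one, then `μ = emb(α) α` is a probability measure
with potential `-ε log emb(α)`. -/
theorem exists_alpha_eq {α : FiniteMeasure X} (h : ‖S.emb α‖ = 1) :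
    ∃ μ : ProbabilityMeasure X, S.alpha μ = α := by
  have hα0 : 0 < (α.mass : ℝ) := by
    rcases (α.mass.2).lt_or_eq with h1 | h1
    · exact h1
    · have := S.norm_emb_le α
      rw [h] at this
      have h2 : (α.mass : ℝ) = 0 := h1.symm
      linarith
  have hp : ∀ x, 0 < S.emb α x := fun x =>
    lt_of_lt_of_le (mul_pos S.kmin_pos hα0) (S.kmin_mul_mass_le_emb α x)
  set β := withDens α (S.toC (S.emb α)) with hβ
  have hβi : ∀ ψ : X → ℝ, ∫ x, ψ x ∂(β : Measure X) = ∫ x, S.emb α x * ψ x ∂(α : Measure X) :=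
    fun ψ => integral_withDens α (fun x => (hp x).le) ψ
  have hβ1 : (β.mass : ℝ) = 1 := by
    rw [← integral_const_one, hβi]
    simp only [mul_one]
    rw [← inner_emb, real_inner_self_eq_norm_sq, h, one_pow]
  have hβp : IsProbabilityMeasure (β : Measure X) := by
    constructor
    rw [← FiniteMeasure.ennreal_mass]
    exact_mod_cast hβ1
  set μ : ProbabilityMeasure X := ⟨β, hβp⟩ with hμ
  have hμi : ∀ ψ : X → ℝ, ∫ x, ψ x ∂(μ : Measure X) = ∫ x, S.emb α x * ψ x ∂(α : Measure X) :=
    hβi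
  set f : C(X, ℝ) := ⟨fun x => -S.ε * Real.log (S.emb α x),
    continuous_const.mul ((S.continuous_coe _).log fun x => (hp x).ne')⟩ with hf
  have hε := S.ε_pos.ne'
  have hexp : ∀ x, S.emb α x * S.expC f x = 1 := by
    intro x
    have : f x / S.ε = -Real.log (S.emb α x) := by
      simp only [hf, ContinuousMap.coe_mk]; field_simp
    rw [expC_apply, this, Real.exp_neg, Real.exp_log (hp x), mul_inv_cancel₀ (hp x).ne']
  have hdens : S.dens μ.toFiniteMeasure (S.expC f) = S.emb α := by
    refine ext_inner_right ℝ fun φ => ?_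
    rw [inner_dens, inner_emb]
    refine (hμi _).trans ?_
    simp only [← mul_assoc, hexp, one_mul]
  have hpot : S.potential μ = f := by
    refine S.sinkhornMap_unique (S.potential_eq μ) fun y => ?_
    rw [sinkhornMap_eq, hdens]
    rfl
  refine ⟨μ, finiteMeasure_ext_of_integral_eq fun ψ => ?_⟩
  rw [integral_alpha, hpot, hμi]
  simp only [← mul_assoc, hexp, one_mul]

theorem B_injective (hS : S.IsUniversal) : Function.Injective S.B := by
  intro μ ν h
  have h1 : S.alpha μ = S.alpha ν := S.emb_injective hS (by rw [emb_alpha, emb_alpha, h])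
  have h2 : μ.toFiniteMeasure = ν.toFiniteMeasure := finiteMeasure_ext_of_integral_eq fun ψ => by
    have h3 := S.integral_eq_integral_alpha μ ψ
    have h4 := S.integral_eq_integral_alpha ν ψ
    rw [h1, h] at h3
    exact h3.trans h4.symm
  exact Subtype.ext (congrArg (fun α : FiniteMeasure X => (α : Measure X)) h2)

theorem tendsto_probabilityMeasure_iff {ι : Type*} {l : Filter ι} {μ : ι → ProbabilityMeasure X}
    {ν : ProbabilityMeasure X} : Tendsto μ l (𝓝 ν) ↔ ∀ ψ : C(X, ℝ),
      Tendsto (fun i => ∫ x, ψ x ∂(μ i : Measure X)) l (𝓝 (∫ x, ψ x ∂(ν : Measure X))) := by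
  rw [ProbabilityMeasure.tendsto_iff_forall_integral_tendsto]
  exact ⟨fun h ψ => h (BoundedContinuousFunction.mkOfCompact ψ), fun h f => h f.toContinuousMap⟩

/-- A weak limit of measures `alpha μ` has an embedding of norm one, so it is `alpha ν`, and `ν` is
the limit of the measures `μ` since `μ = B(μ) alpha μ`. -/
theorem continuous_alpha : Continuous S.alpha := by
  rw [continuous_iff_ultrafilter]
  intro μ g hg
  obtain ⟨β, hβ⟩ := exists_tendsto_ultrafilter g S.alpha _ S.mass_alpha_le
  have h1 : ‖S.emb β‖ = 1 := by
    have := (S.continuous_emb.norm.tendsto β).comp hβ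
    refine tendsto_nhds_unique this ?_
    simp only [Function.comp_def, norm_emb_alpha]
    exact tendsto_const_nhds
  obtain ⟨ν, hν⟩ := S.exists_alpha_eq h1
  have h2 : Tendsto (fun μ' : ProbabilityMeasure X => μ') g (𝓝 ν) := by
    rw [tendsto_probabilityMeasure_iff]
    intro ψ
    have h3 : Continuous fun α : FiniteMeasure X =>
        ∫ x, (ψ * S.toC (S.emb α)) x ∂(α : Measure X) :=
      continuous_integral_pairing.comp (continuous_id.prodMk
        (continuous_const.mul (S.toC.continuous.comp S.continuous_emb)))
    have h4 := (h3.tendsto β).comp hβ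
    rw [← hν] at h4
    simp only [Function.comp_def, emb_alpha] at h4
    rw [S.integral_eq_integral_alpha ν]
    refine h4.congr fun μ' => ?_
    rw [S.integral_eq_integral_alpha μ']
    rfl
  have h5 : μ = ν := tendsto_nhds_unique hg h2
  rw [h5, hν]
  exact hβ

theorem continuous_B : Continuous S.B := by
  have : S.B = fun μ => S.emb (S.alpha μ) := by ext1 μ; rw [emb_alpha]
  rw [this]
  exact S.continuous_emb.comp S.continuous_alpha

theorem isClosedEmbedding_B (hS : S.IsUniversal) : IsClosedEmbedding S.B :=
  S.continuous_B.isClosedEmbedding (S.B_injective hS)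

end Cost
namespace Cost

variable {X : Type*} [MetricSpace X] [CompactSpace X] [MeasurableSpace X] [BorelSpace X]
variable (S : Cost X)

/-! ### The self-transport operator on `H_c` -/

/-- The operator `K_μ`, transported to `H_c` by the isometry `φ ↦ φ / B(μ)` from `H_c` onto `H_μ`. -/
def T (μ : ProbabilityMeasure X) : S.Hc →L[ℝ] S.Hc where
  toFun φ := S.dens (S.alpha μ) (S.expC (S.potential μ) * S.toC φ)
  map_add' φ χ := by rw [map_add, mul_add, dens_add]
  map_smul' a φ := by rw [map_smul, mul_smul_comm, dens_smul]; rfl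
  cont := S.continuous_dens.comp
    (continuous_const.prodMk (continuous_const.mul S.toC.continuous))

theorem T_apply (μ : ProbabilityMeasure X) (φ : S.Hc) :
    S.T μ φ = S.dens (S.alpha μ) (S.expC (S.potential μ) * S.toC φ) := rfl

theorem inner_T (μ : ProbabilityMeasure X) (φ χ : S.Hc) :
    inner ℝ (S.T μ φ) χ =
      ∫ x, S.expC (S.potential μ) x * φ x * χ x ∂(S.alpha μ : Measure X) := by
  rw [T_apply, inner_dens]; rfl

theorem inner_T_comm (μ : ProbabilityMeasure X) (φ χ : S.Hc) :
    inner ℝ (S.T μ φ) χ = inner ℝ φ (S.T μ χ) := by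
  rw [real_inner_comm (S.T μ χ), inner_T, inner_T]
  congr 1; ext x; ring

theorem expC_mul_toC_B (μ : ProbabilityMeasure X) :
    S.expC (S.potential μ) * S.toC (S.B μ) = 1 := by
  ext x; exact S.expC_potential_mul_B μ x

theorem T_B (μ : ProbabilityMeasure X) : S.T μ (S.B μ) = S.B μ := by
  rw [T_apply, expC_mul_toC_B, ← emb_alpha]; rfl

/-- The Markov operator `K_μ` has kernel at least `c` with respect to `μ`: integrate
`(k_c(x, y) - c b(x) b(y)) (ψ(x) - ψ(y))² ≥ 0`, where `b = B(μ)`. -/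
theorem norm_dens_sq_le (μ : ProbabilityMeasure X) (ψ : C(X, ℝ)) {c : ℝ}
    (hc : ∀ x y, c * (S.B μ x * S.B μ y) ≤ S.kc x y) :
    ‖S.dens (S.alpha μ) ψ‖ ^ 2 ≤
      (1 - c) * ∫ x, ψ x * ψ x * S.B μ x ∂(S.alpha μ : Measure X) +
        c * (∫ x, ψ x * S.B μ x ∂(S.alpha μ : Measure X)) ^ 2 := by
  set α := S.alpha μ
  set b := S.toC (S.B μ)
  let L : C(X, ℝ) →ₗ[ℝ] ℝ :=
    { toFun := fun ψ => ∫ x, ψ x ∂(α : Measure X)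
      map_add' := fun φ ψ => integral_add (integrable_continuousMap α φ)
        (integrable_continuousMap α ψ)
      map_smul' := fun a φ => integral_const_mul a _ }
  have hLpos : ∀ φ : C(X, ℝ), (∀ x, 0 ≤ φ x) → 0 ≤ L φ := fun φ h => integral_nonneg h
  have hLdens : ∀ (ρ : C(X, ℝ)) (y : X), L (ρ * S.toC (S.sec y)) = S.dens α ρ y := by
    intro ρ y
    change ∫ x, (ρ * S.toC (S.sec y)) x ∂(α : Measure X) = _
    rw [← inner_dens', real_inner_comm, inner_sec]
  have hLinner : ∀ (ρ : C(X, ℝ)) (φ : S.Hc), L (ρ * S.toC φ) = inner ℝ (S.dens α ρ) φ :=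
    fun ρ φ => (S.inner_dens' α ρ φ).symm
  have hLb : L b = 1 := by
    have := hLinner 1 (S.B μ)
    rw [one_mul] at this
    refine this.trans ?_
    change inner ℝ (S.emb α) (S.B μ) = 1
    rw [emb_alpha, real_inner_self_eq_norm_sq, norm_B, one_pow]
  have hsec : ∀ y, L (S.toC (S.sec y)) = b y := by
    intro y
    have := hLdens 1 y
    rw [one_mul] at this
    refine this.trans ?_
    change S.emb α y = _
    rw [emb_alpha]; rfl
  set A := L (ψ * ψ * b)
  set M := L (ψ * b)
  have h1 : ∀ y, 0 ≤ (S.toC (S.dens α (ψ * ψ)) - (2 : ℝ) • (ψ * S.toC (S.dens α ψ)) + ψ * ψ * b -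
      c • (A • b - (2 * M) • (ψ * b) + ψ * ψ * b)) y := by
    intro y
    have h2 : 0 ≤ L ((S.toC (S.sec y) - (c * b y) • b) *
        ((ψ - ContinuousMap.const X (ψ y)) * (ψ - ContinuousMap.const X (ψ y)))) := by
      refine hLpos _ fun x => mul_nonneg ?_ (mul_self_nonneg _)
      have h3 : S.toC (S.sec y) x = S.kc x y := by
        rw [toC_apply, sec, kerSection_apply, kc_symm]
      have h4 := hc x y
      simp only [ContinuousMap.sub_apply, ContinuousMap.smul_apply, smul_eq_mul, h3, b, toC_apply]
      linarith
    have h5 : (S.toC (S.sec y) - (c * b y) • b) *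
        ((ψ - ContinuousMap.const X (ψ y)) * (ψ - ContinuousMap.const X (ψ y))) =
        ψ * ψ * S.toC (S.sec y) - (2 * ψ y) • (ψ * S.toC (S.sec y)) +
          (ψ y * ψ y) • S.toC (S.sec y) - (c * b y) • (ψ * ψ * b) +
          (2 * c * b y * ψ y) • (ψ * b) - (c * b y * (ψ y * ψ y)) • b := by
      ext x
      simp only [ContinuousMap.sub_apply, ContinuousMap.mul_apply, ContinuousMap.smul_apply,
        ContinuousMap.add_apply, ContinuousMap.const_apply, smul_eq_mul]
      ring
    rw [h5] at h2
    simp only [map_sub, map_add, map_smul, hLdens, hsec, hLb, smul_eq_mul] at h2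
    simp only [ContinuousMap.sub_apply, ContinuousMap.mul_apply, ContinuousMap.smul_apply,
        ContinuousMap.add_apply, smul_eq_mul, toC_apply]
    change 0 ≤ _ - _ + _ - c * b y * A + 2 * c * b y * ψ y * M - _ at h2
    linarith
  have h6 := hLpos _ h1
  have h7 : L (S.toC (S.dens α (ψ * ψ))) = A := by
    have h8 := hLinner 1 (S.dens α (ψ * ψ))
    rw [one_mul] at h8
    have h9 := hLinner (ψ * ψ) (S.B μ)
    refine h8.trans (Eq.trans ?_ h9.symm)
    rw [real_inner_comm]
    congr 1
    exact S.emb_alpha μ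
  have h8 : L (ψ * S.toC (S.dens α ψ)) = ‖S.dens α ψ‖ ^ 2 := by
    rw [hLinner, real_inner_self_eq_norm_sq]
  simp only [map_sub, map_add, map_smul, h7, h8, hLb, smul_eq_mul] at h6
  change 0 ≤ A - 2 * ‖S.dens α ψ‖ ^ 2 + A - c * (A * 1 - 2 * M * M + A) at h6
  change ‖S.dens α ψ‖ ^ 2 ≤ (1 - c) * A + c * M ^ 2
  nlinarith

theorem norm_T_sq_le' (μ : ProbabilityMeasure X) (φ : S.Hc) {c : ℝ}
    (hc : ∀ x y, c * (S.B μ x * S.B μ y) ≤ S.kc x y) :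
    ‖S.T μ φ‖ ^ 2 ≤ (1 - c) * inner ℝ (S.T μ φ) φ + c * inner ℝ (S.B μ) φ ^ 2 := by
  have h := S.norm_dens_sq_le μ (S.expC (S.potential μ) * S.toC φ) hc
  have h1 : ∀ x, S.expC (S.potential μ) x * φ x * S.B μ x = φ x := fun x => by
    have := S.expC_potential_mul_B μ x
    linear_combination φ x * this
  have h2 : ∀ x, (S.expC (S.potential μ) * S.toC φ) x * (S.expC (S.potential μ) * S.toC φ) x *
      S.B μ x = S.expC (S.potential μ) x * φ x * φ x := fun x => by
    have := h1 x
    simp only [ContinuousMap.mul_apply, toC_apply]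
    linear_combination S.expC (S.potential μ) x * φ x * this
  have h3 : ∀ x, (S.expC (S.potential μ) * S.toC φ) x * S.B μ x = φ x := h1
  simp only [h2, h3] at h
  rw [inner_T, ← emb_alpha, inner_emb]
  exact h

theorem norm_T_sq_le (μ : ProbabilityMeasure X) (φ : S.Hc) :
    ‖S.T μ φ‖ ^ 2 ≤ inner ℝ (S.T μ φ) φ := by
  have := S.norm_T_sq_le' μ φ (c := 0) fun x y => by rw [zero_mul]; exact (S.kc_pos x y).le
  linarith

theorem inner_T_nonneg (μ : ProbabilityMeasure X) (φ : S.Hc) : 0 ≤ inner ℝ (S.T μ φ) φ :=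
  (sq_nonneg _).trans (S.norm_T_sq_le μ φ)

theorem norm_T_le (μ : ProbabilityMeasure X) (φ : S.Hc) : ‖S.T μ φ‖ ≤ ‖φ‖ := by
  have h1 := S.norm_T_sq_le μ φ
  have h2 := real_inner_le_norm (S.T μ φ) φ
  by_contra! h
  nlinarith [norm_nonneg φ, norm_nonneg (S.T μ φ)]

/-- Spectral gap of `K_μ`, uniform in `μ`. -/
theorem norm_T_le_of_inner_eq_zero (μ : ProbabilityMeasure X) {φ : S.Hc}
    (h : inner ℝ (S.B μ) φ = 0) : ‖S.T μ φ‖ ≤ (1 - S.kmin) * ‖φ‖ := by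
  have : Nonempty X := μ.nonempty
  have hk0 := S.kmin_pos
  have hk1 := S.kmin_le_one
  have h1 := S.norm_T_sq_le' μ φ (c := S.kmin) fun x y => by
    refine le_trans ?_ (S.kmin_le_kc x y)
    have := S.B_pos μ x
    have := S.B_le_one μ x
    have := S.B_pos μ y
    have := S.B_le_one μ y
    have : S.B μ x * S.B μ y ≤ 1 := by nlinarith
    nlinarith
  rw [h] at h1
  have h2 := real_inner_le_norm (S.T μ φ) φ
  have h3 : ‖S.T μ φ‖ ^ 2 ≤ (1 - S.kmin) * (‖S.T μ φ‖ * ‖φ‖) := by nlinarith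
  rcases (norm_nonneg (S.T μ φ)).eq_or_lt with h4 | h4
  · rw [← h4]; exact mul_nonneg (by linarith) (norm_nonneg _)
  · refine le_of_mul_le_mul_left ?_ h4
    linarith

theorem kmin_mul_norm_sq_le (μ : ProbabilityMeasure X) {φ : S.Hc}
    (h : inner ℝ (S.B μ) φ = 0) : S.kmin * ‖φ‖ ^ 2 ≤ inner ℝ (φ - S.T μ φ) φ := by
  rw [inner_sub_left, real_inner_self_eq_norm_sq]
  have h1 := S.norm_T_le_of_inner_eq_zero μ h
  have h2 := real_inner_le_norm (S.T μ φ) φ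
  nlinarith [norm_nonneg φ]

theorem inner_B_sub_T (μ : ProbabilityMeasure X) (φ : S.Hc) :
    inner ℝ (S.B μ) (φ - S.T μ φ) = 0 := by
  rw [inner_sub_right, ← inner_T_comm, T_B, sub_self]

/-- `Id - T` maps the orthogonal of `B(μ)` onto itself, with inverse bounded by `1 / kmin`. -/
theorem exists_sub_T_eq (μ : ProbabilityMeasure X) {w : S.Hc} (hw : inner ℝ (S.B μ) w = 0) :
    ∃ U : S.Hc, inner ℝ (S.B μ) U = 0 ∧ U - S.T μ U = w ∧ S.kmin * ‖U‖ ≤ ‖w‖ := by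
  have : Nonempty X := μ.nonempty
  have hk0 := S.kmin_pos
  have hk1 := S.kmin_le_one
  set b := S.B μ with hb
  have hbb : inner ℝ b b = (1 : ℝ) := by rw [real_inner_self_eq_norm_sq, hb, norm_B, one_pow]
  set T' : S.Hc →L[ℝ] S.Hc := S.T μ - (innerSL ℝ b).smulRight b with hT'
  have hT'a : ∀ φ, T' φ = S.T μ φ - inner ℝ b φ • b := fun φ => by simp [hT']
  have hn : ‖T'‖ < 1 := by
    refine lt_of_le_of_lt (T'.opNorm_le_bound (M := 1 - S.kmin) (by linarith) fun φ => ?_)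
      (by linarith)
    have h1 : T' φ = S.T μ (φ - inner ℝ b φ • b) := by
      rw [hT'a, map_sub, map_smul, hb, T_B]
    have h2 : inner ℝ b (φ - inner ℝ b φ • b) = 0 := by
      rw [inner_sub_right, inner_smul_right, hbb]; ring
    have h3 : ‖φ - inner ℝ b φ • b‖ ≤ ‖φ‖ := by
      refine le_of_sq_le_sq ?_ (norm_nonneg _)
      rw [norm_sub_sq_real, inner_smul_right, norm_smul, hb, norm_B, real_inner_comm]
      have := Real.norm_eq_abs (inner ℝ φ (S.B μ))
      rw [mul_one, real_inner_comm, Real.norm_eq_abs, sq_abs]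
      nlinarith [sq_nonneg (inner ℝ φ (S.B μ))]
    rw [h1]
    refine (S.norm_T_le_of_inner_eq_zero μ h2).trans ?_
    have : 0 ≤ 1 - S.kmin := by linarith
    gcongr
  set u := Units.oneSub T' hn
  set U : S.Hc := (↑u⁻¹ : S.Hc →L[ℝ] S.Hc) w with hU
  have h1 : U - T' U = w := by
    have h2 : (↑u : S.Hc →L[ℝ] S.Hc) * ↑u⁻¹ = 1 := u.mul_inv
    have h3 := DFunLike.congr_fun h2 w
    simpa [u] using h3
  rw [hT'a] at h1
  have h4 : inner ℝ b U = 0 := by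
    have h5 := congrArg (fun z => inner ℝ b z) h1
    simp only [sub_sub_eq_add_sub, inner_sub_right, inner_add_right, inner_smul_right, hbb] at h5
    have h6 : inner ℝ b (S.T μ U) = inner ℝ b U := by rw [← inner_T_comm, hb, T_B]
    rw [hw, h6] at h5
    linarith
  rw [h4, zero_smul, sub_zero] at h1
  refine ⟨U, h4, h1, ?_⟩
  have h5 := S.kmin_mul_norm_sq_le μ h4
  rw [h1] at h5
  have h6 := real_inner_le_norm w U
  rcases (norm_nonneg U).eq_or_lt with h7 | h7
  · rw [← h7, mul_zero]; exact norm_nonneg _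
  · refine le_of_mul_le_mul_right ?_ h7
    linarith

/-! ### Velocities and the metric tensor in `H_c` -/

/-- The isometry `φ ↦ φ / B(μ)` of `H_c` onto `H_μ`. -/
def Theta (μ : ProbabilityMeasure X) : S.Hc ≃ₗᵢ[ℝ] S.Hμ μ :=
  rescale S.kc_posSemidef (S.kμ_posSemidef μ) (e := S.expC (S.potential μ))
    (fun x => (S.expC_pos _ x).ne') fun x y => by
      simp only [kμ, kc, expC_apply, Matrix.of_apply, ← Real.exp_add]
      congr 1
      ring

theorem Theta_apply (μ : ProbabilityMeasure X) (φ : S.Hc) (x : X) :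
    S.Theta μ φ x = S.expC (S.potential μ) x * φ x := rescale_apply _ _ _ _ _ _ _

theorem Theta_B (μ : ProbabilityMeasure X) (x : X) : S.Theta μ (S.B μ) x = 1 := by
  rw [Theta_apply, expC_potential_mul_B]

theorem K_eq (μ : ProbabilityMeasure X) (φ : C(X, ℝ)) (y : X) :
    S.K μ φ y = S.Theta μ (S.dens (S.alpha μ) φ) y := by
  rw [Theta_apply, dens_apply, integral_alpha, ← integral_const_mul]
  refine integral_congr_ae (Eventually.of_forall fun x => ?_)
  have : S.kμ μ x y = S.expC (S.potential μ) x * S.kc x y * S.expC (S.potential μ) y := by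
    simp only [kμ, kc, expC_apply, Matrix.of_apply, ← Real.exp_add]
    congr 1
    ring
  simp only [this]
  ring

theorem K_Theta (μ : ProbabilityMeasure X) (φ : S.Hc) :
    S.K μ (S.Theta μ φ) = S.Theta μ (S.T μ φ) := by
  ext y
  rw [T_apply, ← K_eq]
  congr 1
  ext x
  rw [Theta_apply]; rfl

theorem isInvIdSubKSq_Theta_iff (μ : ProbabilityMeasure X) (U W : S.Hc) :
    S.IsInvIdSubKSq μ (S.Theta μ U) (S.Theta μ W) ↔
      ∃ a : ℝ, U - S.T μ (S.T μ U) = W + a • S.B μ := by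
  refine exists_congr fun a => ?_
  rw [K_Theta, K_Theta]
  constructor
  · intro h
    apply (S.Theta μ).injective
    refine RKHS.ext fun x => ?_
    rw [map_sub, map_add, map_smul]
    simpa [Theta_B] using h x
  · intro h x
    have h1 := congrArg (fun z => S.Theta μ z x) h
    simpa [map_sub, map_add, map_smul, Theta_B] using h1

/-- Here `Id - T² = (Id + T) (Id - T)`, and the factor `Id + T` is cancelled. -/
theorem isInvIdSubKSq_Theta_iff' (μ : ProbabilityMeasure X) {w : S.Hc}
    (hw : inner ℝ (S.B μ) w = 0) (U : S.Hc) :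
    S.IsInvIdSubKSq μ (S.Theta μ U) (S.Theta μ (w + S.T μ w)) ↔ U - S.T μ U = w := by
  rw [isInvIdSubKSq_Theta_iff]
  constructor
  · rintro ⟨a, ha⟩
    have hTi : ∀ φ, inner ℝ (S.B μ) (S.T μ φ) = inner ℝ (S.B μ) φ := fun φ => by
      rw [← inner_T_comm, T_B]
    have ha0 : a = 0 := by
      have h1 := congrArg (fun z => inner ℝ (S.B μ) z) ha
      simp only [inner_sub_right, inner_add_right, inner_smul_right, hTi, hw,
        real_inner_self_eq_norm_sq, norm_B] at h1
      linarith
    rw [ha0, zero_smul, add_zero] at ha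
    -- `1 + T` is injective, as `T ≥ 0`
    set D := U - S.T μ U - w with hD
    have h2 : D + S.T μ D = 0 := by
      rw [hD, map_sub, map_sub, ← sub_eq_zero.2 ha]
      abel
    have h3 : ‖D‖ ^ 2 + inner ℝ (S.T μ D) D = 0 := by
      rw [← real_inner_self_eq_norm_sq, ← inner_add_left, h2, inner_zero_left]
    have h4 := S.inner_T_nonneg μ D
    have h5 : ‖D‖ = 0 := by nlinarith [sq_nonneg ‖D‖]
    exact sub_eq_zero.1 (norm_eq_zero.1 h5)
  · intro h
    refine ⟨0, ?_⟩
    rw [zero_smul, add_zero, ← h, map_sub]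
    abel

/-- A solution in `C(X)` belongs to `H_μ`, as `K_μ` maps `C(X)` into `H_μ`. -/
theorem exists_Theta_eq_of_isInvIdSubKSq (μ : ProbabilityMeasure X) {w : S.Hc}
    (hw : inner ℝ (S.B μ) w = 0) {u : C(X, ℝ)}
    (hu : S.IsInvIdSubKSq μ u (S.Theta μ (w + S.T μ w))) :
    ∃ U : S.Hc, (u : X → ℝ) = S.Theta μ U ∧ U - S.T μ U = w := by
  obtain ⟨a, ha⟩ := hu
  have h1 : S.K μ u = S.Theta μ (S.dens (S.alpha μ) u) := funext fun y => S.K_eq μ u y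
  rw [h1, K_Theta] at ha
  have h2 : (u : X → ℝ) = S.Theta μ (S.T μ (S.dens (S.alpha μ) u) + (w + S.T μ w) + a • S.B μ) := by
    ext x
    rw [map_add, map_add (S.Theta μ) (S.T μ (S.dens (S.alpha μ) u)), map_smul]
    have := ha x
    simp only [RKHS.coe_add, RKHS.coe_smul, Pi.add_apply, Pi.smul_apply, Theta_B, smul_eq_mul]
    linarith
  refine ⟨_, h2, (S.isInvIdSubKSq_Theta_iff' μ hw _).1 ?_⟩
  rw [← h2]
  exact ⟨a, fun x => by rw [h1, K_Theta]; exact ha x⟩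

/-- The tangent vector at `μ` of a curve whose image by `B` has derivative `w`. -/
def vel (μ : ProbabilityMeasure X) (w : S.Hc) : StrongDual ℝ (S.Hμ μ) :=
  InnerProductSpace.toDual ℝ (S.Hμ μ) (S.Theta μ (w + S.T μ w))

theorem vel_Theta (μ : ProbabilityMeasure X) (w φ : S.Hc) :
    S.vel μ w (S.Theta μ φ) = inner ℝ (w + S.T μ w) φ := by
  rw [vel, InnerProductSpace.toDual_apply_apply, LinearIsometryEquiv.inner_map_map]

theorem riesz_vel (μ : ProbabilityMeasure X) (w : S.Hc) :
    S.riesz μ (S.vel μ w) = S.Theta μ (w + S.T μ w) :=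
  LinearIsometryEquiv.symm_apply_apply _ _

theorem inner_B_eq_zero_of_hasDerivAt {γ : ℝ → ProbabilityMeasure X} {t : ℝ} {w : S.Hc}
    (h : HasDerivAt (fun s => S.B (γ s)) w t) : inner ℝ (S.B (γ t)) w = 0 := by
  have h1 := h.norm_sq
  simp only [norm_B, one_pow] at h1
  have h2 := h1.unique (hasDerivAt_const t (1 : ℝ))
  linarith

/-- The integral against `ν` of the function `φ / B(μ)`. -/
theorem integral_Theta_eq (μ ν : ProbabilityMeasure X) (φ : S.Hc) :
    ∫ x, S.Theta μ φ x ∂(ν : Measure X) =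
      inner ℝ (S.dens (S.alpha ν) (S.expC (S.potential μ) * S.toC φ)) (S.B ν - S.B μ) +
        inner ℝ (S.B ν) φ := by
  have h2 : inner ℝ (S.dens (S.alpha ν) (S.expC (S.potential μ) * S.toC φ)) (S.B μ) =
      inner ℝ (S.B ν) φ := by
    rw [inner_dens, ← emb_alpha S ν, inner_emb]
    congr 1; ext x
    have := S.expC_potential_mul_B μ x
    simp only [ContinuousMap.mul_apply, toC_apply]
    linear_combination φ x * this
  rw [inner_sub_right, h2, sub_add_cancel, inner_dens, integral_eq_integral_alpha]
  congr 1; ext x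
  rw [Theta_apply]; rfl

/-- The derivative along a curve of measures of the integral of a function of the space `H_μ`, at
a point of differentiability of the curve of the embeddings. -/
theorem hasDerivAt_integral_Theta (hS : S.IsUniversal) {γ : ℝ → ProbabilityMeasure X} {t : ℝ}
    {w : S.Hc} (h : HasDerivAt (fun s => S.B (γ s)) w t) (φ : S.Hc) :
    HasDerivAt (fun s => ∫ x, S.Theta (γ t) φ x ∂(γ s : Measure X))
      (inner ℝ (w + S.T (γ t) w) φ) t := by
  set ρ := S.expC (S.potential (γ t)) * S.toC φ with hρ
  have hγ : ContinuousAt γ t :=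
    (S.isClosedEmbedding_B hS).isInducing.continuousAt_iff.2 h.continuousAt
  have hD : ContinuousAt (fun s => S.dens (S.alpha (γ s)) ρ) t :=
    (S.continuous_dens.comp (S.continuous_alpha.prodMk continuous_const)).continuousAt.comp hγ
  have h1 := fun s => S.integral_Theta_eq (γ t) (γ s) φ
  simp only [h1]
  have h3 : HasDerivAt (fun s => inner ℝ (S.dens (S.alpha (γ s)) ρ) (S.B (γ s) - S.B (γ t)))
      (inner ℝ (S.T (γ t) φ) w) t := by
    rw [hasDerivAt_iff_tendsto_slope] at h ⊢
    have h4 := (hD.tendsto.mono_left nhdsWithin_le_nhds).inner (𝕜 := ℝ) h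
    refine h4.congr fun s => ?_
    rw [slope_def_module, slope_def_module, sub_self, inner_zero_right, sub_zero,
      inner_smul_right, smul_eq_mul]
  have h5 : HasDerivAt (fun s => inner ℝ (S.B (γ s)) φ) (inner ℝ w φ) t := by
    simpa using h.inner ℝ (hasDerivAt_const t φ)
  have h6 : inner ℝ (w + S.T (γ t) w) φ = inner ℝ (S.T (γ t) φ) w + inner ℝ w φ := by
    rw [inner_add_left, inner_T_comm, real_inner_comm w, add_comm]
  rw [h6]
  exact h3.add h5

/-- Where the curve of the embeddings is differentiable, the velocity exists and is unique. -/
theorem hasVelocity_iff (hS : S.IsUniversal) {γ : ℝ → ProbabilityMeasure X} {t : ℝ} {w : S.Hc}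
    (h : HasDerivAt (fun s => S.B (γ s)) w t) (σ : StrongDual ℝ (S.Hμ (γ t))) :
    S.HasVelocity γ t σ ↔ σ = S.vel (γ t) w := by
  have hw := S.inner_B_eq_zero_of_hasDerivAt h
  constructor
  · rintro ⟨-, h1⟩
    ext ψ
    obtain ⟨φ, rfl⟩ := (S.Theta (γ t)).surjective ψ
    rw [vel_Theta]
    exact (h1 _).unique (S.hasDerivAt_integral_Theta hS h φ)
  · rintro rfl
    refine ⟨fun ψ hψ => ?_, fun ψ => ?_⟩
    · have : ψ = S.Theta (γ t) (S.B (γ t)) := RKHS.ext fun x => by rw [hψ, Theta_B]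
      rw [this, vel_Theta, inner_add_left, inner_T_comm, T_B, real_inner_comm, hw, add_zero]
    · obtain ⟨φ, rfl⟩ := (S.Theta (γ t)).surjective ψ
      rw [vel_Theta]
      exact S.hasDerivAt_integral_Theta hS h φ

/-- The metric tensor does not depend on the choice of the solution `U`. -/
theorem metricTensor_vel (μ : ProbabilityMeasure X) {w U : S.Hc} (hU : U - S.T μ U = w) :
    S.metricTensor μ (S.vel μ w) (S.vel μ w) = S.ε / 2 * inner ℝ (w + S.T μ w) U := by
  have hw : inner ℝ (S.B μ) w = 0 := by rw [← hU]; exact S.inner_B_sub_T μ U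
  have h : ∃ u : S.Hμ μ, S.IsInvIdSubKSq μ u (S.riesz μ (S.vel μ w)) := by
    refine ⟨S.Theta μ U, ?_⟩
    rw [riesz_vel]
    exact (S.isInvIdSubKSq_Theta_iff' μ hw U).2 hU
  rw [metricTensor, dif_pos h]
  congr 1
  suffices ∀ u : S.Hμ μ, S.IsInvIdSubKSq μ u (S.riesz μ (S.vel μ w)) →
      S.vel μ w u = inner ℝ (w + S.T μ w) U from this _ h.choose_spec
  intro u h2
  obtain ⟨U', rfl⟩ := (S.Theta μ).surjective u
  rw [riesz_vel, isInvIdSubKSq_Theta_iff' S μ hw] at h2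
  rw [vel_Theta, ← sub_eq_zero, ← inner_sub_right]
  -- two solutions differ by a fixed point of `T`
  set D := U' - U with hD
  have h3 : S.T μ D = D := by
    have : D - S.T μ D = 0 := by
      rw [hD, map_sub, ← sub_eq_zero.2 (h2.trans hU.symm)]; abel
    exact (sub_eq_zero.1 this).symm
  rw [inner_add_left, inner_T_comm, h3, ← hU, inner_sub_left, inner_T_comm, h3]
  ring

theorem le_metricTensor_vel (μ : ProbabilityMeasure X) {w : S.Hc}
    (hw : inner ℝ (S.B μ) w = 0) :
    S.ε / 2 * ‖w‖ ^ 2 ≤ S.metricTensor μ (S.vel μ w) (S.vel μ w) := by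
  obtain ⟨U, -, hU, -⟩ := S.exists_sub_T_eq μ hw
  rw [S.metricTensor_vel μ hU]
  have hε := S.ε_pos
  gcongr
  have h1 := S.norm_T_sq_le μ U
  have h2 : inner ℝ (S.T μ w) U = inner ℝ w (S.T μ U) := S.inner_T_comm μ w U
  rw [inner_add_left, h2, ← hU, inner_sub_left, inner_sub_left, norm_sub_sq_real,
    real_inner_self_eq_norm_sq, real_inner_self_eq_norm_sq]
  rw [real_inner_comm] at h1
  have h3 := real_inner_comm U (S.T μ U)
  linarith

theorem metricTensor_vel_le (μ : ProbabilityMeasure X) {w : S.Hc}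
    (hw : inner ℝ (S.B μ) w = 0) :
    S.metricTensor μ (S.vel μ w) (S.vel μ w) ≤ S.ε / S.kmin * ‖w‖ ^ 2 := by
  obtain ⟨U, -, hU, hn⟩ := S.exists_sub_T_eq μ hw
  rw [S.metricTensor_vel μ hU]
  have hε := S.ε_pos
  have hk := S.kmin_pos
  have h1 : inner ℝ (w + S.T μ w) U ≤ 2 * ‖w‖ * ‖U‖ := by
    refine (real_inner_le_norm _ _).trans ?_
    have h2 := norm_add_le w (S.T μ w)
    have h3 := S.norm_T_le μ w
    gcongr; linarith
  have h2 : ‖U‖ ≤ ‖w‖ / S.kmin := by rw [le_div_iff₀ hk]; linarith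
  calc S.ε / 2 * inner ℝ (w + S.T μ w) U ≤ S.ε / 2 * (2 * ‖w‖ * (‖w‖ / S.kmin)) := by
        have := norm_nonneg w
        gcongr
        exact h1.trans (by gcongr)
    _ = _ := by field_simp

end Cost

/-! ### Absolutely continuous curves in a separable Hilbert space -/

section AbsolutelyContinuous

theorem AbsolutelyContinuousOnInterval.of_dist_le {Y Z : Type*} [PseudoMetricSpace Y]
    [PseudoMetricSpace Z] {f : ℝ → Y} {F : ℝ → Z} {a b : ℝ}
    (hF : AbsolutelyContinuousOnInterval F a b)
    (h : ∀ s ∈ uIcc a b, ∀ t ∈ uIcc a b, dist (f s) (f t) ≤ dist (F s) (F t)) :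
    AbsolutelyContinuousOnInterval f a b := by
  rw [absolutelyContinuousOnInterval_iff] at hF ⊢
  intro ε hε
  obtain ⟨δ, hδ, h1⟩ := hF ε hε
  refine ⟨δ, hδ, fun E hE hE' => lt_of_le_of_lt (Finset.sum_le_sum fun i hi => ?_) (h1 E hE hE')⟩
  exact h _ (hE.1 i hi).1 _ (hE.1 i hi).2

theorem absolutelyContinuousOnInterval_of_dist_le_integral {Y : Type*} [PseudoMetricSpace Y]
    {f : ℝ → Y} {m : ℝ → ℝ} {a b : ℝ} (hab : a ≤ b) (hm : IntervalIntegrable m volume a b)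
    (h : ∀ s ∈ Icc a b, ∀ t ∈ Icc a b, s ≤ t → dist (f s) (f t) ≤ ∫ r in s..t, m r) :
    AbsolutelyContinuousOnInterval f a b := by
  refine AbsolutelyContinuousOnInterval.of_dist_le
    (hm.absolutelyContinuousOnInterval_intervalIntegral left_mem_uIcc) ?_
  rw [uIcc_of_le hab]
  have key : ∀ s ∈ Icc a b, ∀ t ∈ Icc a b, s ≤ t →
      dist (f s) (f t) ≤ dist (∫ r in a..s, m r) (∫ r in a..t, m r) := by
    intro s hs t ht hst
    have h1 : IntervalIntegrable m volume a s :=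
      hm.mono_set (by rw [uIcc_of_le hs.1, uIcc_of_le hab]; exact Icc_subset_Icc_right hs.2)
    have h2 : IntervalIntegrable m volume a t :=
      hm.mono_set (by rw [uIcc_of_le ht.1, uIcc_of_le hab]; exact Icc_subset_Icc_right ht.2)
    rw [dist_comm (∫ r in a..s, m r), Real.dist_eq, intervalIntegral.integral_interval_sub_left h2 h1]
    exact (h s hs t ht hst).trans (le_abs_self _)
  intro s hs t ht
  rcases le_total s t with hst | hst
  · exact key s hs t ht hst
  · rw [dist_comm, dist_comm (∫ r in a..s, m r)]
    exact key t ht s hs hst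

theorem le_of_ae_hasDerivAt_nonpos {f : ℝ → ℝ} {a b : ℝ} (hab : a ≤ b)
    (hf : AbsolutelyContinuousOnInterval f a b)
    (h : ∀ᵐ t, t ∈ Ioo a b → ∃ d ≤ 0, HasDerivAt f d t) : f b ≤ f a := by
  have h1 := hf.integral_deriv_eq_sub
  have h2 : ∫ t in a..b, deriv f t ≤ 0 := by
    rw [intervalIntegral.integral_of_le hab]
    refine integral_nonpos_of_ae ?_
    rw [EventuallyLE, ae_restrict_iff' measurableSet_Ioc]
    have h3 : ∀ᵐ t : ℝ, t ≠ b := by simp [ae_iff, measure_singleton]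
    filter_upwards [h, h3] with t ht htb ht'
    obtain ⟨d, hd, hd'⟩ := ht ⟨ht'.1, lt_of_le_of_ne ht'.2 htb⟩
    rw [hd'.deriv]
    exact hd
  linarith

variable {E : Type*} [NormedAddCommGroup E] [InnerProductSpace ℝ E] [CompleteSpace E]

theorem Orthonormal.countable [TopologicalSpace.SeparableSpace E] {ι : Type*} {v : ι → E}
    (hv : Orthonormal ℝ v) : Countable ι := by
  have h : (univ : Set ι).Countable := by
    refine PairwiseDisjoint.countable_of_isOpen (s := fun i => Metric.ball (v i) (1 / 2)) ?_
      (fun i _ => Metric.isOpen_ball) (fun i _ => ⟨v i, by simp⟩)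
    intro i _ j _ hij
    refine Metric.ball_disjoint_ball ?_
    rw [dist_eq_norm]
    have h1 : ‖v i - v j‖ ^ 2 = 2 := by
      rw [norm_sub_sq_real, hv.1, hv.1, hv.2 hij]; norm_num
    nlinarith [norm_nonneg (v i - v j)]
  exact countable_univ_iff.1 h

/-- An absolutely continuous curve in a separable Hilbert space is a primitive of an integrable
function: the derivative exists coordinatewise in a Hilbert basis, and Bessel's inequality for the
difference quotients bounds it by the metric derivative. -/
theorem exists_eq_add_integral [TopologicalSpace.SeparableSpace E] {f : ℝ → E} {m : ℝ → ℝ}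
    {a b : ℝ} (hab : a ≤ b) (hm : IntervalIntegrable m volume a b)
    (h : ∀ s ∈ Icc a b, ∀ t ∈ Icc a b, s ≤ t → dist (f s) (f t) ≤ ∫ r in s..t, m r) :
    ∃ v : ℝ → E, AEStronglyMeasurable v (volume.restrict (Icc a b)) ∧
      (∀ᵐ t ∂(volume.restrict (Icc a b)), ‖v t‖ ≤ m t) ∧
      IntervalIntegrable v volume a b ∧
      ∀ t ∈ Icc a b, f t = f a + ∫ s in a..t, v s := by
  obtain ⟨ι, e, -⟩ := exists_hilbertBasis ℝ E
  have : Countable ι := Orthonormal.countable e.orthonormal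
  set g : ι → ℝ → ℝ := fun i t => inner ℝ (e i) (f t) with hg
  set c : ι → ℝ → ℝ := fun i => deriv (g i) with hc
  have hgac : ∀ i, AbsolutelyContinuousOnInterval (g i) a b := by
    intro i
    refine absolutelyContinuousOnInterval_of_dist_le_integral hab hm fun s hs t ht hst => ?_
    refine le_trans ?_ (h s hs t ht hst)
    rw [Real.dist_eq, dist_eq_norm, ← inner_sub_right]
    refine (abs_real_inner_le_norm _ _).trans ?_
    rw [e.orthonormal.1 i, one_mul]
  have hM := hm.ae_hasDerivAt_integral
  have hgd : ∀ᵐ t, ∀ i, t ∈ uIcc a b → DifferentiableAt ℝ (g i) t :=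
    ae_all_iff.2 fun i => (hgac i).ae_differentiableAt
  have hna : ∀ᵐ t : ℝ, t ≠ a := by simp [ae_iff, measure_singleton]
  have hnb : ∀ᵐ t : ℝ, t ≠ b := by simp [ae_iff, measure_singleton]
  rw [uIcc_of_le hab] at hM hgd
  -- the bound by Bessel's inequality
  have key : ∀ᵐ t, t ∈ Icc a b → 0 ≤ m t ∧ ∀ s : Finset ι, ∑ i ∈ s, c i t ^ 2 ≤ m t ^ 2 := by
    filter_upwards [hM, hgd, hna, hnb] with t h1 h2 h3 h4 ht
    have hM1 := (h1 ht a (left_mem_Icc.2 hab)).tendsto_slope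
    have hmem : ∀ᶠ s in 𝓝[≠] t, s ∈ Icc a b := nhdsWithin_le_nhds
      (Icc_mem_nhds (lt_of_le_of_ne ht.1 (Ne.symm h3)) (lt_of_le_of_ne ht.2 h4))
    have hbound : ∀ᶠ s in 𝓝[≠] t, ‖slope f t s‖ ≤ slope (fun x => ∫ r in a..x, m r) t s := by
      filter_upwards [hmem, self_mem_nhdsWithin] with s hs hst
      have hint : ∀ x ∈ Icc a b, IntervalIntegrable m volume a x := fun x hx =>
        hm.mono_set (by rw [uIcc_of_le hx.1, uIcc_of_le hab]; exact Icc_subset_Icc_right hx.2)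
      rw [slope_def_module, slope_def_field, norm_smul, norm_inv, Real.norm_eq_abs,
        intervalIntegral.integral_interval_sub_left (hint s hs) (hint t ht), inv_mul_eq_div]
      rcases lt_or_gt_of_ne hst with hlt | hlt
      · have h5 := h s hs t ht hlt.le
        rw [abs_of_neg (by linarith), intervalIntegral.integral_symm, neg_div, ← div_neg]
        rw [dist_eq_norm] at h5
        gcongr
        linarith
      · have h5 := h t ht s hs hlt.le
        rw [abs_of_pos (by linarith)]
        rw [dist_comm, dist_eq_norm] at h5
        gcongr
    have hslope : ∀ i s, slope (g i) t s = inner ℝ (e i) (slope f t s) := by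
      intro i s
      rw [slope_def_module, slope_def_module, inner_smul_right, inner_sub_right, smul_eq_mul]
    constructor
    · refine ge_of_tendsto hM1 ?_
      filter_upwards [hbound] with s hs
      exact (norm_nonneg _).trans hs
    · intro F
      have h5 : Tendsto (fun s => ∑ i ∈ F, slope (g i) t s ^ 2) (𝓝[≠] t)
          (𝓝 (∑ i ∈ F, c i t ^ 2)) :=
        tendsto_finsetSum _ fun i _ => ((h2 i ht).hasDerivAt.tendsto_slope).pow 2
      refine le_of_tendsto_of_tendsto h5 (hM1.pow 2) ?_
      filter_upwards [hbound] with s hs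
      have h6 := e.orthonormal.sum_inner_products_le (slope f t s) (s := F)
      simp only [Real.norm_eq_abs, sq_abs] at h6
      simp only [hslope]
      refine h6.trans ?_
      have := norm_nonneg (slope f t s)
      gcongr
  -- the derivative
  classical
  set v : ℝ → E := fun t =>
    if H : Memℓp (fun i => c i t) 2 then e.repr.symm ⟨fun i => c i t, H⟩ else 0 with hv
  have hmem : ∀ᵐ t ∂(volume.restrict (Icc a b)), Memℓp (fun i => c i t) 2 := by
    rw [ae_restrict_iff' measurableSet_Icc]
    filter_upwards [key] with t ht ht'
    refine memℓp_gen' (C := m t ^ 2) fun s => ?_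
    simpa using (ht ht').2 s
  have hvsum : ∀ᵐ t ∂(volume.restrict (Icc a b)), HasSum (fun i => c i t • e i) (v t) := by
    filter_upwards [hmem] with t ht
    have := e.hasSum_repr_symm ⟨fun i => c i t, ht⟩
    simp only [hv, dif_pos ht]
    exact this
  have hvrepr : ∀ᵐ t ∂(volume.restrict (Icc a b)), ∀ i, inner ℝ (e i) (v t) = c i t := by
    filter_upwards [hmem] with t ht i
    rw [← e.repr_apply_apply]
    simp only [hv, dif_pos ht, LinearIsometryEquiv.apply_symm_apply]
  have hvmeas : AEStronglyMeasurable v (volume.restrict (Icc a b)) := by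
    refine aestronglyMeasurable_of_tendsto_ae (atTop : Filter (Finset ι))
      (f := fun s t => ∑ i ∈ s, c i t • e i) (fun s => ?_) hvsum
    exact Finset.aestronglyMeasurable_fun_sum s fun i _ =>
      (measurable_deriv (g i)).aestronglyMeasurable.smul_const (e i)
  have hvnorm : ∀ᵐ t ∂(volume.restrict (Icc a b)), ‖v t‖ ≤ m t := by
    filter_upwards [hvsum, (ae_restrict_iff' measurableSet_Icc).2 key] with t h1 h2
    refine le_of_tendsto h1.norm (Eventually.of_forall fun s => ?_)
    refine le_of_sq_le_sq ?_ h2.1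
    have h3 : ‖∑ i ∈ s, c i t • e i‖ ^ 2 = ∑ i ∈ s, c i t ^ 2 := by
      rw [← real_inner_self_eq_norm_sq, e.orthonormal.inner_sum]
      simp [sq]
    rw [h3]
    exact h2.2 s
  have hvint : IntervalIntegrable v volume a b := by
    rw [intervalIntegrable_iff_integrableOn_Icc_of_le hab] at hm ⊢
    exact hm.mono' hvmeas hvnorm
  refine ⟨v, hvmeas, hvnorm, hvint, fun t ht => ?_⟩
  have hsub : Icc a t ⊆ Icc a b := Icc_subset_Icc_right ht.2
  have hvint' : IntervalIntegrable v volume a t :=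
    hvint.mono_set (by rw [uIcc_of_le ht.1, uIcc_of_le hab]; exact hsub)
  apply e.repr.injective
  ext i
  rw [e.repr_apply_apply, e.repr_apply_apply, inner_add_right]
  have h1 : inner ℝ (e i) (∫ s in a..t, v s) = ∫ s in a..t, inner ℝ (e i) (v s) := by
    rw [intervalIntegral.integral_of_le ht.1, intervalIntegral.integral_of_le ht.1]
    exact (integral_inner hvint'.1 (e i)).symm
  have h2 : ∫ s in a..t, inner ℝ (e i) (v s) = ∫ s in a..t, c i s := by
    refine intervalIntegral.integral_congr_ae ?_
    have := (ae_restrict_iff' measurableSet_Icc).1 hvrepr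
    filter_upwards [this] with s hs hs'
    rw [uIoc_of_le ht.1] at hs'
    exact hs (hsub ⟨hs'.1.le, hs'.2⟩) i
  have h3 : ∫ s in a..t, c i s = g i t - g i a :=
    ((hgac i).mono (by rw [uIcc_of_le ht.1, uIcc_of_le hab]; exact hsub)).integral_deriv_eq_sub
  rw [h1, h2, h3]
  simp [hg]

theorem ae_hasDerivAt_of_eq_add_integral {f v : ℝ → E} {a b : ℝ} (hab : a ≤ b)
    (hv : IntervalIntegrable v volume a b)
    (h : ∀ t ∈ Icc a b, f t = f a + ∫ s in a..t, v s) :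
    ∀ᵐ t, t ∈ Icc a b → HasDerivAt f (v t) t := by
  have hna : ∀ᵐ t : ℝ, t ≠ a := by simp [ae_iff, measure_singleton]
  have hnb : ∀ᵐ t : ℝ, t ≠ b := by simp [ae_iff, measure_singleton]
  have hd := hv.ae_hasDerivAt_integral
  rw [uIcc_of_le hab] at hd
  filter_upwards [hd, hna, hnb] with t h1 h2 h3 ht
  have h4 := (h1 ht a (left_mem_Icc.2 hab)).const_add (f a)
  refine h4.congr_of_eventuallyEq ?_
  filter_upwards [Icc_mem_nhds (lt_of_le_of_ne ht.1 (Ne.symm h2)) (lt_of_le_of_ne ht.2 h3)] with s hs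
  exact h s hs

end AbsolutelyContinuous
namespace Cost

variable {X : Type*} [MetricSpace X] [CompactSpace X] [MeasurableSpace X] [BorelSpace X]
variable (S : Cost X)

/-! ### The monotone operator driving the flow -/

/-- `-w` belongs to the monotone operator `(2 / ε) (A + N)` at the point `emb α` of the cone of the
embeddings of positive measures, where `A` is the antisymmetric operator sending `emb α` to
`V emb(α) - ∫ V(x) k_c(x, ·) dα(x)` and `N` is the normal cone. -/
structure IsFlowDirection (V : C(X, ℝ)) (α : FiniteMeasure X) (w : S.Hc) : Prop where
  nonneg : ∀ x, 0 ≤ w x + 2 / S.ε * (V x * S.emb α x - S.dens α V x)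
  inner_eq_zero : inner ℝ w (S.emb α) = 0

variable {S}
variable {V : C(X, ℝ)}

theorem IsFlowDirection.inner_nonneg {α : FiniteMeasure X} {w : S.Hc}
    (h : S.IsFlowDirection V α w) (β : FiniteMeasure X) :
    0 ≤ inner ℝ w (S.emb β) +
      2 / S.ε * (inner ℝ (S.dens β V) (S.emb α) - inner ℝ (S.dens α V) (S.emb β)) := by
  have h1 : inner ℝ w (S.emb β) +
      2 / S.ε * (inner ℝ (S.dens β V) (S.emb α) - inner ℝ (S.dens α V) (S.emb β)) =
      ∫ x, (w x + 2 / S.ε * (V x * S.emb α x - S.dens α V x)) ∂(β : Measure X) := by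
    have i1 := integrable_continuousMap β (S.toC w)
    have i2 := integrable_continuousMap β (V * S.toC (S.emb α))
    have i3 := integrable_continuousMap β (S.toC (S.dens α V))
    have e1 := integral_add i1 ((i2.sub i3).const_mul (2 / S.ε))
    refine Eq.trans ?_ e1.symm
    rw [integral_const_mul]
    have e2 := integral_sub i2 i3
    simp only [Pi.sub_apply] at e2 ⊢
    rw [e2, real_inner_comm, inner_emb, inner_dens, real_inner_comm (S.emb β) (S.dens α V),
      inner_emb]
    rfl
  rw [h1]
  exact integral_nonneg h.nonneg

/-- Monotonicity: the antisymmetric parts cancel. -/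
theorem IsFlowDirection.inner_sub_nonpos {α β : FiniteMeasure X} {w z : S.Hc}
    (h : S.IsFlowDirection V α w) (h' : S.IsFlowDirection V β z) :
    inner ℝ (w - z) (S.emb α - S.emb β) ≤ 0 := by
  have h1 := h.inner_nonneg β
  have h2 := h'.inner_nonneg α
  have h3 := h.inner_eq_zero
  have h4 := h'.inner_eq_zero
  rw [inner_sub_left, inner_sub_right, inner_sub_right, h3, h4]
  linarith

variable (S V) in
/-- A curve of probability measures whose embedding moves in flow directions. It is continuous on
`[0, ∞)` and absolutely continuous on the compact subintervals of `(0, ∞)`; negative times play no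
role. -/
structure IsEvolution (γ : ℝ → ProbabilityMeasure X) : Prop where
  cont : ContinuousOn (fun t => S.B (γ t)) (Ici 0)
  ac : ∀ a b, 0 < a → a ≤ b → ∃ m : ℝ → ℝ, IntervalIntegrable m volume a b ∧
    ∀ s ∈ Icc a b, ∀ t ∈ Icc a b, s ≤ t → dist (S.B (γ s)) (S.B (γ t)) ≤ ∫ r in s..t, m r
  dir : ∀ᵐ t : ℝ, 0 < t → ∃ w, HasDerivAt (fun s => S.B (γ s)) w t ∧
    S.IsFlowDirection V (S.alpha (γ t)) w

theorem IsEvolution.absolutelyContinuousOnInterval {γ : ℝ → ProbabilityMeasure X}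
    (h : S.IsEvolution V γ) {a b : ℝ} (ha : 0 < a) (hab : a ≤ b) :
    AbsolutelyContinuousOnInterval (fun t => S.B (γ t)) a b := by
  obtain ⟨m, hm, h1⟩ := h.ac a b ha hab
  exact absolutelyContinuousOnInterval_of_dist_le_integral hab hm h1

theorem norm_B_sub_B_le (μ ν : ProbabilityMeasure X) : ‖S.B μ - S.B ν‖ ≤ 2 := by
  refine (norm_sub_le _ _).trans ?_
  rw [norm_B, norm_B]; norm_num

/-! ### Contraction -/

theorem IsEvolution.norm_sub_le_of_pos {γ₁ γ₂ : ℝ → ProbabilityMeasure X}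
    (h₁ : S.IsEvolution V γ₁) (h₂ : S.IsEvolution V γ₂) {s t : ℝ} (hs : 0 < s) (hst : s ≤ t) :
    ‖S.B (γ₁ t) - S.B (γ₂ t)‖ ≤ ‖S.B (γ₁ s) - S.B (γ₂ s)‖ := by
  have hac : AbsolutelyContinuousOnInterval
      (fun r => ‖S.B (γ₁ r) - S.B (γ₂ r)‖ ^ 2) s t := by
    have h1 := (h₁.absolutelyContinuousOnInterval hs hst).sub
      (h₂.absolutelyContinuousOnInterval hs hst)
    refine AbsolutelyContinuousOnInterval.of_dist_le (h1.const_smul (4 : ℝ)) fun x _ y _ => ?_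
    simp only [Pi.sub_apply]
    rw [dist_smul₀, Real.dist_eq, dist_eq_norm, Real.norm_eq_abs,
      abs_of_pos (by norm_num : (0:ℝ) < 4)]
    have h2 := norm_B_sub_B_le (S := S) (γ₁ x) (γ₂ x)
    have h3 := norm_B_sub_B_le (S := S) (γ₁ y) (γ₂ y)
    set p := S.B (γ₁ x) - S.B (γ₂ x)
    set q := S.B (γ₁ y) - S.B (γ₂ y)
    have h4 := abs_norm_sub_norm_le p q
    have h5 : ‖p‖ ^ 2 - ‖q‖ ^ 2 = (‖p‖ - ‖q‖) * (‖p‖ + ‖q‖) := by ring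
    rw [h5, abs_mul, abs_of_nonneg (by positivity : 0 ≤ ‖p‖ + ‖q‖), mul_comm]
    have := norm_nonneg p
    have := norm_nonneg q
    gcongr
    linarith
  have h2 := le_of_ae_hasDerivAt_nonpos hst hac (by
    filter_upwards [h₁.dir, h₂.dir] with r hr1 hr2 hr
    obtain ⟨w, hw, hwd⟩ := hr1 (hs.trans hr.1)
    obtain ⟨z, hz, hzd⟩ := hr2 (hs.trans hr.1)
    refine ⟨_, ?_, (hw.sub hz).norm_sq⟩
    have := hwd.inner_sub_nonpos hzd
    rw [emb_alpha, emb_alpha, real_inner_comm] at this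
    simp only [Pi.sub_apply]
    linarith)
  exact le_of_sq_le_sq h2 (norm_nonneg _)

theorem IsEvolution.norm_sub_le {γ₁ γ₂ : ℝ → ProbabilityMeasure X}
    (h₁ : S.IsEvolution V γ₁) (h₂ : S.IsEvolution V γ₂) {s t : ℝ} (hs : 0 ≤ s) (hst : s ≤ t) :
    ‖S.B (γ₁ t) - S.B (γ₂ t)‖ ≤ ‖S.B (γ₁ s) - S.B (γ₂ s)‖ := by
  rcases hs.eq_or_lt with rfl | hs
  · rcases hst.eq_or_lt with rfl | ht
    · exact le_rfl
    · have h1 : ContinuousWithinAt (fun r => ‖S.B (γ₁ r) - S.B (γ₂ r)‖) (Ioi 0) 0 :=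
        (((h₁.cont.sub h₂.cont).norm) 0 (self_mem_Ici)).mono Ioi_subset_Ici_self
      refine ge_of_tendsto h1.tendsto ?_
      filter_upwards [Ioc_mem_nhdsGT ht] with r hr
      exact h₁.norm_sub_le_of_pos h₂ hr.1 hr.2
  · exact h₁.norm_sub_le_of_pos h₂ hs hst

theorem IsEvolution.shift {γ : ℝ → ProbabilityMeasure X} (h : S.IsEvolution V γ) {r : ℝ}
    (hr : 0 ≤ r) : S.IsEvolution V fun t => γ (t + r) := by
  refine ⟨?_, ?_, ?_⟩
  · refine h.cont.comp (f := fun t => t + r) (by fun_prop) fun t ht => ?_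
    exact add_nonneg ht hr
  · intro a b ha hab
    obtain ⟨m, hm, h1⟩ := h.ac (a + r) (b + r) (by linarith) (by linarith)
    refine ⟨fun t => m (t + r), by simpa using hm.comp_add_right r, ?_⟩
    intro s hs t ht hst
    rw [intervalIntegral.integral_comp_add_right]
    exact h1 _ ⟨by linarith [hs.1], by linarith [hs.2]⟩ _ ⟨by linarith [ht.1], by linarith [ht.2]⟩
      (by linarith)
  · have := (measurePreserving_add_right (volume : Measure ℝ) r).quasiMeasurePreserving.ae h.dir
    filter_upwards [this] with t ht ht0
    obtain ⟨w, hw, hwd⟩ := ht (by linarith)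
    exact ⟨w, hw.comp_add_const t r, hwd⟩

/-- The speed of an evolution is non-increasing. -/
theorem IsEvolution.norm_deriv_le {γ : ℝ → ProbabilityMeasure X} (h : S.IsEvolution V γ)
    {s t : ℝ} (hs : 0 ≤ s) (hst : s ≤ t) {w z : S.Hc}
    (hw : HasDerivAt (fun s => S.B (γ s)) w s) (hz : HasDerivAt (fun s => S.B (γ s)) z t) :
    ‖z‖ ≤ ‖w‖ := by
  have h1 := hw.tendsto_slope_zero_right.norm
  have h2 := hz.tendsto_slope_zero_right.norm
  refine le_of_tendsto_of_tendsto h2 h1 ?_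
  filter_upwards [self_mem_nhdsWithin] with r hr
  rw [norm_smul, norm_smul]
  gcongr
  exact (h.shift (le_of_lt hr)).norm_sub_le h hs hst

end Cost

/-! ### Almost every time, and the potential energy -/

theorem frequently_nhdsGT_of_ae {P : ℝ → Prop} (h : ∀ᵐ t, P t) (s : ℝ) : ∃ᶠ t in 𝓝[>] s, P t := by
  intro hn
  obtain ⟨u, hu, hsub⟩ := mem_nhdsGT_iff_exists_Ioo_subset.1 hn
  have h1 : volume (Ioo s u) ≤ volume {t | ¬ P t} := measure_mono hsub
  rw [ae_iff.1 h, Real.volume_Ioo] at h1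
  have : s < u := hu
  simp at h1
  linarith

theorem continuous_energy {X : Type*} [MetricSpace X] [CompactSpace X] [MeasurableSpace X]
    [BorelSpace X] (V : C(X, ℝ)) :
    Continuous fun μ : ProbabilityMeasure X => energy V μ := by
  rw [continuous_iff_continuousAt]
  exact fun μ => Cost.tendsto_probabilityMeasure_iff.1 tendsto_id V

theorem le_energy {X : Type*} [MetricSpace X] [CompactSpace X] [MeasurableSpace X]
    [BorelSpace X] {V : C(X, ℝ)} {m : ℝ} (hm : ∀ x, m ≤ V x) (μ : ProbabilityMeasure X) :
    m ≤ energy V μ := by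
  have h := integral_mono (μ := (μ : Measure X)) (integrable_const m)
    (integrable_continuousMap μ.toFiniteMeasure V) hm
  have e : ∫ _x, m ∂(μ : Measure X) = m := by simp
  rw [e] at h
  exact h

namespace Cost

variable {X : Type*} [MetricSpace X] [CompactSpace X] [MeasurableSpace X] [BorelSpace X]
variable {S : Cost X} {V : C(X, ℝ)}

/-! ### Flow directions and the potential energy -/

theorem dens_congr_ae {α : FiniteMeasure X} {ρ ρ' : C(X, ℝ)}
    (h : ρ =ᵐ[(α : Measure X)] ρ') : S.dens α ρ = S.dens α ρ' := by
  refine integral_congr_ae ?_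
  filter_upwards [h] with x hx
  rw [hx]

/-- Complementarity: a non-negative function of integral zero. -/
theorem IsFlowDirection.ae_eq_zero {α : FiniteMeasure X} {w : S.Hc}
    (h : S.IsFlowDirection V α w) :
    ∀ᵐ x ∂(α : Measure X), w x + 2 / S.ε * (V x * S.emb α x - S.dens α V x) = 0 := by
  set F : C(X, ℝ) := S.toC w + (2 / S.ε) • (V * S.toC (S.emb α) - S.toC (S.dens α V)) with hF
  have h1 : ∫ x, F x ∂(α : Measure X) = 0 := by
    have e1 := integral_add (integrable_continuousMap α (S.toC w))
      (((integrable_continuousMap α (V * S.toC (S.emb α))).sub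
        (integrable_continuousMap α (S.toC (S.dens α V)))).const_mul (2 / S.ε))
    have e2 := integral_sub (integrable_continuousMap α (V * S.toC (S.emb α)))
        (integrable_continuousMap α (S.toC (S.dens α V)))
    refine Eq.trans ?_ (e1.trans ?_)
    · rfl
    rw [integral_const_mul]
    simp only [Pi.sub_apply] at e2 ⊢
    rw [e2]
    have e3 := h.inner_eq_zero
    rw [real_inner_comm, inner_emb] at e3
    have e4 := S.inner_dens α V (S.emb α)
    rw [real_inner_comm, inner_emb] at e4
    have e5 : ∫ x, S.toC w x ∂(α : Measure X) = ∫ x, w x ∂(α : Measure X) := rfl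
    have e6 : ∫ x, (V * S.toC (S.emb α)) x ∂(α : Measure X) =
      ∫ x, V x * S.emb α x ∂(α : Measure X) := rfl
    have e7 : ∫ x, S.toC (S.dens α V) x ∂(α : Measure X) =
      ∫ x, S.dens α V x ∂(α : Measure X) := rfl
    rw [e5, e6, e7, e3, e4, sub_self, mul_zero, add_zero]
  have h2 := (integral_eq_zero_iff_of_nonneg (f := F) (fun x => h.nonneg x)
    (integrable_continuousMap α F)).1 h1
  filter_upwards [h2] with x hx
  exact hx

/-- For a flow direction `w` at `μ`, the image of `w` under the inverse of `Id - T` is explicit. -/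
theorem IsFlowDirection.sub_T_eq {μ : ProbabilityMeasure X} {w : S.Hc}
    (h : S.IsFlowDirection V (S.alpha μ) w) :
    (w - (2 / S.ε) • S.dens (S.alpha μ) V) - S.T μ (w - (2 / S.ε) • S.dens (S.alpha μ) V) = w := by
  have h1 : S.T μ (w - (2 / S.ε) • S.dens (S.alpha μ) V) =
      S.dens (S.alpha μ) ((-(2 / S.ε)) • V) := by
    rw [T_apply]
    refine dens_congr_ae ?_
    filter_upwards [h.ae_eq_zero] with x hx
    have e := S.expC_potential_mul_B μ x
    rw [emb_alpha] at hx
    simp only [ContinuousMap.mul_apply, toC_apply, ContinuousMap.smul_apply, smul_eq_mul,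
      RKHS.coe_sub, Pi.sub_apply, RKHS.coe_smul, Pi.smul_apply]
    linear_combination S.expC (S.potential μ) x * hx - (2 / S.ε) * V x * e
  rw [h1, dens_smul]
  simp

/-- The function `V + (ε / 2) Theta U` is the opposite of the pressure. -/
theorem IsFlowDirection.pointwise_nonneg {μ : ProbabilityMeasure X} {w : S.Hc}
    (h : S.IsFlowDirection V (S.alpha μ) w) (x : X) :
    0 ≤ V x + S.ε / 2 * S.Theta μ (w - (2 / S.ε) • S.dens (S.alpha μ) V) x := by
  have h1 := h.nonneg x
  have hε := S.ε_pos
  have e := S.expC_potential_mul_B μ x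
  rw [emb_alpha] at h1
  have h2 : V x + S.ε / 2 * S.Theta μ (w - (2 / S.ε) • S.dens (S.alpha μ) V) x =
      S.ε / 2 * (S.expC (S.potential μ) x *
        (w x + 2 / S.ε * (V x * S.B μ x - S.dens (S.alpha μ) V x))) := by
    rw [Theta_apply]
    simp only [RKHS.coe_sub, Pi.sub_apply, RKHS.coe_smul, Pi.smul_apply, smul_eq_mul]
    field_simp
    linear_combination (-2 * V x) * e
  rw [h2]
  have := S.expC_pos (S.potential μ) x
  positivity

theorem IsFlowDirection.ae_pointwise_eq_zero {μ : ProbabilityMeasure X} {w : S.Hc}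
    (h : S.IsFlowDirection V (S.alpha μ) w) : ∀ᵐ x ∂(S.alpha μ : Measure X),
    V x + S.ε / 2 * S.Theta μ (w - (2 / S.ε) • S.dens (S.alpha μ) V) x = 0 := by
  filter_upwards [h.ae_eq_zero] with x hx
  have hε := S.ε_pos
  have e := S.expC_potential_mul_B μ x
  rw [emb_alpha] at hx
  rw [Theta_apply]
  simp only [RKHS.coe_sub, Pi.sub_apply, RKHS.coe_smul, Pi.smul_apply, smul_eq_mul]
  field_simp at hx ⊢
  linear_combination S.expC (S.potential μ) x * hx - 2 * V x * e

theorem energy_add_integral (μ ν : ProbabilityMeasure X) (U : S.Hc) :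
    energy V ν + S.ε / 2 * ∫ x, S.Theta μ U x ∂(ν : Measure X) =
      ∫ x, (V x + S.ε / 2 * S.Theta μ U x) ∂(ν : Measure X) := by
  have h1 := integrable_continuousMap ν.toFiniteMeasure V
  have h2 := integrable_continuousMap ν.toFiniteMeasure
    (S.expC (S.potential μ) * S.toC U)
  have h3 : ((S.expC (S.potential μ) * S.toC U : C(X, ℝ)) : X → ℝ) = S.Theta μ U := by
    ext x; rw [Theta_apply]; rfl
  rw [h3] at h2
  rw [← integral_const_mul]
  exact (integral_add h1 (h2.const_mul _)).symm

theorem IsFlowDirection.energy_add_nonneg {μ : ProbabilityMeasure X} {w : S.Hc}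
    (h : S.IsFlowDirection V (S.alpha μ) w) (ν : ProbabilityMeasure X) :
    0 ≤ energy V ν + S.ε / 2 *
      ∫ x, S.Theta μ (w - (2 / S.ε) • S.dens (S.alpha μ) V) x ∂(ν : Measure X) := by
  rw [energy_add_integral]
  exact integral_nonneg h.pointwise_nonneg

theorem IsFlowDirection.energy_add_eq_zero {μ : ProbabilityMeasure X} {w : S.Hc}
    (h : S.IsFlowDirection V (S.alpha μ) w) :
    energy V μ + S.ε / 2 *
      ∫ x, S.Theta μ (w - (2 / S.ε) • S.dens (S.alpha μ) V) x ∂(μ : Measure X) = 0 := by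
  rw [energy_add_integral, integral_eq_integral_alpha]
  refine integral_eq_zero_of_ae ?_
  filter_upwards [h.ae_pointwise_eq_zero] with x hx
  rw [hx, zero_mul]; rfl

/-- Solutions of `U - T U = w` differ by a multiple of `B(μ)`. -/
theorem eq_add_smul_B {μ : ProbabilityMeasure X} {U U' w : S.Hc} (h : U - S.T μ U = w)
    (h' : U' - S.T μ U' = w) : ∃ a : ℝ, U = U' + a • S.B μ := by
  refine ⟨inner ℝ (S.B μ) (U - U'), ?_⟩
  set a := inner ℝ (S.B μ) (U - U')
  have h1 : inner ℝ (S.B μ) (U - U' - a • S.B μ) = 0 := by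
    rw [inner_sub_right, inner_smul_right, real_inner_self_eq_norm_sq, norm_B]; simp [a]
  have h2 := S.kmin_mul_norm_sq_le μ h1
  have h3 : U - U' - a • S.B μ - S.T μ (U - U' - a • S.B μ) = 0 := by
    have e : U - U' - a • S.B μ - S.T μ (U - U' - a • S.B μ) =
      (U - S.T μ U) - (U' - S.T μ U') := by
      rw [map_sub, map_sub, map_smul, T_B]; abel
    rw [e, h, h', sub_self]
  rw [h3, inner_zero_left] at h2
  have hk := S.kmin_pos
  have h4 : ‖U - U' - a • S.B μ‖ = 0 := by
    have : ‖U - U' - a • S.B μ‖ ^ 2 ≤ 0 := by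
      by_contra! h5
      have := mul_pos hk h5
      linarith
    exact pow_eq_zero_iff (two_ne_zero) |>.1 (le_antisymm this (sq_nonneg _))
  rw [norm_eq_zero] at h4
  rw [sub_sub, sub_eq_zero] at h4
  exact h4

variable (S) in
/-- One-sided Lipschitz estimate of the energy at a point that admits a flow direction. -/
theorem exists_energy_sub_le : ∃ C : ℝ, 0 ≤ C ∧ ∀ (V : C(X, ℝ)) (μ ν : ProbabilityMeasure X)
    (w : S.Hc), S.IsFlowDirection V (S.alpha μ) w →
    energy V μ - energy V ν ≤ C * ‖w‖ * ‖S.B ν - S.B μ‖ := by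
  have hk := S.kmin_pos
  have hε := S.ε_pos
  refine ⟨S.ε / 2 * ((1 / Real.sqrt S.kmin * (1 / S.kmin) + 1) * (1 / S.kmin)), by positivity,
    fun V μ ν w h => ?_⟩
  obtain ⟨U₀, hU₀, hU₀w, hn⟩ := S.exists_sub_T_eq μ (w := w) (by
    rw [real_inner_comm, ← emb_alpha]; exact h.inner_eq_zero)
  -- `U` is only controlled modulo `B(μ)`, whose image under `Theta` is the constant `1`
  obtain ⟨a, ha⟩ := eq_add_smul_B h.sub_T_eq hU₀w
  have h1 := h.energy_add_nonneg ν
  have h2 := h.energy_add_eq_zero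
  rw [ha] at h1 h2
  have h3 : ∀ ν' : ProbabilityMeasure X, ∫ x, S.Theta μ (U₀ + a • S.B μ) x ∂(ν' : Measure X) =
      ∫ x, S.Theta μ U₀ x ∂(ν' : Measure X) + a := by
    intro ν'
    have e : ∀ x, S.Theta μ (U₀ + a • S.B μ) x = S.Theta μ U₀ x + a := by
      intro x
      rw [map_add, map_smul, RKHS.coe_add, RKHS.coe_smul]
      simp [Theta_B]
    simp only [e]
    have i2 := integrable_continuousMap ν'.toFiniteMeasure
      (S.expC (S.potential μ) * S.toC U₀)
    have i3 : ((S.expC (S.potential μ) * S.toC U₀ : C(X, ℝ)) : X → ℝ) = S.Theta μ U₀ := by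
      ext x; rw [Theta_apply]; rfl
    rw [i3] at i2
    have := integral_add i2 (integrable_const a)
    simpa using this
  rw [h3] at h1 h2
  rw [integral_Theta_eq] at h1 h2
  rw [sub_self, inner_zero_right, zero_add] at h2
  set d := S.dens (S.alpha ν) (S.expC (S.potential μ) * S.toC U₀)
  have h4 : inner ℝ d (S.B ν - S.B μ) ≤ 1 / Real.sqrt S.kmin * (1 / S.kmin) * ‖U₀‖ *
      ‖S.B ν - S.B μ‖ := by
    rw [inner_dens']
    refine (le_abs_self _).trans ((abs_integral_le _ _).trans ?_)
    rw [mul_assoc, mul_assoc, mul_assoc]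
    have hm := S.mass_alpha_le ν
    refine mul_le_mul hm ?_ (norm_nonneg _) (by positivity)
    refine (ContinuousMap.norm_le _ (by positivity)).2 fun x => ?_
    simp only [ContinuousMap.mul_apply, toC_apply, norm_mul, Real.norm_eq_abs]
    have e1 : |S.expC (S.potential μ) x| ≤ 1 / S.kmin := by
      rw [abs_of_pos (S.expC_pos _ x), le_div_iff₀ hk, ← S.expC_potential_mul_B μ x]
      exact mul_le_mul_of_nonneg_left (S.kmin_le_B μ x) (S.expC_pos _ x).le
    have e2 := S.abs_apply_le U₀ x
    have e3 := S.abs_apply_le (S.B ν - S.B μ) x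
    simp only [RKHS.coe_sub, Pi.sub_apply] at e3 ⊢
    rw [← mul_assoc]
    refine (mul_le_mul (mul_le_mul e1 e2 (abs_nonneg _) (by positivity)) e3 (abs_nonneg _)
      (by positivity)).trans_eq (by ring)
  have h5 : inner ℝ (S.B ν) U₀ - inner ℝ (S.B μ) U₀ ≤ ‖U₀‖ * ‖S.B ν - S.B μ‖ := by
    rw [← inner_sub_left, mul_comm]
    exact real_inner_le_norm _ _
  have h6 : energy V μ - energy V ν ≤
      S.ε / 2 * ((1 / Real.sqrt S.kmin * (1 / S.kmin) + 1) * ‖U₀‖ * ‖S.B ν - S.B μ‖) := by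
    have : energy V μ - energy V ν ≤ S.ε / 2 * (inner ℝ d (S.B ν - S.B μ) +
      (inner ℝ (S.B ν) U₀ - inner ℝ (S.B μ) U₀)) := by linarith
    refine this.trans ?_
    gcongr
    linarith
  refine h6.trans ?_
  have h7 : ‖U₀‖ ≤ 1 / S.kmin * ‖w‖ := by
    rw [one_div, inv_mul_eq_div, le_div_iff₀ hk]; linarith
  calc _ ≤ S.ε / 2 * ((1 / Real.sqrt S.kmin * (1 / S.kmin) + 1) * (1 / S.kmin * ‖w‖) *
        ‖S.B ν - S.B μ‖) := by gcongr
    _ = _ := by ring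

/-- Lower bound of the speed by the excess of energy. -/
theorem IsFlowDirection.kmin_mul_energy_sub_le {μ : ProbabilityMeasure X} {w : S.Hc}
    (h : S.IsFlowDirection V (S.alpha μ) w) {x : X} (hx : ∀ y, V x ≤ V y) :
    S.kmin * (energy V μ - V x) ≤ S.ε / 2 * ‖w‖ := by
  have hε := S.ε_pos
  have hk := S.kmin_pos
  have h1 := h.nonneg x
  have h2 : S.dens (S.alpha μ) V x - V x * S.emb (S.alpha μ) x =
      ∫ y, (V y - V x) * S.kc y x ∂(S.alpha μ : Measure X) := by
    have e : S.dens (S.alpha μ) V x - V x * S.emb (S.alpha μ) x =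
      S.dens (S.alpha μ) (V - (V x) • 1) x := by
      rw [dens_sub, dens_smul, RKHS.coe_sub, RKHS.coe_smul]; rfl
    rw [e, dens_apply]; simp
  have h3 : S.kmin * (energy V μ - V x) ≤
      ∫ y, (V y - V x) * S.kc y x ∂(S.alpha μ : Measure X) := by
    have e : energy V μ - V x = ∫ y, (V y - V x) ∂(μ : Measure X) := by
      have := integral_sub (integrable_continuousMap μ.toFiniteMeasure V) (integrable_const (V x))
      have e2 : ∫ _y, V x ∂(μ.toFiniteMeasure : Measure X) = V x := by
        have : IsProbabilityMeasure (μ.toFiniteMeasure : Measure X) :=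
          inferInstanceAs (IsProbabilityMeasure (μ : Measure X))
        simp
      rw [e2] at this
      exact this.symm
    rw [e, integral_eq_integral_alpha, ← integral_const_mul]
    refine integral_mono ?_ ?_ fun y => ?_
    · exact integrable_continuousMap (S.alpha μ)
        (S.kmin • ((V - (V x) • 1) * S.toC (S.B μ))) |>.congr
        (Eventually.of_forall fun y => by simp [toC_apply])
    · exact integrable_continuousMap (S.alpha μ) ((V - (V x) • 1) * S.toC (S.sec x)) |>.congr
        (Eventually.of_forall fun y => by simp [toC_apply, kerSection_apply, S.kc_symm x y])
    · have e1 := S.kmin_le_kc y x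
      have e2 := S.B_le_one μ y
      have e3 := sub_nonneg.2 (hx y)
      calc S.kmin * ((V y - V x) * S.B μ y) ≤ S.kmin * ((V y - V x) * 1) := by gcongr
        _ = (V y - V x) * S.kmin := by ring
        _ ≤ _ := by gcongr
  have h4 := (le_abs_self _).trans (S.abs_apply_le w x)
  rw [← h2] at h3
  have h5 : S.dens (S.alpha μ) V x - V x * S.emb (S.alpha μ) x ≤ S.ε / 2 * w x := by
    have := mul_nonneg (by positivity : 0 ≤ S.ε / 2) h1
    have e : S.ε / 2 * (w x + 2 / S.ε * (V x * S.emb (S.alpha μ) x - S.dens (S.alpha μ) V x)) =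
      S.ε / 2 * w x + (V x * S.emb (S.alpha μ) x - S.dens (S.alpha μ) V x) := by
      field_simp
    linarith
  refine h3.trans (h5.trans ?_)
  gcongr

end Cost

/-! ### Monotonicity along absolutely continuous curves -/

/-- A linear form along an absolutely continuous curve, perturbed by a real function. -/
theorem inner_add_le_of_ae_hasDerivAt {H : Type*} [NormedAddCommGroup H] [InnerProductSpace ℝ H]
    {b : ℝ → H} {ψ : ℝ → ℝ} {s t : ℝ} (hst : s ≤ t) (hb : AbsolutelyContinuousOnInterval b s t)
    (hψ : AbsolutelyContinuousOnInterval ψ s t) (e : H)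
    (h : ∀ᵐ r, r ∈ Ioo s t → ∃ w d, HasDerivAt b w r ∧ HasDerivAt ψ d r ∧ inner ℝ e w + d ≤ 0) :
    inner ℝ e (b t) + ψ t ≤ inner ℝ e (b s) + ψ s := by
  have h1 : AbsolutelyContinuousOnInterval (fun r => inner ℝ e (b r)) s t := by
    refine AbsolutelyContinuousOnInterval.of_dist_le (hb.const_smul ‖e‖) fun x _ y _ => ?_
    rw [dist_smul₀, norm_norm, Real.dist_eq, dist_eq_norm,
      ← inner_sub_right]
    exact abs_real_inner_le_norm _ _
  refine le_of_ae_hasDerivAt_nonpos hst (h1.add hψ) ?_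
  filter_upwards [h] with r hr hr'
  obtain ⟨w, d, hw, hd, hwd⟩ := hr hr'
  refine ⟨_, hwd, ?_⟩
  have := ((hasDerivAt_const r e).inner ℝ hw).add hd
  simpa using this

theorem absolutelyContinuousOnInterval_const_mul (c s t : ℝ) :
    AbsolutelyContinuousOnInterval (fun r => c * r) s t :=
  (LipschitzWith.of_dist_le_mul (K := ‖c‖₊) fun x y => by
    rw [Real.dist_eq, Real.dist_eq, ← mul_sub, abs_mul]; rfl).lipschitzOnWith
    |>.absolutelyContinuousOnInterval

namespace Cost

variable {X : Type*} [MetricSpace X] [CompactSpace X] [MeasurableSpace X] [BorelSpace X]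
variable {S : Cost X} {V : C(X, ℝ)} {γ : ℝ → ProbabilityMeasure X}

/-! ### Energy dissipation along an evolution -/

/-- After a time at which it is differentiable, an evolution is Lipschitz. -/
theorem IsEvolution.norm_sub_le_mul (h : S.IsEvolution V γ) {r s t : ℝ} {w : S.Hc} (hr : 0 ≤ r)
    (hw : HasDerivAt (fun t => S.B (γ t)) w r) (hs : 0 < s) (hrs : r ≤ s) (hst : s ≤ t) :
    ‖S.B (γ t) - S.B (γ s)‖ ≤ ‖w‖ * (t - s) := by
  set e := S.B (γ t) - S.B (γ s) with he
  have h1 := inner_add_le_of_ae_hasDerivAt hst (h.absolutelyContinuousOnInterval hs hst)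
    (absolutelyContinuousOnInterval_const_mul (-(‖e‖ * ‖w‖)) s t) e (by
      filter_upwards [h.dir] with q hq hq'
      obtain ⟨z, hz, -⟩ := hq (hs.trans hq'.1)
      refine ⟨z, _, hz, (hasDerivAt_id q).const_mul _, ?_⟩
      have h2 := real_inner_le_norm e z
      have h3 := h.norm_deriv_le hr (hrs.trans hq'.1.le) hw hz
      nlinarith [norm_nonneg e])
  have h4 : ‖e‖ ^ 2 ≤ ‖e‖ * (‖w‖ * (t - s)) := by
    rw [← real_inner_self_eq_norm_sq]
    nth_rw 2 [he]
    rw [inner_sub_right]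
    linarith
  rcases (norm_nonneg e).eq_or_lt with h5 | h5
  · rw [← h5]
    have := sub_nonneg.2 hst
    positivity
  · nlinarith

theorem IsEvolution.exists_direction (h : S.IsEvolution V γ) {a b : ℝ} (ha : 0 ≤ a) (hab : a < b) :
    ∃ r ∈ Ioo a b, ∃ w, HasDerivAt (fun s => S.B (γ s)) w r ∧
      S.IsFlowDirection V (S.alpha (γ r)) w := by
  have h1 := (frequently_nhdsGT_of_ae h.dir a).and_eventually (Ioo_mem_nhdsGT hab)
  obtain ⟨r, hr, hr'⟩ := h1.exists
  exact ⟨r, hr', hr (ha.trans_lt hr'.1)⟩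

theorem IsEvolution.continuousOn (hS : S.IsUniversal) (h : S.IsEvolution V γ) :
    ContinuousOn γ (Ici 0) :=
  (S.isClosedEmbedding_B hS).isInducing.continuousOn_iff.2 h.cont

theorem IsEvolution.continuousOn_energy (hS : S.IsUniversal) (h : S.IsEvolution V γ) :
    ContinuousOn (fun t => energy V (γ t)) (Ici 0) :=
  (continuous_energy V).comp_continuousOn (h.continuousOn hS)

theorem IsEvolution.exists_lipschitz_energy (hS : S.IsUniversal) (h : S.IsEvolution V γ) {δ : ℝ}
    (hδ : 0 < δ) : ∃ L : ℝ≥0, LipschitzOnWith L (fun t => energy V (γ t)) (Ici δ) := by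
  obtain ⟨r, hr, w, hw, -⟩ := h.exists_direction le_rfl hδ
  obtain ⟨C, hC, hE⟩ := S.exists_energy_sub_le
  set L := C * ‖w‖ * ‖w‖ with hL
  have hL0 : 0 ≤ L := by positivity
  have hdist : ∀ s t, δ ≤ s → δ ≤ t → ‖S.B (γ t) - S.B (γ s)‖ ≤ ‖w‖ * |t - s| := by
    intro s t hs ht
    rcases le_total s t with hst | hst
    · rw [abs_of_nonneg (sub_nonneg.2 hst)]
      exact h.norm_sub_le_mul hr.1.le hw (by linarith) (by linarith [hr.2]) hst
    · rw [abs_sub_comm, abs_of_nonneg (sub_nonneg.2 hst), norm_sub_rev]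
      exact h.norm_sub_le_mul hr.1.le hw (by linarith) (by linarith [hr.2]) hst
  have key : ∀ s t, δ ≤ s → δ ≤ t → energy V (γ s) - energy V (γ t) ≤ L * |t - s| := by
    intro s t hs ht
    have hc : ContinuousWithinAt (fun s => energy V (γ s)) (Ioi s) s :=
      (h.continuousOn_energy hS s (by simp only [mem_Ici]; linarith)).mono fun x hx => by
        simp only [mem_Ici, mem_Ioi] at *; linarith
    have h1 : Tendsto (fun s => energy V (γ s) - energy V (γ t)) (𝓝[>] s)
        (𝓝 (energy V (γ s) - energy V (γ t))) := hc.tendsto.sub_const _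
    have h2 : Tendsto (fun s => L * |t - s|) (𝓝[>] s) (𝓝 (L * |t - s|)) :=
      (Continuous.tendsto (by fun_prop) s).mono_left nhdsWithin_le_nhds
    refine le_of_tendsto_of_tendsto_of_frequently h1 h2 ?_
    refine ((frequently_nhdsGT_of_ae h.dir s).and_eventually self_mem_nhdsWithin).mono ?_
    rintro q ⟨hq, hq'⟩
    have hq' : s < q := hq'
    obtain ⟨z, hz, hzd⟩ := hq (by linarith)
    refine (hE V _ (γ t) z hzd).trans ?_
    have h3 := h.norm_deriv_le hr.1.le (by linarith [hr.2]) hw hz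
    have h4 := hdist q t (by linarith) ht
    rw [hL, mul_assoc _ ‖w‖ |t - q|]
    gcongr
  refine ⟨⟨L, hL0⟩, LipschitzOnWith.of_dist_le_mul fun s hs t ht => ?_⟩
  rw [Real.dist_eq, Real.dist_eq, abs_sub_le_iff]
  refine ⟨?_, ?_⟩
  · rw [abs_sub_comm]; exact key s t hs ht
  · exact key t s ht hs

theorem IsEvolution.absolutelyContinuousOnInterval_energy (hS : S.IsUniversal)
    (h : S.IsEvolution V γ) {a b : ℝ} (ha : 0 < a) (hab : a ≤ b) :
    AbsolutelyContinuousOnInterval (fun t => energy V (γ t)) a b := by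
  obtain ⟨L, hL⟩ := h.exists_lipschitz_energy hS ha
  refine (hL.mono ?_).absolutelyContinuousOnInterval
  rw [uIcc_of_le hab]
  exact Icc_subset_Ici_self

/-- Energy dissipation: `E(γ_s) + (ε / 2) ∫ Θ U dγ_s` is minimal at `s = t`. -/
theorem IsEvolution.hasDerivAt_energy (hS : S.IsUniversal) (h : S.IsEvolution V γ) :
    ∀ᵐ t : ℝ, 0 < t → ∃ w, HasDerivAt (fun s => S.B (γ s)) w t ∧
      S.IsFlowDirection V (S.alpha (γ t)) w ∧
      HasDerivAt (fun s => energy V (γ s))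
        (-S.metricTensor (γ t) (S.vel (γ t) w) (S.vel (γ t) w)) t := by
  have hd : ∀ᵐ t : ℝ, ∀ n : ℕ, t ∈ uIcc (1 / ((n : ℝ) + 1)) (n + 1) →
      DifferentiableAt ℝ (fun s => energy V (γ s)) t := by
    refine ae_all_iff.2 fun n => ?_
    refine (h.absolutelyContinuousOnInterval_energy hS (by positivity) ?_).ae_differentiableAt
    rw [div_le_iff₀ (by positivity)]
    nlinarith [(Nat.cast_nonneg n : (0 : ℝ) ≤ n)]
  filter_upwards [hd, h.dir] with t ht1 ht2 ht
  obtain ⟨w, hw, hwd⟩ := ht2 ht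
  refine ⟨w, hw, hwd, ?_⟩
  have hdt : DifferentiableAt ℝ (fun s => energy V (γ s)) t := by
    obtain ⟨n, hn⟩ := exists_nat_one_div_lt ht
    obtain ⟨k, hk⟩ := exists_nat_ge t
    refine ht1 (max n k) ?_
    rw [uIcc_of_le]
    · constructor
      · refine le_trans ?_ hn.le
        gcongr
        exact le_max_left _ _
      · refine hk.trans ?_
        have : (k : ℝ) ≤ (max n k : ℕ) := by exact_mod_cast le_max_right n k
        linarith
    · rw [div_le_iff₀ (by positivity)]
      nlinarith [(Nat.cast_nonneg (max n k) : (0 : ℝ) ≤ (max n k : ℕ))]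
  set U := w - (2 / S.ε) • S.dens (S.alpha (γ t)) V with hU
  have h1 := (hasDerivAt_integral_Theta S hS hw U).const_mul (S.ε / 2)
  have h2 := hdt.hasDerivAt.add h1
  have h3 : IsLocalMin (fun s => energy V (γ s) +
      S.ε / 2 * ∫ x, S.Theta (γ t) U x ∂(γ s : Measure X)) t :=
    Eventually.of_forall fun s => (hwd.energy_add_eq_zero).trans_le (hwd.energy_add_nonneg (γ s))
  have h4 := h3.hasDerivAt_eq_zero h2
  rw [S.metricTensor_vel (γ t) hwd.sub_T_eq, ← eq_neg_of_add_eq_zero_left h4]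
  exact hdt.hasDerivAt

theorem IsFlowDirection.le_metricTensor {μ : ProbabilityMeasure X} {w : S.Hc}
    (h : S.IsFlowDirection V (S.alpha μ) w) :
    S.ε / 2 * ‖w‖ ^ 2 ≤ S.metricTensor μ (S.vel μ w) (S.vel μ w) :=
  S.le_metricTensor_vel μ (by rw [real_inner_comm, ← emb_alpha]; exact h.inner_eq_zero)

theorem IsEvolution.antitoneOn_energy (hS : S.IsUniversal) (h : S.IsEvolution V γ) :
    AntitoneOn (fun t => energy V (γ t)) (Ici 0) := by
  have key : ∀ s t, 0 < s → s ≤ t → energy V (γ t) ≤ energy V (γ s) := by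
    intro s t hs hst
    refine le_of_ae_hasDerivAt_nonpos hst (h.absolutelyContinuousOnInterval_energy hS hs hst) ?_
    filter_upwards [h.hasDerivAt_energy hS] with r hr hr'
    obtain ⟨w, -, hw, hd⟩ := hr (hs.trans hr'.1)
    refine ⟨_, ?_, hd⟩
    have := hw.le_metricTensor
    have hε := S.ε_pos
    have : 0 ≤ S.ε / 2 * ‖w‖ ^ 2 := by positivity
    linarith
  intro s hs t _ hst
  rcases (mem_Ici.1 hs).eq_or_lt with rfl | hs
  · rcases hst.eq_or_lt with rfl | ht
    · exact le_rfl
    have h1 := ((h.continuousOn_energy hS) 0 self_mem_Ici).mono Ioi_subset_Ici_self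
    refine ge_of_tendsto h1.tendsto ?_
    filter_upwards [Ioc_mem_nhdsGT ht] with r hr
    exact key r t hr.1 hr.2
  · exact key s t hs hst

/-- The speed at time `t` is at most of order `1 / √t`. -/
theorem IsEvolution.norm_deriv_sq_mul_le (hS : S.IsUniversal) (h : S.IsEvolution V γ) {t : ℝ}
    (ht : 0 < t) {w : S.Hc} (hw : HasDerivAt (fun s => S.B (γ s)) w t) :
    S.ε * ‖w‖ ^ 2 * t ≤ 4 * (energy V (γ 0) - energy V (γ t)) := by
  have hε := S.ε_pos
  have hst : t / 2 ≤ t := by linarith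
  have h1 := inner_add_le_of_ae_hasDerivAt hst
    (h.absolutelyContinuousOnInterval_energy hS (by positivity) hst)
    (absolutelyContinuousOnInterval_const_mul (S.ε / 2 * ‖w‖ ^ 2) _ _) (1 : ℝ) (by
      filter_upwards [h.hasDerivAt_energy hS] with r hr hr'
      obtain ⟨z, hz, hzd, hd⟩ := hr (by linarith [hr'.1])
      refine ⟨_, _, hd, (hasDerivAt_id r).const_mul _, ?_⟩
      have h2 := hzd.le_metricTensor
      have h3 := h.norm_deriv_le (by linarith [hr'.1]) hr'.2.le hz hw
      have h4 : S.ε / 2 * ‖w‖ ^ 2 ≤ S.ε / 2 * ‖z‖ ^ 2 := by gcongr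
      simp
      linarith)
  have h5 := h.antitoneOn_energy hS (self_mem_Ici (a := (0 : ℝ))) (mem_Ici.2 (by linarith : 0 ≤ t / 2))
    (by linarith)
  simp at h1 h5
  nlinarith

end Cost
namespace Cost

variable {X : Type*} [MetricSpace X] [CompactSpace X] [MeasurableSpace X] [BorelSpace X]
variable {S : Cost X} {V : C(X, ℝ)} {γ : ℝ → ProbabilityMeasure X}

theorem neg_norm_le_energy (V : C(X, ℝ)) (μ : ProbabilityMeasure X) : -‖V‖ ≤ energy V μ :=
  le_energy (fun x => (abs_le.1 (V.norm_coe_le_norm x)).1) μ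

theorem energy_sub_le (V : C(X, ℝ)) (μ ν : ProbabilityMeasure X) :
    energy V μ - energy V ν ≤ 2 * ‖V‖ := by
  have h1 := neg_norm_le_energy V ν
  have h2 := neg_norm_le_energy (-V) μ
  have h3 : energy (-V) μ = -energy V μ := integral_neg _
  rw [norm_neg, h3] at h2
  linarith

/-- The energy is bounded and monotone, so that its derivative is integrable up to `t = 0`, although
the curve is only known to be Lipschitz away from `0`. -/
theorem IsEvolution.integrableOn_deriv_energy (hS : S.IsUniversal) (h : S.IsEvolution V γ) :
    IntegrableOn (deriv fun t => energy V (γ t)) (Ici 0) ∧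
      ∀ s t, 0 ≤ s → s ≤ t →
        energy V (γ t) - energy V (γ s) = ∫ r in s..t, deriv (fun t => energy V (γ t)) r := by
  set E := fun t => energy V (γ t) with hE
  have hanti : ∀ b : ℝ, 0 ≤ b → MonotoneOn (fun t => -E t) (uIcc 0 b) := by
    intro b hb s hs t ht hst
    rw [uIcc_of_le hb] at hs ht
    exact neg_le_neg (h.antitoneOn_energy hS hs.1 ht.1 hst)
  have hderiv : deriv (fun t => -E t) = fun t => -deriv E t := by ext t; exact deriv.neg
  have hint : ∀ b : ℝ, 0 ≤ b → IntervalIntegrable (deriv E) volume 0 b := by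
    intro b hb
    have := (hanti b hb).intervalIntegrable_deriv
    rw [hderiv] at this
    have h1 := this.neg
    have h2 : -(fun t => -deriv E t) = deriv E := by ext t; simp
    rwa [h2] at h1
  have hftc : ∀ s t, 0 ≤ s → s ≤ t → E t - E s = ∫ r in s..t, deriv E r := by
    intro s t hs hst
    have key : ∀ s, 0 < s → s ≤ t → E t - E s = ∫ r in s..t, deriv E r := fun s hs hst =>
      (h.absolutelyContinuousOnInterval_energy hS hs hst).integral_deriv_eq_sub.symm
    rcases hs.eq_or_lt with rfl | hs
    · rcases hst.eq_or_lt with rfl | ht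
      · simp
      have h1 := ((h.continuousOn_energy hS 0 self_mem_Ici).mono Ioi_subset_Ici_self).tendsto
      have h2 : ContinuousWithinAt (fun s => ∫ r in s..t, deriv E r) (uIcc t 0) 0 := by
        have := intervalIntegral.continuousOn_primitive_interval' (hint t ht.le).symm
          (left_mem_uIcc (a := t)) 0 right_mem_uIcc
        have := this.neg
        refine this.congr (fun s _ => ?_) ?_ <;> exact intervalIntegral.integral_symm _ _
      have h3 : 𝓝[>] (0 : ℝ) ≤ 𝓝[uIcc t 0] 0 := by
        rw [uIcc_of_ge ht.le, nhdsWithin_Icc_eq_nhdsGE ht]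
        exact nhdsWithin_mono _ Ioi_subset_Ici_self
      refine tendsto_nhds_unique (h1.const_sub (E t)) ((h2.tendsto.mono_left h3).congr' ?_)
      filter_upwards [Ioc_mem_nhdsGT ht] with r hr
      exact (key r hr.1 hr.2).symm
    · exact key s hs hst
  have hneg : ∀ᵐ t, 0 < t → deriv E t ≤ 0 := by
    filter_upwards [h.hasDerivAt_energy hS] with t ht ht0
    obtain ⟨w, -, hw, hd⟩ := ht ht0
    rw [hd.deriv]
    have := hw.le_metricTensor
    have hε := S.ε_pos
    have : 0 ≤ S.ε / 2 * ‖w‖ ^ 2 := by positivity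
    linarith
  refine ⟨?_, hftc⟩
  rw [integrableOn_Ici_iff_integrableOn_Ioi]
  refine integrableOn_Ioi_of_intervalIntegral_norm_bounded (2 * ‖V‖) 0 (l := atTop)
    (b := fun n : ℕ => (n : ℝ))
    (fun n => ((hint n (Nat.cast_nonneg n)).1)) tendsto_natCast_atTop_atTop
    (Eventually.of_forall fun n => ?_)
  have e : ∫ x in (0 : ℝ)..n, ‖deriv E x‖ = ∫ x in (0 : ℝ)..n, -deriv E x := by
    refine intervalIntegral.integral_congr_ae ?_
    filter_upwards [hneg] with t ht ht'
    rw [uIoc_of_le (Nat.cast_nonneg n)] at ht'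
    rw [Real.norm_eq_abs, abs_of_nonpos (ht ht'.1)]
  rw [e, intervalIntegral.integral_neg, ← hftc 0 n le_rfl (Nat.cast_nonneg n)]
  have := energy_sub_le V (γ 0) (γ n)
  simp only [hE]
  linarith

theorem IsEvolution.isACCurve_energy (hS : S.IsUniversal) (h : S.IsEvolution V γ) :
    IsACCurve 1 (Ici 0) edist (fun t => energy V (γ t)) := by
  obtain ⟨h1, h2⟩ := h.integrableOn_deriv_energy hS
  refine ⟨fun t => -deriv (fun t => energy V (γ t)) t, memLp_one_iff_integrable.2 h1.neg, ?_⟩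
  intro s hs t ht hst
  rw [intervalIntegral.integral_neg, ← h2 s t hs hst, edist_dist, Real.dist_eq,
    abs_of_nonneg (sub_nonneg.2 (h.antitoneOn_energy hS hs ht hst)), neg_sub]

/-- The speed of an evolution is square integrable, up to the initial time. -/
theorem IsEvolution.exists_memLp (hS : S.IsUniversal) (h : S.IsEvolution V γ) :
    ∃ m : ℝ → ℝ, (∀ t, 0 ≤ m t) ∧ MemLp m 2 (volume.restrict (Ici 0)) ∧
      ∀ s t, 0 ≤ s → s ≤ t → ‖S.B (γ t) - S.B (γ s)‖ ≤ ∫ r in s..t, m r := by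
  have hε := S.ε_pos
  obtain ⟨h1, h2⟩ := h.integrableOn_deriv_energy hS
  set D := deriv fun t => energy V (γ t) with hD
  set m : ℝ → ℝ := fun t => Real.sqrt (2 / S.ε * -D t) with hm
  have hmeas : Measurable m := ((measurable_deriv _).neg.const_mul _).sqrt
  have hD0 : ∀ᵐ t, 0 < t → ∃ w, HasDerivAt (fun s => S.B (γ s)) w t ∧ ‖w‖ ^ 2 ≤ 2 / S.ε * -D t := by
    filter_upwards [h.hasDerivAt_energy hS] with t ht ht0
    obtain ⟨w, hw, hwd, hd⟩ := ht ht0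
    refine ⟨w, hw, ?_⟩
    rw [hD, hd.deriv, neg_neg, div_mul_eq_mul_div, le_div_iff₀ hε]
    linarith [hwd.le_metricTensor]
  have hmL : MemLp m 2 (volume.restrict (Ici 0)) := by
    rw [memLp_two_iff_integrable_sq hmeas.aestronglyMeasurable]
    refine (h1.neg.const_mul (2 / S.ε)).congr ?_
    have h3 : ∀ᵐ t : ℝ, t ≠ 0 := by simp [ae_iff, measure_singleton]
    rw [EventuallyEq, ae_restrict_iff' measurableSet_Ici]
    filter_upwards [hD0, h3] with t ht ht0 ht1
    obtain ⟨w, -, hw⟩ := ht (lt_of_le_of_ne ht1 (Ne.symm ht0))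
    exact (Real.sq_sqrt ((sq_nonneg _).trans hw)).symm
  refine ⟨m, fun t => Real.sqrt_nonneg _, hmL, ?_⟩
  have hmi : ∀ s t, 0 ≤ s → s ≤ t → IntervalIntegrable m volume s t := by
    intro s t hs hst
    rw [intervalIntegrable_iff_integrableOn_Icc_of_le hst]
    exact (hmL.mono_measure (Measure.restrict_mono (fun x hx => hs.trans hx.1) le_rfl)).integrable
      one_le_two
  have key : ∀ s t, 0 < s → s ≤ t → ‖S.B (γ t) - S.B (γ s)‖ ≤ ∫ r in s..t, m r := by
    intro s t hs hst
    set e := S.B (γ t) - S.B (γ s) with he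
    have hM := (hmi s t hs.le hst)
    have hsub : ∀ x ∈ uIcc s t, 0 < x := fun x hx => by
      rw [uIcc_of_le hst] at hx; exact hs.trans_le hx.1
    have h3 := inner_add_le_of_ae_hasDerivAt hst (h.absolutelyContinuousOnInterval hs hst)
      ((hM.absolutelyContinuousOnInterval_intervalIntegral left_mem_uIcc).const_mul (-‖e‖)) e (by
        filter_upwards [hD0, hM.ae_hasDerivAt_integral] with r hr hr2 hr'
        obtain ⟨w, hw, hwd⟩ := hr (hs.trans hr'.1)
        have hr'' : r ∈ uIcc s t := by rw [uIcc_of_le hst]; exact Ioo_subset_Icc_self hr'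
        refine ⟨_, _, hw, (hr2 hr'' s left_mem_uIcc).const_mul _, ?_⟩
        have h4 := real_inner_le_norm e w
        have h5 : ‖w‖ ≤ m r := Real.le_sqrt_of_sq_le hwd
        nlinarith [norm_nonneg e])
    simp only [intervalIntegral.integral_same] at h3
    have h4 : ‖e‖ ^ 2 ≤ ‖e‖ * ∫ r in s..t, m r := by
      rw [← real_inner_self_eq_norm_sq]
      nth_rw 2 [he]
      rw [inner_sub_right]
      linarith
    have h5 : 0 ≤ ∫ r in s..t, m r :=
      intervalIntegral.integral_nonneg hst fun r _ => Real.sqrt_nonneg _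
    rcases (norm_nonneg e).eq_or_lt with h6 | h6
    · rwa [← h6]
    · nlinarith
  intro s t hs hst
  rcases hs.eq_or_lt with rfl | hs
  · rcases hst.eq_or_lt with rfl | ht
    · simp
    have h3 := ((h.cont 0 self_mem_Ici).mono Ioi_subset_Ici_self).tendsto
    refine le_of_tendsto (h3.const_sub (S.B (γ t))).norm ?_
    filter_upwards [Ioc_mem_nhdsGT ht] with r hr
    refine (key r t hr.1 hr.2).trans ?_
    rw [← intervalIntegral.integral_add_adjacent_intervals (hmi 0 r le_rfl hr.1.le)
      (hmi r t hr.1.le hr.2)]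
    have : 0 ≤ ∫ q in (0 : ℝ)..r, m q :=
      intervalIntegral.integral_nonneg hr.1.le fun r _ => Real.sqrt_nonneg _
    linarith
  · exact key s t hs hst

/-! ### Long-term behavior -/

theorem IsEvolution.tendsto_energy (hS : S.IsUniversal) (h : S.IsEvolution V γ) {x : X}
    (hx : ∀ y, V x ≤ V y) : Tendsto (fun t => energy V (γ t)) atTop (𝓝 (V x)) := by
  have hε := S.ε_pos
  have hk := S.kmin_pos
  rw [tendsto_order]
  refine ⟨fun a ha => Eventually.of_forall fun t => ha.trans_le (le_energy hx _), fun a ha => ?_⟩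
  -- the excess of energy at a time where the curve is differentiable is at most of order `1 / √t`
  set η := S.kmin * (a - V x) / S.ε with hη
  have hη0 : 0 < η := by have := sub_pos.2 ha; positivity
  set t₀ := 8 * ‖V‖ / (S.ε * η ^ 2) with ht₀
  have ht₀0 : 0 ≤ t₀ := by positivity
  obtain ⟨t, ht, w, hw, hwd⟩ := h.exists_direction ht₀0 (lt_add_one t₀)
  have ht0 : 0 < t := ht₀0.trans_lt ht.1
  have h1 := h.norm_deriv_sq_mul_le hS ht0 hw
  have h2 := energy_sub_le V (γ 0) (γ t)
  have h3 : ‖w‖ < η := by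
    by_contra! h4
    have h5 : S.ε * η ^ 2 * t ≤ S.ε * ‖w‖ ^ 2 * t := by gcongr
    have h6 := ht.1
    rw [ht₀, div_lt_iff₀ (by positivity)] at h6
    nlinarith
  have h4 := hwd.kmin_mul_energy_sub_le hx
  have h5 : energy V (γ t) < a := by
    have h6 : S.ε * η = S.kmin * (a - V x) := by rw [hη]; field_simp
    have h7 : S.kmin * (energy V (γ t) - V x) < S.kmin * (a - V x) := by nlinarith
    have := lt_of_mul_lt_mul_left h7 hk.le
    linarith
  filter_upwards [eventually_ge_atTop t] with s hs
  exact (h.antitoneOn_energy hS (mem_Ici.2 ht0.le) (mem_Ici.2 (ht0.le.trans hs)) hs).trans_lt h5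

theorem eq_diracProba_of_energy_eq {V : C(X, ℝ)} {x : X} (hx : ∀ y, y ≠ x → V x < V y)
    {μ : ProbabilityMeasure X} (h : energy V μ = V x) : μ = diracProba x := by
  have hx' : ∀ y, V x ≤ V y := fun y => by
    by_cases e : y = x
    · rw [e]
    · exact (hx y e).le
  have h1 : ∫ y, (V y - V x) ∂(μ : Measure X) = 0 := by
    have e1 := integral_sub (integrable_continuousMap μ.toFiniteMeasure V) (integrable_const (V x))
    have e2 : ∫ _y, V x ∂(μ : Measure X) = V x := by simp
    have e3 : ∫ y, V y ∂(μ : Measure X) = V x := h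
    refine e1.trans ?_
    exact (congrArg₂ (· - ·) e3 e2).trans (sub_self _)
  have hi : Integrable (fun y => V y - V x) (μ : Measure X) :=
    (integrable_continuousMap μ.toFiniteMeasure V).sub (integrable_const (V x))
  have h2 := (integral_eq_zero_iff_of_nonneg (fun y => sub_nonneg.2 (hx' y)) hi).1 h1
  have h3 : ∀ᵐ y ∂(μ : Measure X), y = x := by
    filter_upwards [h2] with y hy
    by_contra hne
    have := hx y hne
    simp only [Pi.zero_apply] at hy
    linarith
  apply Subtype.ext
  change (μ : Measure X) = Measure.dirac x
  ext A hA
  rw [Measure.dirac_apply' _ hA]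
  by_cases hxA : x ∈ A
  · rw [indicator_of_mem hxA]
    have : A =ᵐ[(μ : Measure X)] univ := by
      filter_upwards [h3] with y hy
      exact propext ⟨fun _ => trivial, fun _ => by subst hy; exact hxA⟩
    rw [measure_congr this, measure_univ]; rfl
  · rw [indicator_of_notMem hxA]
    refine measure_mono_null (fun y hy => ?_) (ae_iff.1 h3)
    intro e
    exact hxA (e ▸ hy)

theorem IsEvolution.tendsto_diracProba (hS : S.IsUniversal) (h : S.IsEvolution V γ) {x : X}
    (hx : ∀ y, y ≠ x → V x < V y) : Tendsto γ atTop (𝓝 (diracProba x)) := by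
  have hx' : ∀ y, V x ≤ V y := fun y => by
    by_cases e : y = x
    · rw [e]
    · exact (hx y e).le
  rw [tendsto_iff_ultrafilter]
  intro g hg
  obtain ⟨ν, -, hν⟩ := isCompact_univ.ultrafilter_le_nhds' (g.map γ) univ_mem
  have hν : Tendsto γ g (𝓝 ν) := hν
  have h1 := ((continuous_energy V).tendsto ν).comp hν
  have h2 := (h.tendsto_energy hS hx').mono_left hg
  rw [← eq_diracProba_of_energy_eq hx (tendsto_nhds_unique h1 h2)]
  exact hν

end Cost

/-! ### Comparison of the Riemannian distance with the distance of the embeddings -/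

/-- Jensen's inequality on the unit interval. -/
theorem enorm_intervalIntegral_rpow_le {H : Type*} [NormedAddCommGroup H] [NormedSpace ℝ H]
    {v : ℝ → H} (hv : AEStronglyMeasurable v (volume.restrict (Icc 0 1))) :
    ‖∫ t in (0 : ℝ)..1, v t‖ₑ ^ (2 : ℝ) ≤ ∫⁻ t in Icc (0 : ℝ) 1, ‖v t‖ₑ ^ (2 : ℝ) := by
  have : IsProbabilityMeasure (volume.restrict (Icc (0 : ℝ) 1)) := ⟨by simp⟩
  rw [intervalIntegral.integral_of_le zero_le_one, ← integral_Icc_eq_integral_Ioc]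
  have h1 := enorm_integral_le_lintegral_enorm (μ := volume.restrict (Icc (0 : ℝ) 1)) v
  rw [← eLpNorm_one_eq_lintegral_enorm] at h1
  have h2 := h1.trans (eLpNorm_le_eLpNorm_of_exponent_le one_le_two hv)
  rw [eLpNorm_eq_lintegral_rpow_enorm_toReal two_ne_zero ENNReal.ofNat_ne_top] at h2
  have h3 := ENNReal.rpow_le_rpow h2 (zero_le_two (α := ℝ))
  rwa [← ENNReal.rpow_mul, ENNReal.toReal_ofNat, one_div, inv_mul_cancel₀ two_ne_zero,
    ENNReal.rpow_one] at h3

/-- Reparametrization of an absolutely continuous curve by the (regularized) arc length. -/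
theorem exists_lipschitz_reparametrization {Y : Type*} [PseudoMetricSpace Y] {f : ℝ → Y}
    {m : ℝ → ℝ} {s t : ℝ} (hst : s ≤ t) (hm : IntervalIntegrable m volume s t)
    (h : ∀ x ∈ Icc s t, ∀ y ∈ Icc s t, x ≤ y → dist (f x) (f y) ≤ ∫ r in x..y, m r) :
    ∃ τ : ℝ → ℝ, τ 0 = s ∧ τ 1 = t ∧ ∀ q ∈ Icc (0 : ℝ) 1, ∀ q' ∈ Icc (0 : ℝ) 1, q ≤ q' →
      dist (f (τ q)) (f (τ q')) ≤ (∫ r in s..t, (m r + 1)) * (q' - q) := by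
  -- adding `1` makes the length function strictly increasing
  have hm1 : IntervalIntegrable (fun r => m r + 1) volume s t := hm.add (by simp)
  have hsub : ∀ x ∈ Icc s t, ∀ y ∈ Icc s t, uIcc x y ⊆ uIcc s t := by
    intro x hx y hy
    rw [uIcc_of_le hst]
    exact uIcc_subset_Icc hx hy
  set L : ℝ → ℝ := fun x => ∫ r in s..x, (m r + 1) with hL
  have hLsub : ∀ x ∈ Icc s t, ∀ y ∈ Icc s t, x ≤ y →
      dist (f x) (f y) + (y - x) ≤ L y - L x := by
    intro x hx y hy hxy
    have e1 : L y - L x = ∫ r in x..y, (m r + 1) :=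
      intervalIntegral.integral_interval_sub_left
        (hm1.mono_set (hsub s (left_mem_Icc.2 hst) y hy))
        (hm1.mono_set (hsub s (left_mem_Icc.2 hst) x hx))
    rw [e1, intervalIntegral.integral_add (hm.mono_set (hsub x hx y hy)) (by simp)]
    simp only [intervalIntegral.integral_const, smul_eq_mul, mul_one]
    linarith [h x hx y hy hxy]
  have hcont : ContinuousOn L (Icc s t) := by
    have := intervalIntegral.continuousOn_primitive_interval' hm1 (left_mem_uIcc (a := s))
    rwa [uIcc_of_le hst] at this
  have hL0 : L s = 0 := intervalIntegral.integral_same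
  have hsmem : s ∈ Icc s t := left_mem_Icc.2 hst
  have htmem : t ∈ Icc s t := right_mem_Icc.2 hst
  have hLt : 0 ≤ L t := by
    have h1 := hLsub s hsmem t htmem hst
    have := dist_nonneg (x := f s) (y := f t)
    linarith
  have hex : ∀ q ∈ Icc (0 : ℝ) 1, ∃ r ∈ Icc s t, L r = q * L t := by
    intro q hq
    refine intermediate_value_Icc hst hcont ⟨?_, ?_⟩
    · rw [hL0]; exact mul_nonneg hq.1 hLt
    · exact mul_le_of_le_one_left hLt hq.2
  choose! τ hτ hτL using hex
  have hle : ∀ x ∈ Icc s t, ∀ y ∈ Icc s t, L x ≤ L y → x ≤ y := by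
    intro x hx y hy hxy
    by_contra! hlt
    have h1 := hLsub y hy x hx hlt.le
    have := dist_nonneg (x := f y) (y := f x)
    linarith
  have h0 : (0 : ℝ) ∈ Icc (0 : ℝ) 1 := by simp
  have h1 : (1 : ℝ) ∈ Icc (0 : ℝ) 1 := by simp
  refine ⟨τ, ?_, ?_, ?_⟩
  · refine le_antisymm (hle _ (hτ 0 h0) _ hsmem ?_) (hτ 0 h0).1
    rw [hτL 0 h0, zero_mul, hL0]
  · refine le_antisymm (hτ 1 h1).2 (hle _ htmem _ (hτ 1 h1) ?_)
    rw [hτL 1 h1, one_mul]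
  · intro q hq q' hq' hqq
    have hLL : L (τ q) ≤ L (τ q') := by
      rw [hτL q hq, hτL q' hq']; gcongr
    have h2 := hle _ (hτ q hq) _ (hτ q' hq') hLL
    have h3 := hLsub _ (hτ q hq) _ (hτ q' hq') h2
    rw [hτL q hq, hτL q' hq'] at h3
    have h4 : (∫ r in s..t, (m r + 1)) = L t := rfl
    rw [h4]
    linarith

namespace Cost

variable {X : Type*} [MetricSpace X] [CompactSpace X] [MeasurableSpace X] [BorelSpace X]
variable {S : Cost X} {V : C(X, ℝ)} {γ : ℝ → ProbabilityMeasure X}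

theorem ofReal_norm_B_sub_B_le_dS (hS : S.IsUniversal) (μ ν : ProbabilityMeasure X) :
    ENNReal.ofReal (Real.sqrt (S.ε / 2) * ‖S.B μ - S.B ν‖) ≤ S.dS μ ν := by
  have hε := S.ε_pos
  have key : ENNReal.ofReal (Real.sqrt (S.ε / 2) * ‖S.B μ - S.B ν‖) ^ (2 : ℝ) ≤
      (S.dS μ ν) ^ (2 : ℝ) := by
    rw [dS, ← ENNReal.rpow_mul, one_div, inv_mul_cancel₀ two_ne_zero, ENNReal.rpow_one]
    refine le_sInf ?_
    rintro A ⟨γ, σ, ⟨v, hv, hb⟩, rfl, rfl, hσ, rfl⟩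
    have hvi : IntervalIntegrable v volume 0 1 := by
      rw [intervalIntegrable_iff_integrableOn_Icc_of_le zero_le_one]
      exact hv.integrable one_le_two
    have hd := ae_hasDerivAt_of_eq_add_integral zero_le_one hvi hb
    have h1 : S.B (γ 0) - S.B (γ 1) = -∫ t in (0 : ℝ)..1, v t := by
      have := hb 1 (by simp)
      simp only at this
      rw [this]; abel
    rw [h1, norm_neg, ENNReal.ofReal_mul (Real.sqrt_nonneg _),
      ENNReal.mul_rpow_of_nonneg _ _ zero_le_two, ofReal_norm,
      ENNReal.ofReal_rpow_of_nonneg (Real.sqrt_nonneg _) zero_le_two, Real.rpow_two,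
      Real.sq_sqrt (by positivity)]
    calc _ ≤ ENNReal.ofReal (S.ε / 2) * ∫⁻ t in Icc (0 : ℝ) 1, ‖v t‖ₑ ^ (2 : ℝ) := by
          gcongr; exact enorm_intervalIntegral_rpow_le hv.1
      _ = ∫⁻ t in Icc (0 : ℝ) 1, ENNReal.ofReal (S.ε / 2) * ‖v t‖ₑ ^ (2 : ℝ) :=
          (lintegral_const_mul' _ _ ENNReal.ofReal_ne_top).symm
      _ ≤ _ := by
          refine lintegral_mono_ae ?_
          rw [ae_restrict_iff' measurableSet_Icc] at hσ ⊢
          filter_upwards [hσ, hd] with t h2 h3 ht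
          have h4 := (S.hasVelocity_iff hS (h3 ht) (σ t)).1 (h2 ht)
          rw [h4, ← ofReal_norm, ENNReal.ofReal_rpow_of_nonneg (norm_nonneg _) zero_le_two,
            ← ENNReal.ofReal_mul (by positivity), Real.rpow_two]
          exact ENNReal.ofReal_le_ofReal
            (S.le_metricTensor_vel _ (S.inner_B_eq_zero_of_hasDerivAt (h3 ht)))
  exact (ENNReal.rpow_le_rpow_iff zero_lt_two).1 key

/-- A Lipschitz curve of embeddings is an admissible competitor for `d_S`. -/
theorem dS_le_of_lipschitz (hS : S.IsUniversal) {L : ℝ} (hL : 0 ≤ L)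
    (h : ∀ s ∈ Icc (0 : ℝ) 1, ∀ t ∈ Icc (0 : ℝ) 1, s ≤ t →
      dist (S.B (γ s)) (S.B (γ t)) ≤ L * (t - s)) :
    S.dS (γ 0) (γ 1) ≤ ENNReal.ofReal (Real.sqrt (S.ε / S.kmin) * L) := by
  have hε := S.ε_pos
  have hk := S.kmin_pos
  obtain ⟨v, hv, hvn, hvi, hb⟩ := exists_eq_add_integral (f := fun t => S.B (γ t)) (m := fun _ => L)
    zero_le_one (by simp) (fun s hs t ht hst => by
      simpa [mul_comm] using h s hs t ht hst)
  have hd := ae_hasDerivAt_of_eq_add_integral zero_le_one hvi hb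
  have hvL : MemLp v 2 (volume.restrict (Icc (0 : ℝ) 1)) := MemLp.of_bound hv L hvn
  have key : (S.dS (γ 0) (γ 1)) ^ (2 : ℝ) ≤
      ENNReal.ofReal (Real.sqrt (S.ε / S.kmin) * L) ^ (2 : ℝ) := by
    rw [dS, ← ENNReal.rpow_mul, one_div, inv_mul_cancel₀ two_ne_zero, ENNReal.rpow_one]
    have hvel : ∀ᵐ t ∂(volume.restrict (Icc (0 : ℝ) 1)), S.HasVelocity γ t (S.vel (γ t) (v t)) := by
      rw [ae_restrict_iff' measurableSet_Icc]
      filter_upwards [hd] with t h1 ht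
      exact (S.hasVelocity_iff hS (h1 ht) _).2 rfl
    refine le_trans (b := ∫⁻ t in Icc (0 : ℝ) 1, ENNReal.ofReal (S.metricTensor (γ t)
      (S.vel (γ t) (v t)) (S.vel (γ t) (v t)))) (sInf_le ?_) ?_
    · exact ⟨γ, fun t => S.vel (γ t) (v t), ⟨v, hvL, hb⟩, rfl, rfl, hvel, rfl⟩
    · calc _ ≤ ∫⁻ t in Icc (0 : ℝ) 1, ENNReal.ofReal (S.ε / S.kmin * L ^ 2) := by
            refine lintegral_mono_ae ?_
            rw [ae_restrict_iff' measurableSet_Icc] at hvn ⊢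
            filter_upwards [hd, hvn] with t h1 h2 ht
            refine ENNReal.ofReal_le_ofReal
              ((S.metricTensor_vel_le _ (S.inner_B_eq_zero_of_hasDerivAt (h1 ht))).trans ?_)
            have := h2 ht
            gcongr
        _ = ENNReal.ofReal (S.ε / S.kmin * L ^ 2) := by simp
        _ = _ := by
            rw [ENNReal.ofReal_rpow_of_nonneg (by positivity) zero_le_two, Real.rpow_two, mul_pow,
              Real.sq_sqrt (by positivity)]
  exact (ENNReal.rpow_le_rpow_iff zero_lt_two).1 key

theorem dS_le_of_dist_le_integral (hS : S.IsUniversal) {m : ℝ → ℝ} {s t : ℝ} (hst : s ≤ t)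
    (hm0 : ∀ r, 0 ≤ m r) (hm : IntervalIntegrable m volume s t)
    (h : ∀ x ∈ Icc s t, ∀ y ∈ Icc s t, x ≤ y → dist (S.B (γ x)) (S.B (γ y)) ≤ ∫ r in x..y, m r) :
    S.dS (γ s) (γ t) ≤
      ENNReal.ofReal (∫ r in s..t, Real.sqrt (S.ε / S.kmin) * (m r + 1)) := by
  obtain ⟨τ, h0, h1, hτ⟩ := exists_lipschitz_reparametrization (f := fun x => S.B (γ x)) hst hm h
  have h2 := dS_le_of_lipschitz (γ := fun q => γ (τ q)) hS
    (intervalIntegral.integral_nonneg hst fun r _ => add_nonneg (hm0 r) zero_le_one) hτ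
  rw [h0, h1] at h2
  rwa [intervalIntegral.integral_const_mul]

/-! ### Flows as evolutions of the embeddings -/

theorem ae_alpha_iff {μ : ProbabilityMeasure X} {p : X → Prop} :
    (∀ᵐ x ∂(S.alpha μ : Measure X), p x) ↔ ∀ᵐ x ∂(μ : Measure X), p x := by
  have h : (S.alpha μ : Measure X) =
      (μ : Measure X).withDensity fun x => ENNReal.ofReal (S.expC (S.potential μ) x) := rfl
  have hm : Measurable fun x => ENNReal.ofReal (S.expC (S.potential μ) x) :=
    (S.expC (S.potential μ)).continuous.measurable.ennreal_ofReal
  rw [h, ae_withDensity_iff hm]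
  refine eventually_congr (Eventually.of_forall fun x => ?_)
  have := S.expC_pos (S.potential μ) x
  simp [this]

/-- A flow solves the evolution problem: the potential `U` is `(2 / ε) (C - V - p) B(γ_t)`, and the
pressure `p` disappears in `T U`, an integral over the support of `γ_t`. -/
theorem IsFlow.isEvolution (hS : S.IsUniversal) {μ₀ : ProbabilityMeasure X}
    {μ : ℝ≥0 → ProbabilityMeasure X} (h : S.IsFlow V μ₀ μ) : S.IsEvolution V (extend μ) := by
  have hε := S.ε_pos
  set γ := extend μ with hγ
  have hc : 0 < Real.sqrt (S.ε / 2) := Real.sqrt_pos.2 (by positivity)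
  have hac : ∀ T : ℝ, 0 ≤ T → ∃ m : ℝ → ℝ, IntervalIntegrable m volume 0 T ∧
      ∀ s ∈ Icc 0 T, ∀ t ∈ Icc 0 T, s ≤ t →
        dist (S.B (γ s)) (S.B (γ t)) ≤ ∫ r in s..t, m r := by
    intro T hT
    obtain ⟨m, hm, h1⟩ := h.ac T hT
    have hmi : IntervalIntegrable m volume 0 T := by
      rw [intervalIntegrable_iff_integrableOn_Icc_of_le hT]
      exact hm.integrable one_le_two
    refine ⟨fun r => (Real.sqrt (S.ε / 2))⁻¹ * |m r|, hmi.abs.const_mul _, ?_⟩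
    intro s hs t ht hst
    have h2 := (ofReal_norm_B_sub_B_le_dS hS _ _).trans (h1 s hs t ht hst)
    have h3 : IntervalIntegrable m volume s t := hmi.mono_set (by
      rw [uIcc_of_le hT]; exact uIcc_subset_Icc hs ht)
    have h4 : ∫ r in s..t, m r ≤ ∫ r in s..t, |m r| :=
      intervalIntegral.integral_mono_on hst h3 h3.abs fun r _ => le_abs_self _
    have h5 : 0 ≤ ∫ r in s..t, |m r| := intervalIntegral.integral_nonneg hst fun r _ => abs_nonneg _
    have h6 := h2.trans (ENNReal.ofReal_le_ofReal h4)
    rw [ENNReal.ofReal_le_ofReal_iff h5] at h6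
    rw [intervalIntegral.integral_const_mul, inv_mul_eq_div, le_div_iff₀ hc, dist_eq_norm, mul_comm]
    exact h6
  refine ⟨?_, ?_, ?_⟩
  · intro t ht
    have hT : 0 ≤ t + 1 := by linarith [mem_Ici.1 ht]
    obtain ⟨m, hm, h1⟩ := hac (t + 1) hT
    have h2 := (absolutelyContinuousOnInterval_of_dist_le_integral hT hm h1).continuousOn
    rw [uIcc_of_le hT] at h2
    refine (h2 t ⟨ht, by simp⟩).mono_of_mem_nhdsWithin ?_
    rw [← Ici_inter_Iic]
    exact inter_mem_nhdsWithin _ (Iic_mem_nhds (by simp))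
  · intro a b ha hab
    obtain ⟨m, hm, h1⟩ := hac b (ha.le.trans hab)
    refine ⟨m, hm.mono_set ?_, fun s hs t ht hst => ?_⟩
    · rw [uIcc_of_le hab, uIcc_of_le (ha.le.trans hab)]; exact Icc_subset_Icc_left ha.le
    · exact h1 s ⟨ha.le.trans hs.1, hs.2⟩ t ⟨ha.le.trans ht.1, ht.2⟩ hst
  · have hd : ∀ᵐ t : ℝ, ∀ n : ℕ, t ∈ Icc (0 : ℝ) n →
        ∃ w, HasDerivAt (fun s => S.B (γ s)) w t := by
      refine ae_all_iff.2 fun n => ?_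
      obtain ⟨m, hm, h1⟩ := hac n (Nat.cast_nonneg n)
      obtain ⟨v, -, -, hvi, hb⟩ := exists_eq_add_integral (Nat.cast_nonneg n) hm h1
      filter_upwards [ae_hasDerivAt_of_eq_add_integral (Nat.cast_nonneg n) hvi hb] with t h2 ht
      exact ⟨_, h2 ht⟩
    filter_upwards [hd, h.eq] with t h1 h2 ht
    obtain ⟨n, hn⟩ := exists_nat_ge t
    obtain ⟨w, hw⟩ := h1 n ⟨ht.le, hn⟩
    obtain ⟨σ, hσ, u, hu, p, hp, C, hC⟩ := h2 ht
    refine ⟨w, hw, ?_⟩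
    have hwB := S.inner_B_eq_zero_of_hasDerivAt hw
    rw [(S.hasVelocity_iff hS hw σ).1 hσ, riesz_vel] at hu
    obtain ⟨U, hU, hUw⟩ := S.exists_Theta_eq_of_isInvIdSubKSq (γ t) hwB hu
    have hux : ∀ x, u x = S.expC (S.potential (γ t)) x * U x := fun x => by
      rw [hU, Theta_apply]
    have hp0 : ∀ᵐ x ∂(S.alpha (γ t) : Measure X), p x = 0 := by
      rw [ae_alpha_iff]
      filter_upwards [Measure.support_mem_ae (μ := (γ t : Measure X))] with x hx
      exact hp.2 x hx
    have hT : S.T (γ t) U = (2 / S.ε) • (C • S.B (γ t) - S.dens (S.alpha (γ t)) V) := by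
      have : S.T (γ t) U = S.dens (S.alpha (γ t)) ((2 / S.ε) • (C • 1 - V)) := by
        rw [T_apply]
        refine dens_congr_ae ?_
        filter_upwards [hp0] with x hx
        have h3 := hC x
        rw [hx, hux] at h3
        simp only [ContinuousMap.mul_apply, toC_apply, ContinuousMap.smul_apply, smul_eq_mul,
          ContinuousMap.sub_apply, ContinuousMap.one_apply]
        field_simp
        linarith
      rw [this, dens_smul, dens_sub, dens_smul, ← emb_alpha]; rfl
    have key : ∀ x, w x + 2 / S.ε * (V x * S.emb (S.alpha (γ t)) x - S.dens (S.alpha (γ t)) V x) =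
        -(2 / S.ε * (p x * S.B (γ t) x)) := by
      intro x
      rw [← hUw, hT, emb_alpha]
      simp only [RKHS.coe_sub, Pi.sub_apply, RKHS.coe_smul, Pi.smul_apply, smul_eq_mul]
      have h3 := hC x
      rw [hux] at h3
      have e := S.expC_potential_mul_B (γ t) x
      field_simp
      linear_combination 2 * S.B (γ t) x * h3 - S.ε * U x * e
    refine ⟨fun x => ?_, by rw [emb_alpha, real_inner_comm]; exact hwB⟩
    rw [key]
    have h3 := hp.1 x
    have h4 := S.B_pos (γ t) x
    have : 0 ≤ 2 / S.ε * (-p x * S.B (γ t) x) :=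
      mul_nonneg (by positivity) (mul_nonneg (neg_nonneg.2 h3) h4.le)
    linarith

/-- An evolution is a flow, with the pressure `-(V + (ε / 2) Theta U)`. -/
theorem IsEvolution.isFlow (hS : S.IsUniversal) {μ : ℝ≥0 → ProbabilityMeasure X}
    (h : S.IsEvolution V (extend μ)) : S.IsFlow V (μ 0) μ := by
  have hε := S.ε_pos
  refine ⟨fun T hT => ?_, rfl, ?_⟩
  · obtain ⟨m, hm0, hm, h1⟩ := h.exists_memLp hS
    have hmT : MemLp m 2 (volume.restrict (Icc 0 T)) :=
      hm.mono_measure (Measure.restrict_mono (fun x hx => hx.1) le_rfl)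
    refine ⟨fun r => Real.sqrt (S.ε / S.kmin) * (m r + 1),
      (hmT.add (memLp_const 1)).const_mul _, ?_⟩
    intro s hs t ht hst
    refine dS_le_of_dist_le_integral hS hst hm0 ?_ fun x hx y hy hxy => ?_
    · rw [intervalIntegrable_iff_integrableOn_Icc_of_le hst]
      exact (hmT.integrable one_le_two).mono_measure
        (Measure.restrict_mono (Icc_subset_Icc hs.1 ht.2) le_rfl)
    · rw [dist_comm, dist_eq_norm]
      exact h1 x y (hs.1.trans hx.1) hxy
  · filter_upwards [h.dir] with t ht ht0
    obtain ⟨w, hw, hwd⟩ := ht ht0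
    set U := w - (2 / S.ε) • S.dens (S.alpha (extend μ t)) V with hU
    set u : C(X, ℝ) := S.expC (S.potential (extend μ t)) * S.toC U with hu
    have hux : (u : X → ℝ) = S.Theta (extend μ t) U := by
      ext x; rw [Theta_apply]; rfl
    have hwB := S.inner_B_eq_zero_of_hasDerivAt hw
    refine ⟨S.vel _ w, (S.hasVelocity_iff hS hw _).2 rfl, u, ?_, -(V + (S.ε / 2) • u), ⟨?_, ?_⟩, 0, ?_⟩
    · rw [hux, riesz_vel, isInvIdSubKSq_Theta_iff' _ _ hwB]
      exact hwd.sub_T_eq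
    · intro x
      have := hwd.pointwise_nonneg x
      rw [← hU, ← hux] at this
      simp
      linarith
    · have h1 : {x | (-(V + (S.ε / 2) • u)) x = 0} ∈ ae (extend μ t : Measure X) := by
        have := ae_alpha_iff.1 hwd.ae_pointwise_eq_zero
        rw [← hU, ← hux] at this
        filter_upwards [this] with x hx
        simp
        linarith
      have h2 : IsClosed {x | (-(V + (S.ε / 2) • u)) x = 0} :=
        isClosed_eq (ContinuousMap.continuous _) continuous_const
      exact fun x hx => Measure.support_subset_of_isClosed h2 h1 hx
    · intro x
      simp
      ring

end Cost

/-! ### Linear complementarity problems -/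

/-- The linear complementarity problem of a coercive operator on `ℝⁿ` is solvable: a solution is a
fixed point of the contraction `y ↦ (y - ρ (A y - q))⁺` for a small step `ρ`. -/
theorem exists_linear_complementarity {n : ℕ}
    (A : EuclideanSpace ℝ (Fin n) →L[ℝ] EuclideanSpace ℝ (Fin n)) {η : ℝ} (hη : 0 < η)
    (hA : ∀ y, η * ‖y‖ ^ 2 ≤ inner ℝ (A y) y) (q : EuclideanSpace ℝ (Fin n)) :
    ∃ y : EuclideanSpace ℝ (Fin n), (∀ i, 0 ≤ y i) ∧ (∀ i, q i ≤ A y i) ∧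
      ∀ i, (A y i - q i) * y i = 0 := by
  set ρ := η / (‖A‖ ^ 2 + η ^ 2) with hρ
  have hden : 0 < ‖A‖ ^ 2 + η ^ 2 := by positivity
  have hρ0 : 0 < ρ := by positivity
  set c := 1 - ρ * η with hc
  have hρη : ρ * η ≤ 1 := by
    rw [hρ, div_mul_eq_mul_div, div_le_one hden]; nlinarith [sq_nonneg ‖A‖]
  have hc0 : 0 ≤ c := by linarith
  have hc1 : c < 1 := by have := mul_pos hρ0 hη; linarith
  have hstep : ∀ y, ‖y - ρ • A y‖ ^ 2 ≤ c * ‖y‖ ^ 2 := by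
    intro y
    rw [norm_sub_sq_real, inner_smul_right, real_inner_comm, norm_smul, Real.norm_eq_abs, mul_pow,
      sq_abs]
    have h1 := hA y
    have h2 : ‖A y‖ ^ 2 ≤ ‖A‖ ^ 2 * ‖y‖ ^ 2 := by
      rw [← mul_pow]; gcongr; exact A.le_opNorm y
    have h3 : ρ * ‖A‖ ^ 2 ≤ η := by
      rw [hρ, div_mul_eq_mul_div, div_le_iff₀ hden]; nlinarith [sq_nonneg η, mul_pos hη (sq_pos_of_pos hη)]
    have h4 : ρ ^ 2 * ‖A y‖ ^ 2 ≤ ρ * (η * ‖y‖ ^ 2) := by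
      calc ρ ^ 2 * ‖A y‖ ^ 2 ≤ ρ ^ 2 * (‖A‖ ^ 2 * ‖y‖ ^ 2) := by gcongr
        _ = ρ * ((ρ * ‖A‖ ^ 2) * ‖y‖ ^ 2) := by ring
        _ ≤ _ := by gcongr
    have h5 := mul_le_mul_of_nonneg_left h1 hρ0.le
    rw [hc]
    nlinarith
  set Φ : EuclideanSpace ℝ (Fin n) → EuclideanSpace ℝ (Fin n) := fun y =>
    WithLp.toLp 2 fun i => max (y i - ρ * (A y i - q i)) 0 with hΦ
  have hΦd : ∀ y z, ‖Φ y - Φ z‖ ≤ ‖(y - z) - ρ • A (y - z)‖ := by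
    intro y z
    rw [EuclideanSpace.norm_eq, EuclideanSpace.norm_eq]
    refine Real.sqrt_le_sqrt (Finset.sum_le_sum fun i _ => ?_)
    refine pow_le_pow_left₀ (norm_nonneg _) ?_ 2
    have e : ((y - z) - ρ • A (y - z)) i =
        (y i - ρ * (A y i - q i)) - (z i - ρ * (A z i - q i)) := by
      simp only [map_sub, PiLp.sub_apply, PiLp.smul_apply, smul_eq_mul]; ring
    rw [e]
    exact abs_max_sub_max_le_abs _ _ _
  have hcontr : ContractingWith (Real.sqrt c).toNNReal Φ := by
    refine ⟨?_, LipschitzWith.of_dist_le_mul fun y z => ?_⟩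
    · rw [← NNReal.coe_lt_coe, Real.coe_toNNReal _ (Real.sqrt_nonneg _), NNReal.coe_one,
        Real.sqrt_lt' one_pos]
      simpa using hc1
    · rw [dist_eq_norm, dist_eq_norm, Real.coe_toNNReal _ (Real.sqrt_nonneg _)]
      refine (hΦd y z).trans ?_
      refine le_of_sq_le_sq ((hstep _).trans_eq ?_) (by positivity)
      rw [mul_pow, Real.sq_sqrt hc0]
  obtain ⟨y, hy⟩ : ∃ y, Φ y = y := ⟨_, hcontr.fixedPoint_isFixedPt⟩
  have hyi : ∀ i, max (y i - ρ * (A y i - q i)) 0 = y i := fun i => by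
    conv_rhs => rw [← hy]
  refine ⟨y, fun i => ?_, fun i => ?_, fun i => ?_⟩
  · rw [← hyi]; exact le_max_right _ _
  · have h1 := (le_max_left _ _).trans_eq (hyi i)
    have h2 : 0 ≤ ρ * (A y i - q i) := by linarith
    linarith [nonneg_of_mul_nonneg_right h2 hρ0]
  · rcases max_choice (y i - ρ * (A y i - q i)) 0 with h | h
    · have h1 := hyi i
      rw [h] at h1
      have h2 : ρ * (A y i - q i) = 0 := by linarith
      rw [(mul_eq_zero.1 h2).resolve_left hρ0.ne', zero_mul]
    · rw [← hyi i, h, mul_zero]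

/-- The measure `∑ᵢ yᵢ δ_{xᵢ}`, where negative weights are replaced by `0`. -/
def sumDirac {X : Type*} [MeasurableSpace X] {n : ℕ} (x : Fin n → X) (y : Fin n → ℝ) :
    FiniteMeasure X :=
  ∑ i, (y i).toNNReal • (diracProba (x i)).toFiniteMeasure

theorem integral_sumDirac {X : Type*} [MetricSpace X] [MeasurableSpace X] [BorelSpace X] {n : ℕ}
    (x : Fin n → X) {y : Fin n → ℝ} (hy : ∀ i, 0 ≤ y i) (ψ : X → ℝ) :
    ∫ z, ψ z ∂(sumDirac x y : Measure X) = ∑ i, y i * ψ (x i) := by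
  have h : (sumDirac x y : Measure X) = ∑ i, (y i).toNNReal • Measure.dirac (x i) := by
    rw [sumDirac]
    have := map_sum (FiniteMeasure.toMeasureAddMonoidHom (Ω := X))
      (fun i => (y i).toNNReal • (diracProba (x i)).toFiniteMeasure) Finset.univ
    exact this
  rw [h, integral_finsetSum_measure]
  · refine Finset.sum_congr rfl fun i _ => ?_
    rw [integral_smul_nnreal_measure, integral_dirac, NNReal.smul_def, Real.coe_toNNReal _ (hy i),
      smul_eq_mul]
  · intro i _
    exact (integrable_dirac (by simp)).smul_measure_nnreal

namespace Cost

variable {X : Type*} [MetricSpace X] [CompactSpace X] [MeasurableSpace X] [BorelSpace X]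
variable {S : Cost X} {V : C(X, ℝ)}

/-! ### The resolvent of the monotone operator -/

variable (S) in
theorem continuous_eval (x : X) : Continuous fun φ : S.Hc => φ x :=
  (continuous_const.inner continuous_id).congr fun φ => S.inner_sec x φ

/-- The resolvent equation tested at finitely many points, for measures carried by these points and
with a small multiple `η` of the identity added. -/
theorem exists_resolvent_fin {n : ℕ} (x : Fin n → X) (θ : ℝ) {η : ℝ} (hη : 0 < η) (h : S.Hc) :
    ∃ α : FiniteMeasure X,
      (∀ i, h (x i) ≤ S.emb α (x i) + θ * (V (x i) * S.emb α (x i) - S.dens α V (x i)) +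
        η * α.mass) ∧
      inner ℝ (S.emb α - h) (S.emb α) ≤ 0 ∧
      -(η * (α.mass : ℝ) ^ 2) ≤ inner ℝ (S.emb α - h) (S.emb α) := by
  set N : Matrix (Fin n) (Fin n) ℝ := Matrix.of fun i j =>
    S.kc (x j) (x i) * (1 + θ * (V (x i) - V (x j))) with hN
  set A : EuclideanSpace ℝ (Fin n) →L[ℝ] EuclideanSpace ℝ (Fin n) :=
    (Matrix.toEuclideanLin N).toContinuousLinearMap + η • ContinuousLinearMap.id ℝ _ with hA
  have hAi : ∀ y i, A y i = ∑ j, N i j * y j + η * y i := fun y i => rfl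
  have hcoer : ∀ y, η * ‖y‖ ^ 2 ≤ inner ℝ (A y) y := by
    intro y
    have e1 : inner ℝ (A y) y = ∑ i, ∑ j, N i j * (y i * y j) + η * ‖y‖ ^ 2 := by
      rw [EuclideanSpace.norm_sq_eq, PiLp.inner_apply, Finset.mul_sum, ← Finset.sum_add_distrib]
      refine Finset.sum_congr rfl fun i _ => ?_
      rw [hAi, real_inner_comm, RCLike.inner_apply, conj_trivial, add_mul, Finset.sum_mul,
        Real.norm_eq_abs, sq_abs]
      congr 1
      · exact Finset.sum_congr rfl fun j _ => by ring
      · ring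
    -- the antisymmetric part of `N` does not contribute
    have e2 : ∑ i, ∑ j, N i j * (y i * y j) = ∑ i, ∑ j, S.kc (x i) (x j) * (y i * y j) := by
      have e3 : ∑ i, ∑ j, S.kc (x i) (x j) * (V (x i) - V (x j)) * (y i * y j) = 0 := by
        have e4 : ∑ i, ∑ j, S.kc (x i) (x j) * (V (x i) - V (x j)) * (y i * y j) =
            -∑ i, ∑ j, S.kc (x i) (x j) * (V (x i) - V (x j)) * (y i * y j) := by
          conv_lhs => rw [Finset.sum_comm]
          rw [← Finset.sum_neg_distrib]
          refine Finset.sum_congr rfl fun i _ => ?_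
          rw [← Finset.sum_neg_distrib]
          refine Finset.sum_congr rfl fun j _ => ?_
          rw [S.kc_symm (x j) (x i)]; ring
        linarith
      have e5 : ∀ i j, N i j * (y i * y j) = S.kc (x i) (x j) * (y i * y j) +
          θ * (S.kc (x i) (x j) * (V (x i) - V (x j)) * (y i * y j)) := by
        intro i j
        simp only [hN, Matrix.of_apply]
        rw [S.kc_symm (x j) (x i)]; ring
      simp only [e5, Finset.sum_add_distrib, ← Finset.mul_sum, e3, mul_zero, add_zero]
    have e6 : ∑ i, ∑ j, S.kc (x i) (x j) * (y i * y j) = ‖∑ i, y i • S.sec (x i)‖ ^ 2 := by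
      rw [← real_inner_self_eq_norm_sq, sum_inner]
      refine Finset.sum_congr rfl fun i _ => ?_
      rw [inner_sum]
      refine Finset.sum_congr rfl fun j _ => ?_
      rw [inner_smul_left, inner_smul_right, inner_sec_sec, conj_trivial]; ring
    rw [e1, e2, e6]
    have := sq_nonneg ‖∑ i, y i • S.sec (x i)‖
    linarith
  obtain ⟨y, hy0, hy1, hy2⟩ :=
    exists_linear_complementarity A hη hcoer (WithLp.toLp 2 fun i => h (x i))
  set α := sumDirac x y with hα
  have hint : ∀ ψ : X → ℝ, ∫ z, ψ z ∂(α : Measure X) = ∑ i, y i * ψ (x i) :=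
    integral_sumDirac x hy0
  have hmass : (α.mass : ℝ) = ∑ i, y i := by
    rw [← integral_const_one, hint]; simp
  have hle : ∀ i, y i ≤ α.mass := fun i => by
    rw [hmass]; exact Finset.single_le_sum (fun j _ => hy0 j) (Finset.mem_univ i)
  have hNi : ∀ i, ∑ j, N i j * y j =
      S.emb α (x i) + θ * (V (x i) * S.emb α (x i) - S.dens α V (x i)) := by
    intro i
    rw [emb_apply, dens_apply, hint, hint, Finset.mul_sum, ← Finset.sum_sub_distrib,
      Finset.mul_sum, ← Finset.sum_add_distrib]
    refine Finset.sum_congr rfl fun j _ => ?_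
    simp only [hN, Matrix.of_apply]
    ring
  have hself : inner ℝ (S.emb α - h) (S.emb α) = -(η * ∑ i, y i ^ 2) := by
    have e1 : ∑ i, (A y i - h (x i)) * y i = 0 := Finset.sum_eq_zero fun i _ => hy2 i
    have e2 : inner ℝ (S.emb α - h) (S.emb α) = ∑ i, y i * (S.emb α (x i) - h (x i)) := by
      rw [real_inner_comm, inner_emb, hint]; simp
    have e3 : ∑ i, y i * (V (x i) * S.emb α (x i)) = ∑ i, y i * S.dens α V (x i) := by
      have f1 := S.inner_dens α V (S.emb α)
      rw [real_inner_comm, inner_emb, hint, hint] at f1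
      exact f1.symm
    have e4 : ∑ i, (A y i - h (x i)) * y i = ∑ i, y i * (S.emb α (x i) - h (x i)) +
        θ * (∑ i, y i * (V (x i) * S.emb α (x i)) - ∑ i, y i * S.dens α V (x i)) +
        η * ∑ i, y i ^ 2 := by
      rw [← Finset.sum_sub_distrib, Finset.mul_sum, Finset.mul_sum, ← Finset.sum_add_distrib,
        ← Finset.sum_add_distrib]
      refine Finset.sum_congr rfl fun i _ => ?_
      rw [hAi, hNi]; ring
    rw [e3, sub_self, mul_zero, add_zero, e1] at e4
    rw [e2]; linarith
  have hsq : ∑ i, y i ^ 2 ≤ (α.mass : ℝ) ^ 2 := by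
    calc ∑ i, y i ^ 2 ≤ ∑ i, y i * α.mass := Finset.sum_le_sum fun i _ => by
          rw [sq]; exact mul_le_mul_of_nonneg_left (hle i) (hy0 i)
      _ = (α.mass : ℝ) ^ 2 := by rw [← Finset.sum_mul, ← hmass, sq]
  refine ⟨α, fun i => ?_, ?_, ?_⟩
  · have h1 := hy1 i
    rw [hAi, hNi] at h1
    refine h1.trans ?_
    have := hle i
    gcongr
  · rw [hself]
    have : 0 ≤ ∑ i, y i ^ 2 := Finset.sum_nonneg fun i _ => sq_nonneg _
    have := mul_nonneg hη.le this
    linarith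
  · rw [hself]; gcongr

theorem norm_emb_le_of_inner_nonpos {α : FiniteMeasure X} {h : S.Hc}
    (hα : inner ℝ (S.emb α - h) (S.emb α) ≤ 0) : ‖S.emb α‖ ≤ ‖h‖ := by
  rw [inner_sub_left, real_inner_self_eq_norm_sq] at hα
  have := real_inner_le_norm h (S.emb α)
  by_contra! hlt
  nlinarith [norm_nonneg h]

variable (V) in
/-- The resolvent of the monotone operator at `h`: the limit of the problems on the first `n` points
of a dense sequence, with `η = 1 / (n + 1)`. -/
theorem exists_resolvent [Nonempty X] (θ : ℝ) (h : S.Hc) : ∃ α : FiniteMeasure X,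
    (∀ x, h x ≤ S.emb α x + θ * (V x * S.emb α x - S.dens α V x)) ∧
    inner ℝ (S.emb α - h) (S.emb α) = 0 := by
  choose α hα1 hα2 hα3 using fun n : ℕ => exists_resolvent_fin (S := S) (V := V) (n := n)
    (fun i => TopologicalSpace.denseSeq X i) θ (η := 1 / ((n : ℝ) + 1)) (by positivity) h
  have hm : ∀ n, ((α n).mass : ℝ) ≤ ‖h‖ / Real.sqrt S.kmin := fun n =>
    S.mass_le _ (norm_emb_le_of_inner_nonpos (hα2 n))
  have hl : (hyperfilter ℕ : Filter ℕ) ≤ atTop := Nat.hyperfilter_le_atTop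
  obtain ⟨β, hβ⟩ := exists_tendsto_ultrafilter (hyperfilter ℕ) α _ hm
  have hemb : Tendsto (fun n => S.emb (α n)) (hyperfilter ℕ) (𝓝 (S.emb β)) :=
    (S.continuous_emb.tendsto β).comp hβ
  have hdens : Tendsto (fun n => S.dens (α n) V) (hyperfilter ℕ) (𝓝 (S.dens β V)) :=
    ((S.continuous_dens.comp (continuous_id.prodMk continuous_const)).tendsto β).comp hβ
  have hη : Tendsto (fun n : ℕ => 1 / ((n : ℝ) + 1)) (hyperfilter ℕ) (𝓝 0) :=
    tendsto_one_div_add_atTop_nhds_zero_nat.mono_left hl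
  have hmass : Tendsto (fun n => ((α n).mass : ℝ)) (hyperfilter ℕ) (𝓝 β.mass) :=
    (NNReal.continuous_coe.tendsto _).comp ((FiniteMeasure.continuous_mass.tendsto β).comp hβ)
  refine ⟨β, fun x => ?_, le_antisymm ?_ ?_⟩
  · refine (TopologicalSpace.denseRange_denseSeq X).induction_on x ?_ fun i => ?_
    · have c1 := S.continuous_coe h
      have c2 := S.continuous_coe (S.emb β)
      have c3 := S.continuous_coe (S.dens β V)
      exact isClosed_le c1 (by fun_prop)
    · set z := TopologicalSpace.denseSeq X i
      have t1 := ((S.continuous_eval z).tendsto _).comp hemb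
      have t2 := ((S.continuous_eval z).tendsto _).comp hdens
      have t3 := (t1.add (((t1.const_mul (V z)).sub t2).const_mul θ)).add (hη.mul hmass)
      rw [zero_mul, add_zero] at t3
      refine ge_of_tendsto t3 ?_
      have h1 : ∀ᶠ n : ℕ in hyperfilter ℕ, i < n := hl (eventually_gt_atTop i)
      filter_upwards [h1] with n hn
      exact hα1 n ⟨i, hn⟩
  · exact le_of_tendsto ((hemb.sub_const h).inner hemb) (Eventually.of_forall hα2)
  · have t1 := (hη.mul (hmass.pow 2)).neg
    rw [zero_mul, neg_zero] at t1
    exact le_of_tendsto_of_tendsto' t1 ((hemb.sub_const h).inner hemb) hα3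

variable (V) in
/-- Implicit Euler step. -/
theorem exists_isFlowDirection_step [Nonempty X] {τ : ℝ} (hτ : 0 < τ) (h : S.Hc) :
    ∃ α : FiniteMeasure X, S.IsFlowDirection V α (τ⁻¹ • (S.emb α - h)) := by
  obtain ⟨α, h1, h2⟩ := exists_resolvent V (2 / S.ε * τ) h
  refine ⟨α, fun x => ?_, by rw [inner_smul_left, h2, mul_zero]⟩
  have h3 := h1 x
  simp only [RKHS.coe_smul, Pi.smul_apply, RKHS.coe_sub, Pi.sub_apply, smul_eq_mul]
  have e : τ⁻¹ * (S.emb α x - h x) + 2 / S.ε * (V x * S.emb α x - S.dens α V x) =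
      τ⁻¹ * (S.emb α x + 2 / S.ε * τ * (V x * S.emb α x - S.dens α V x) - h x) := by
    field_simp
    ring
  rw [e]
  exact mul_nonneg (inv_nonneg.2 hτ.le) (sub_nonneg.2 h3)

theorem dens_nnreal_smul (c : ℝ≥0) (α : FiniteMeasure X) (ρ : C(X, ℝ)) :
    S.dens (c • α) ρ = (c : ℝ) • S.dens α ρ := by
  have h : ((c • α : FiniteMeasure X) : Measure X) = c • (α : Measure X) := rfl
  rw [dens, h, integral_smul_nnreal_measure]; rfl

theorem IsFlowDirection.smul {α : FiniteMeasure X} {w : S.Hc} (h : S.IsFlowDirection V α w)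
    (c : ℝ≥0) : S.IsFlowDirection V (c • α) ((c : ℝ) • w) := by
  refine ⟨fun x => ?_, ?_⟩
  · have := mul_nonneg c.2 (h.nonneg x)
    simp only [emb, dens_nnreal_smul, RKHS.coe_smul, Pi.smul_apply, smul_eq_mul] at this ⊢
    refine this.trans_eq ?_
    change (c : ℝ) * _ = _
    ring
  · rw [emb, dens_nnreal_smul, inner_smul_left, inner_smul_right]
    have := h.inner_eq_zero
    rw [emb] at this
    rw [this, mul_zero, mul_zero]

/-- The points of the unit sphere at which the monotone operator is defined are dense in the image
of `B`. -/
theorem exists_isFlowDirection_norm_sub_lt (μ : ProbabilityMeasure X) {δ : ℝ} (hδ : 0 < δ) :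
    ∃ (ν : ProbabilityMeasure X) (w : S.Hc), S.IsFlowDirection V (S.alpha ν) w ∧
      ‖S.B ν - S.B μ‖ < δ := by
  have : Nonempty X := μ.nonempty
  have hε := S.ε_pos
  have hk := S.kmin_pos
  set b := S.B μ with hb
  have hb1 : ‖b‖ = 1 := S.norm_B μ
  set C := 2 / S.ε * (2 * (1 / Real.sqrt S.kmin * ‖V‖)) with hC
  have hC0 : 0 ≤ C := by positivity
  set δ' := min δ 1 / 3 with hδ'
  have hδ'0 : 0 < δ' := by have := lt_min hδ one_pos; positivity
  have hδ'1 : δ' < 1 := by have := min_le_right δ 1; rw [hδ']; linarith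
  have hδ'2 : 2 * δ' < δ := by have := min_le_left δ 1; rw [hδ']; linarith
  set τ := δ' ^ 2 / (C + 1) with hτ
  have hτ0 : 0 < τ := by positivity
  obtain ⟨α, hα⟩ := exists_isFlowDirection_step (S := S) V hτ0 b
  set a := S.emb α with ha
  have h0 : inner ℝ (a - b) a = 0 := by
    have := hα.inner_eq_zero
    rw [inner_smul_left] at this
    exact (mul_eq_zero.1 this).resolve_left (by simpa using hτ0.ne')
  have hna : ‖a‖ ≤ 1 := (norm_emb_le_of_inner_nonpos h0.le).trans_eq hb1
  have hpair : ∀ (β : FiniteMeasure X) (φ : S.Hc), ‖S.emb β‖ ≤ 1 → ‖φ‖ ≤ 1 →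
      |inner ℝ (S.dens β V) φ| ≤ 1 / Real.sqrt S.kmin * ‖V‖ := by
    intro β φ hβ hφ
    rw [inner_dens']
    refine (abs_integral_le _ _).trans ?_
    have h1 := S.mass_le β hβ
    have h2 : ‖V * S.toC φ‖ ≤ ‖V‖ * 1 := (norm_mul_le _ _).trans
      (by have := (S.norm_toC_le φ).trans hφ; gcongr)
    rw [mul_one] at h2
    gcongr
  -- distance from the resolvent to the initial point
  have hdist : ‖a - b‖ ≤ δ' := by
    have h1 := hα.inner_nonneg (S.alpha μ)
    rw [emb_alpha, ← hb, ← ha, inner_smul_left, conj_trivial] at h1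
    have h2 : inner ℝ (a - b) b = -‖a - b‖ ^ 2 := by
      rw [← real_inner_self_eq_norm_sq, inner_sub_right (a - b) a b, h0]; ring
    have h3 := (abs_le.1 (hpair (S.alpha μ) a (S.norm_emb_alpha μ).le hna)).2
    have h4 := (abs_le.1 (hpair α b hna hb1.le)).1
    have h5 : 2 / S.ε * (inner ℝ (S.dens (S.alpha μ) V) a - inner ℝ (S.dens α V) b) ≤ C := by
      rw [hC]; gcongr; linarith
    have h6 : τ⁻¹ * ‖a - b‖ ^ 2 ≤ C := by rw [h2] at h1; linarith
    have h7 : ‖a - b‖ ^ 2 ≤ δ' ^ 2 := by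
      rw [inv_mul_le_iff₀ hτ0, hτ, div_mul_eq_mul_div, le_div_iff₀ (by positivity)] at h6
      nlinarith [sq_nonneg ‖a - b‖, sq_nonneg δ']
    exact le_of_sq_le_sq h7 hδ'0.le
  have hna' : 1 - δ' ≤ ‖a‖ := by
    have := norm_sub_norm_le b a
    rw [norm_sub_rev] at this
    linarith
  have hna0 : 0 < ‖a‖ := by linarith
  set c : ℝ≥0 := ⟨‖a‖⁻¹, by positivity⟩ with hc
  have hemb : S.emb (c • α) = ‖a‖⁻¹ • a := dens_nnreal_smul c α 1
  obtain ⟨ν, hν⟩ := S.exists_alpha_eq (α := c • α) (by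
    rw [hemb, norm_smul, norm_inv, norm_norm, inv_mul_cancel₀ hna0.ne'])
  refine ⟨ν, _, by rw [hν]; exact hα.smul c, ?_⟩
  have h1 : ‖S.B ν - a‖ ≤ δ' := by
    rw [← emb_alpha, hν, hemb]
    have e : ‖a‖⁻¹ • a - a = (‖a‖⁻¹ - 1) • a := by rw [sub_smul, one_smul]
    rw [e, norm_smul, Real.norm_eq_abs, abs_of_nonneg (sub_nonneg.2 ((one_le_inv₀ hna0).2 hna)),
      sub_mul, inv_mul_cancel₀ hna0.ne']
    linarith
  calc ‖S.B ν - b‖ ≤ ‖S.B ν - a‖ + ‖a - b‖ := norm_sub_le_norm_sub_add_norm_sub _ _ _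
    _ ≤ δ' + δ' := by gcongr
    _ < δ := by linarith

end Cost
namespace Cost

variable {X : Type*} [MetricSpace X] [CompactSpace X] [MeasurableSpace X] [BorelSpace X]
variable {S : Cost X} {V : C(X, ℝ)}

/-! ### Existence of evolutions -/

variable (S V) in
/-- The value at `x` of the antisymmetric operator `A` at the point `emb α`. -/
def drift (x : X) (α : FiniteMeasure X) : ℝ := V x * S.emb α x - S.dens α V x

theorem continuous_drift (x : X) : Continuous (S.drift V x) := by
  have h1 := (S.continuous_eval x).comp S.continuous_emb
  have h2 := (S.continuous_eval x).comp
    (S.continuous_dens.comp (continuous_id.prodMk (continuous_const (y := V))))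
  exact (h1.const_mul (V x)).sub h2

/-- A continuous function of a measure is uniformly continuous in its embedding. -/
theorem exists_modulus (hS : S.IsUniversal) {Φ : FiniteMeasure X → ℝ} (hΦ : Continuous Φ) {δ : ℝ}
    (hδ : 0 < δ) : ∃ r > 0, ∀ α β : FiniteMeasure X, ‖S.emb α‖ ≤ 1 → ‖S.emb β‖ ≤ 1 →
      ‖S.emb α - S.emb β‖ < r → |Φ α - Φ β| ≤ δ := by
  by_contra! hcon
  choose α β hα hβ hαβ hΦαβ using fun n : ℕ => hcon (1 / ((n : ℝ) + 1)) (by positivity)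
  obtain ⟨a, ha⟩ := exists_tendsto_ultrafilter (hyperfilter ℕ) α _ fun n => S.mass_le _ (hα n)
  obtain ⟨b, hb⟩ := exists_tendsto_ultrafilter (hyperfilter ℕ) β _ fun n => S.mass_le _ (hβ n)
  have h1 := (((S.continuous_emb.tendsto a).comp ha).sub ((S.continuous_emb.tendsto b).comp hb)).norm
  have h2 : Tendsto (fun n : ℕ => 1 / ((n : ℝ) + 1)) (hyperfilter ℕ) (𝓝 0) :=
    tendsto_one_div_add_atTop_nhds_zero_nat.mono_left Nat.hyperfilter_le_atTop
  have h3 : ‖S.emb a - S.emb b‖ ≤ 0 := le_of_tendsto_of_tendsto' h1 h2 fun n => (hαβ n).le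
  have h4 : a = b := S.emb_injective hS (by rwa [norm_le_zero_iff, sub_eq_zero] at h3)
  have h5 := (((hΦ.tendsto a).comp ha).sub ((hΦ.tendsto b).comp hb)).abs
  rw [h4, sub_self, abs_zero] at h5
  have h6 : δ ≤ 0 := ge_of_tendsto h5 (Eventually.of_forall fun n => (hΦαβ n).le)
  linarith

/-- A locally Lipschitz curve whose increments satisfy an approximate form of the inequality that
defines flow directions is an evolution. -/
theorem isEvolution_of_increments {γ : ℝ → ProbabilityMeasure X}
    (hcont : ContinuousOn (fun t => S.B (γ t)) (Ici 0))
    (hlip : ∀ a, 0 < a → ∃ L : ℝ, ∀ s t, a ≤ s → s ≤ t → ‖S.B (γ t) - S.B (γ s)‖ ≤ L * (t - s))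
    (hinc : ∀ s, 0 < s → ∀ (x : X) (δ : ℝ), 0 < δ → ∃ r > 0, ∀ t ∈ Ioo s (s + r),
      0 ≤ S.B (γ t) x - S.B (γ s) x +
        2 / S.ε * (t - s) * (S.drift V x (S.alpha (γ s)) + δ)) : S.IsEvolution V γ := by
  have hε := S.ε_pos
  have hac : ∀ a b, 0 < a → a ≤ b → ∃ m : ℝ → ℝ, IntervalIntegrable m volume a b ∧
      ∀ s ∈ Icc a b, ∀ t ∈ Icc a b, s ≤ t →
        dist (S.B (γ s)) (S.B (γ t)) ≤ ∫ r in s..t, m r := by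
    intro a b ha hab
    obtain ⟨L, hL⟩ := hlip a ha
    refine ⟨fun _ => L, by simp, fun s hs t ht hst => ?_⟩
    rw [dist_comm, dist_eq_norm]
    simpa [mul_comm] using hL s t hs.1 hst
  refine ⟨hcont, hac, ?_⟩
  have hd : ∀ᵐ t : ℝ, ∀ n : ℕ, t ∈ Icc (1 / ((n : ℝ) + 1)) (1 / ((n : ℝ) + 1) + n) →
      ∃ w, HasDerivAt (fun s => S.B (γ s)) w t := by
    refine ae_all_iff.2 fun n => ?_
    have hab : 1 / ((n : ℝ) + 1) ≤ 1 / ((n : ℝ) + 1) + n := le_add_of_nonneg_right (Nat.cast_nonneg n)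
    obtain ⟨m, hm, h1⟩ := hac _ _ (by positivity) hab
    obtain ⟨v, -, -, hvi, hb⟩ := exists_eq_add_integral hab hm h1
    filter_upwards [ae_hasDerivAt_of_eq_add_integral hab hvi hb] with t h2 ht
    exact ⟨_, h2 ht⟩
  filter_upwards [hd] with t h1 ht
  obtain ⟨w, hw⟩ : ∃ w, HasDerivAt (fun s => S.B (γ s)) w t := by
    obtain ⟨n, hn⟩ := exists_nat_one_div_lt ht
    obtain ⟨k, hk⟩ := exists_nat_ge t
    refine h1 (max n k) ⟨?_, ?_⟩
    · refine le_trans ?_ hn.le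
      gcongr
      exact le_max_left _ _
    · have h2 : (k : ℝ) ≤ (max n k : ℕ) := by exact_mod_cast le_max_right n k
      have h3 : 0 < 1 / (((max n k : ℕ) : ℝ) + 1) := by positivity
      linarith
  refine ⟨w, hw, fun x => ?_, ?_⟩
  · refine le_of_forall_pos_le_add fun δ hδ => ?_
    obtain ⟨r, hr, hinc⟩ := hinc t ht x (δ / (2 / S.ε)) (by positivity)
    have h2 := ((S.continuous_eval x).tendsto _).comp hw.tendsto_slope_zero_right
    have h3 := h2.add_const (2 / S.ε * (S.drift V x (S.alpha (γ t)) + δ / (2 / S.ε)))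
    have h4 : 0 ≤ w x + 2 / S.ε * (S.drift V x (S.alpha (γ t)) + δ / (2 / S.ε)) := by
      refine ge_of_tendsto h3 ?_
      filter_upwards [Ioo_mem_nhdsGT hr] with q hq
      have h5 := hinc (t + q) ⟨by linarith [hq.1], by linarith [hq.2]⟩
      simp only [Function.comp_apply, RKHS.coe_smul, RKHS.coe_sub, Pi.smul_apply, Pi.sub_apply,
        smul_eq_mul]
      have h6 : q⁻¹ * (S.B (γ (t + q)) x - S.B (γ t) x) +
          2 / S.ε * (S.drift V x (S.alpha (γ t)) + δ / (2 / S.ε)) =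
          q⁻¹ * (S.B (γ (t + q)) x - S.B (γ t) x +
            2 / S.ε * (t + q - t) * (S.drift V x (S.alpha (γ t)) + δ / (2 / S.ε))) := by
        have := hq.1.ne'
        field_simp
        ring
      rw [h6]
      exact mul_nonneg (inv_nonneg.2 hq.1.le) h5
    have h7 : 2 / S.ε * (S.drift V x (S.alpha (γ t)) + δ / (2 / S.ε)) =
        2 / S.ε * S.drift V x (S.alpha (γ t)) + δ := by
      field_simp
    rw [h7] at h4
    simp only [drift] at h4
    linarith
  · rw [emb_alpha, real_inner_comm]
    exact S.inner_B_eq_zero_of_hasDerivAt hw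

/-! ### The implicit Euler scheme -/

variable (S V) in
/-- A sequence of measures obtained by implicit Euler steps of length `τ`. -/
def IsEulerScheme (τ : ℝ) (α : ℕ → FiniteMeasure X) : Prop :=
  ∀ n, S.IsFlowDirection V (α (n + 1)) (τ⁻¹ • (S.emb (α (n + 1)) - S.emb (α n)))

variable (S V) in
theorem exists_isEulerScheme [Nonempty X] {τ : ℝ} (hτ : 0 < τ) (α₀ : FiniteMeasure X) :
    ∃ α : ℕ → FiniteMeasure X, α 0 = α₀ ∧ S.IsEulerScheme V τ α := by
  choose J hJ using exists_isFlowDirection_step (S := S) V hτ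
  exact ⟨fun n => Nat.rec α₀ (fun _ β => J (S.emb β)) n, rfl, fun n => hJ _⟩

namespace IsEulerScheme

variable {τ : ℝ} {α : ℕ → FiniteMeasure X} {w : S.Hc}

theorem inner_eq_zero (hτ : 0 < τ) (h : S.IsEulerScheme V τ α) (n : ℕ) :
    inner ℝ (S.emb (α (n + 1)) - S.emb (α n)) (S.emb (α (n + 1))) = 0 := by
  have := (h n).inner_eq_zero
  rw [inner_smul_left] at this
  exact (mul_eq_zero.1 this).resolve_left (by simpa using hτ.ne')

/-- The discrete speed is non-increasing. -/
theorem norm_step_le (hτ : 0 < τ) (h : S.IsEulerScheme V τ α) (hw : S.IsFlowDirection V (α 0) w)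
    (n : ℕ) : ‖S.emb (α (n + 1)) - S.emb (α n)‖ ≤ τ * ‖w‖ := by
  have key : ∀ (a b : FiniteMeasure X) (z : S.Hc), S.IsFlowDirection V a z →
      S.IsFlowDirection V b (τ⁻¹ • (S.emb b - S.emb a)) → ‖S.emb b - S.emb a‖ ≤ τ * ‖z‖ := by
    intro a b z hz hb
    have h1 := hb.inner_sub_nonpos hz
    set d := S.emb b - S.emb a with hd
    rw [inner_sub_left, inner_smul_left, conj_trivial, real_inner_self_eq_norm_sq] at h1
    have h2 := real_inner_le_norm z d
    have h3 : τ⁻¹ * ‖d‖ ^ 2 ≤ ‖z‖ * ‖d‖ := by linarith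
    rw [inv_mul_le_iff₀ hτ] at h3
    by_contra! hlt
    have := mul_nonneg hτ.le (norm_nonneg z)
    nlinarith
  induction n with
  | zero => exact key _ _ _ hw (h 0)
  | succ n ih =>
    refine (key _ _ _ (h n) (h (n + 1))).trans ?_
    rwa [norm_smul, norm_inv, Real.norm_eq_abs, abs_of_pos hτ, ← mul_assoc,
      mul_inv_cancel₀ hτ.ne', one_mul]

theorem norm_sub_le (hτ : 0 < τ) (h : S.IsEulerScheme V τ α) (hw : S.IsFlowDirection V (α 0) w)
    {m n : ℕ} (hmn : m ≤ n) :
    ‖S.emb (α n) - S.emb (α m)‖ ≤ ‖w‖ * (n * τ - m * τ) := by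
  induction n, hmn using Nat.le_induction with
  | base => simp
  | succ n _ ih =>
    have h1 := h.norm_step_le hτ hw n
    have h2 := norm_sub_le_norm_sub_add_norm_sub (S.emb (α (n + 1))) (S.emb (α n)) (S.emb (α m))
    push_cast
    linarith

theorem norm_sq_eq (hτ : 0 < τ) (h : S.IsEulerScheme V τ α) (n : ℕ) :
    ‖S.emb (α n)‖ ^ 2 =
      ‖S.emb (α (n + 1))‖ ^ 2 + ‖S.emb (α (n + 1)) - S.emb (α n)‖ ^ 2 := by
  have h1 := norm_sub_sq_real (S.emb (α (n + 1))) (S.emb (α (n + 1)) - S.emb (α n))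
  rw [sub_sub_cancel, real_inner_comm, h.inner_eq_zero hτ n] at h1
  linarith

theorem norm_le (hτ : 0 < τ) (h : S.IsEulerScheme V τ α) (n : ℕ) :
    ‖S.emb (α n)‖ ≤ ‖S.emb (α 0)‖ := by
  induction n with
  | zero => exact le_rfl
  | succ n ih =>
    refine le_trans ?_ ih
    have h1 := h.norm_sq_eq hτ n
    have h2 := sq_nonneg ‖S.emb (α (n + 1)) - S.emb (α n)‖
    exact le_of_sq_le_sq (by linarith) (norm_nonneg _)

/-- The loss of norm of the scheme is of the order of the step. -/
theorem le_norm_sq (hτ : 0 < τ) (h : S.IsEulerScheme V τ α) (hw : S.IsFlowDirection V (α 0) w)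
    (n : ℕ) : ‖S.emb (α 0)‖ ^ 2 - n * τ * (τ * ‖w‖ ^ 2) ≤ ‖S.emb (α n)‖ ^ 2 := by
  induction n with
  | zero => simp
  | succ n ih =>
    have h1 := h.norm_sq_eq hτ n
    have h2 := pow_le_pow_left₀ (norm_nonneg _) (h.norm_step_le hτ hw n) 2
    push_cast
    nlinarith

theorem increments (hτ : 0 < τ) (h : S.IsEulerScheme V τ α) (x : X) {M : ℝ} {m n : ℕ}
    (hmn : m ≤ n) (hM : ∀ k, m ≤ k → k ≤ n → S.drift V x (α k) ≤ M) :
    0 ≤ S.emb (α n) x - S.emb (α m) x + 2 / S.ε * (n * τ - m * τ) * M := by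
  have hε := S.ε_pos
  induction n, hmn using Nat.le_induction with
  | base => simp
  | succ n hmn ih =>
    have h1 := ih fun k hk hk' => hM k hk (hk'.trans n.le_succ)
    have h2 := (h n).nonneg x
    have h3 := hM (n + 1) (hmn.trans n.le_succ) le_rfl
    simp only [RKHS.coe_smul, RKHS.coe_sub, Pi.smul_apply, Pi.sub_apply, smul_eq_mul] at h2
    have h4 : 2 / S.ε * S.drift V x (α (n + 1)) ≤ 2 / S.ε * M := by gcongr
    have h5 : 0 ≤ τ⁻¹ * (S.emb (α (n + 1)) x - S.emb (α n) x) + 2 / S.ε * M := by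
      simp only [drift] at h4
      linarith
    have h6 := mul_nonneg hτ.le h5
    rw [mul_add, mul_inv_cancel_left₀ hτ.ne'] at h6
    push_cast
    linarith

end IsEulerScheme

theorem norm_B_sub_eq_emb (μ ν : ProbabilityMeasure X) :
    S.B μ - S.B ν = S.emb (S.alpha μ) - S.emb (S.alpha ν) := by
  rw [emb_alpha, emb_alpha]

/-- Existence of the evolution from a point of the domain of the monotone operator, as a limit of
implicit Euler schemes. -/
theorem exists_isEvolution_of_isFlowDirection (hS : S.IsUniversal) {μ : ProbabilityMeasure X}
    {w : S.Hc} (hw : S.IsFlowDirection V (S.alpha μ) w) :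
    ∃ γ : ℝ → ProbabilityMeasure X, γ 0 = μ ∧ S.IsEvolution V γ := by
  have hε := S.ε_pos
  have : Nonempty X := μ.nonempty
  set τ : ℕ → ℝ := fun N => 1 / ((N : ℝ) + 1) with hτ
  have hτ0 : ∀ N, 0 < τ N := fun N => by positivity
  set l : Ultrafilter ℕ := hyperfilter ℕ with hl
  have hlat : (l : Filter ℕ) ≤ atTop := Nat.hyperfilter_le_atTop
  have hτl : Tendsto τ l (𝓝 0) := tendsto_one_div_add_atTop_nhds_zero_nat.mono_left hlat
  choose α hα0 hα using fun N => exists_isEulerScheme S V (hτ0 N) (S.alpha μ)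
  have hw' : ∀ N, S.IsFlowDirection V (α N 0) w := fun N => by rw [hα0]; exact hw
  have hnorm0 : ∀ N, ‖S.emb (α N 0)‖ = 1 := fun N => by rw [hα0, norm_emb_alpha]
  have hnorm : ∀ N n, ‖S.emb (α N n)‖ ≤ 1 := fun N n =>
    ((hα N).norm_le (hτ0 N) n).trans_eq (hnorm0 N)
  set k : ℕ → ℝ → ℕ := fun N t => ⌊t * ((N : ℝ) + 1)⌋₊ with hk
  have hkmono : ∀ N {s t : ℝ}, s ≤ t → k N s ≤ k N t := fun N s t hst =>
    Nat.floor_mono (by gcongr)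
  have hkt : ∀ t : ℝ, 0 ≤ t → Tendsto (fun N => (k N t : ℝ) * τ N) l (𝓝 t) := by
    intro t ht
    have h1 := (tendsto_nat_floor_mul_div_atTop ht).comp
      (tendsto_atTop_add_const_right atTop (1 : ℝ) tendsto_natCast_atTop_atTop)
    refine (h1.mono_left hlat).congr fun N => ?_
    simp [hk, hτ, div_eq_mul_inv]
  have hex : ∀ t : ℝ, 0 ≤ t → ∃ ν : ProbabilityMeasure X,
      Tendsto (fun N => α N (k N t)) l (𝓝 (S.alpha ν)) := by
    intro t ht
    obtain ⟨β, hβ⟩ := exists_tendsto_ultrafilter l (fun N => α N (k N t)) _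
      fun N => S.mass_le _ (hnorm N _)
    have h1 := (S.continuous_emb.norm.tendsto β).comp hβ
    have h2 : ‖S.emb β‖ ≤ 1 := le_of_tendsto h1 (Eventually.of_forall fun N => hnorm N _)
    have h3 : 1 ≤ ‖S.emb β‖ ^ 2 := by
      have h4 := ((hkt t ht).mul (hτl.mul_const (‖w‖ ^ 2))).const_sub 1
      rw [zero_mul, mul_zero, sub_zero] at h4
      refine le_of_tendsto_of_tendsto' h4 (h1.pow 2) fun N => ?_
      have h5 := (hα N).le_norm_sq (hτ0 N) (hw' N) (k N t)
      rw [hnorm0, one_pow] at h5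
      exact h5
    obtain ⟨ν, hν⟩ := S.exists_alpha_eq (α := β) (by nlinarith [norm_nonneg (S.emb β)])
    exact ⟨ν, by rwa [hν]⟩
  have : Nonempty (ProbabilityMeasure X) := ⟨μ⟩
  choose! γ hγ using hex
  have hemb : ∀ t : ℝ, 0 ≤ t → Tendsto (fun N => S.emb (α N (k N t))) l (𝓝 (S.B (γ t))) := by
    intro t ht
    have := (S.continuous_emb.tendsto _).comp (hγ t ht)
    rwa [emb_alpha] at this
  have hlip : ∀ s t, 0 ≤ s → s ≤ t → ‖S.B (γ t) - S.B (γ s)‖ ≤ ‖w‖ * (t - s) := by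
    intro s t hs hst
    have h1 := ((hemb t (hs.trans hst)).sub (hemb s hs)).norm
    have h2 := ((hkt t (hs.trans hst)).sub (hkt s hs)).const_mul ‖w‖
    exact le_of_tendsto_of_tendsto' h1 h2 fun N =>
      (hα N).norm_sub_le (hτ0 N) (hw' N) (hkmono N hst)
  refine ⟨γ, ?_, isEvolution_of_increments ?_ ?_ ?_⟩
  · have h1 := hemb 0 le_rfl
    have h2 : ∀ N, S.emb (α N (k N 0)) = S.B μ := fun N => by
      have : k N 0 = 0 := by simp [hk]
      rw [this, hα0, emb_alpha]
    simp only [h2] at h1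
    exact S.B_injective hS (tendsto_nhds_unique h1 tendsto_const_nhds)
  · refine LipschitzOnWith.continuousOn (K := ‖w‖₊) (LipschitzOnWith.of_dist_le_mul ?_)
    intro s hs t ht
    rw [coe_nnnorm]
    rcases le_total s t with hst | hst
    · rw [dist_comm, dist_comm s, dist_eq_norm, Real.dist_eq, abs_of_nonneg (sub_nonneg.2 hst)]
      exact hlip s t hs hst
    · rw [dist_eq_norm, Real.dist_eq, abs_of_nonneg (sub_nonneg.2 hst)]
      exact hlip t s ht hst
  · exact fun a ha => ⟨‖w‖, fun s t hs hst => hlip s t (ha.le.trans hs) hst⟩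
  · intro s hs x δ hδ
    obtain ⟨ρ, hρ, hmod⟩ := exists_modulus hS (continuous_drift (S := S) (V := V) x) hδ
    refine ⟨ρ / (‖w‖ + 1), by positivity, fun t ht => ?_⟩
    have hst := ht.1.le
    have ht0 := hs.le.trans hst
    have hlt : ‖w‖ * (t - s) < ρ := by
      have h1 : t - s < ρ / (‖w‖ + 1) := by linarith [ht.2]
      rw [lt_div_iff₀ (by positivity)] at h1
      linarith [ht.1]
    have t1 := ((S.continuous_eval x).tendsto _).comp (hemb t ht0)
    have t2 := ((S.continuous_eval x).tendsto _).comp (hemb s hs.le)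
    have t3 := (hkt t ht0).sub (hkt s hs.le)
    have t4 := (((continuous_drift (S := S) (V := V) x).tendsto _).comp (hγ s hs.le)).add_const δ
    refine ge_of_tendsto ((t1.sub t2).add ((t3.const_mul (2 / S.ε)).mul t4)) ?_
    filter_upwards [(t3.const_mul ‖w‖).eventually_lt_const hlt] with N hN
    refine (hα N).increments (hτ0 N) x (hkmono N hst) fun j hj hj' => ?_
    have h1 := (hα N).norm_sub_le (hτ0 N) (hw' N) hj
    have h2 : ‖w‖ * (j * τ N - k N s * τ N) ≤ ‖w‖ * (k N t * τ N - k N s * τ N) := by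
      have := (hτ0 N).le
      gcongr
    have h3 := (abs_le.1 (hmod _ _ (hnorm N _) (hnorm N _) (h1.trans_lt (h2.trans_lt hN)))).2
    simp only [Function.comp_apply]
    linarith

/-- Smoothing effect: the Lipschitz constant after a positive time is bounded uniformly over all
evolutions. -/
theorem IsEvolution.norm_sub_le_sqrt_mul (hS : S.IsUniversal) {γ : ℝ → ProbabilityMeasure X}
    (h : S.IsEvolution V γ) {a s t : ℝ} (ha : 0 < a) (has : a ≤ s) (hst : s ≤ t) :
    ‖S.B (γ t) - S.B (γ s)‖ ≤ Real.sqrt (16 * ‖V‖ / (S.ε * a)) * (t - s) := by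
  have hε := S.ε_pos
  obtain ⟨r, hr, w, hw, -⟩ := h.exists_direction (by positivity : 0 ≤ a / 2) (half_lt_self ha)
  have hr0 : 0 < r := lt_trans (by positivity) hr.1
  refine (h.norm_sub_le_mul hr0.le hw (ha.trans_le has) (hr.2.le.trans has) hst).trans ?_
  have h1 := h.norm_deriv_sq_mul_le hS hr0 hw
  have h2 := energy_sub_le V (γ 0) (γ r)
  have h3 : ‖w‖ ≤ Real.sqrt (16 * ‖V‖ / (S.ε * a)) := by
    refine Real.le_sqrt_of_sq_le ?_
    rw [le_div_iff₀ (by positivity)]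
    have h4 : S.ε * ‖w‖ ^ 2 * (a / 2) ≤ S.ε * ‖w‖ ^ 2 * r := by
      have := hr.1.le
      gcongr
    nlinarith
  have := sub_nonneg.2 hst
  gcongr

/-- The inequality for the increments, uniformly over all evolutions. -/
theorem exists_increments (hS : S.IsUniversal) {s : ℝ} (hs : 0 < s) (x : X) {δ : ℝ} (hδ : 0 < δ) :
    ∃ r > 0, ∀ γ : ℝ → ProbabilityMeasure X, S.IsEvolution V γ → ∀ t ∈ Ioo s (s + r),
      0 ≤ S.B (γ t) x - S.B (γ s) x +
        2 / S.ε * (t - s) * (S.drift V x (S.alpha (γ s)) + δ) := by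
  have hε := S.ε_pos
  obtain ⟨ρ, hρ, hmod⟩ := exists_modulus hS (continuous_drift (S := S) (V := V) x) hδ
  set L := Real.sqrt (16 * ‖V‖ / (S.ε * s)) with hL
  have hL0 : 0 ≤ L := Real.sqrt_nonneg _
  refine ⟨ρ / (L + 1), by positivity, fun γ h t ht => ?_⟩
  set M := S.drift V x (S.alpha (γ s)) + δ with hM
  have h1 := inner_add_le_of_ae_hasDerivAt ht.1.le (h.absolutelyContinuousOnInterval hs ht.1.le)
    (absolutelyContinuousOnInterval_const_mul (-(2 / S.ε * M)) s t) (-S.sec x) (by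
      filter_upwards [h.dir] with q hq hq'
      obtain ⟨w, hw, hwd⟩ := hq (hs.trans hq'.1)
      refine ⟨w, _, hw, (hasDerivAt_id q).const_mul _, ?_⟩
      rw [inner_neg_left, inner_sec]
      have h2 : ‖S.B (γ q) - S.B (γ s)‖ < ρ := by
        refine (h.norm_sub_le_sqrt_mul hS hs le_rfl hq'.1.le).trans_lt ?_
        have h3 : q - s < ρ / (L + 1) := by linarith [hq'.2, ht.2]
        rw [lt_div_iff₀ (by positivity)] at h3
        rw [← hL]
        linarith [hq'.1]
      rw [norm_B_sub_eq_emb] at h2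
      have h3 := (abs_le.1 (hmod _ _ (S.norm_emb_alpha _).le (S.norm_emb_alpha _).le h2)).2
      have h4 := hwd.nonneg x
      have h5 : 2 / S.ε * S.drift V x (S.alpha (γ q)) ≤ 2 / S.ε * M := by
        gcongr; linarith
      simp only [drift] at h5
      simp
      linarith)
  rw [inner_neg_left, inner_neg_left, inner_sec, inner_sec] at h1
  linarith

/-- Existence of the evolution from an arbitrary probability measure, by density. -/
theorem exists_isEvolution (hS : S.IsUniversal) (V : C(X, ℝ)) (μ : ProbabilityMeasure X) :
    ∃ γ : ℝ → ProbabilityMeasure X, γ 0 = μ ∧ S.IsEvolution V γ := by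
  choose ν w hw hν using fun j : ℕ => exists_isFlowDirection_norm_sub_lt (S := S) (V := V) μ
    (δ := 1 / ((j : ℝ) + 1)) (by positivity)
  choose Γ hΓ0 hΓ using fun j => exists_isEvolution_of_isFlowDirection hS (hw j)
  set l : Ultrafilter ℕ := hyperfilter ℕ with hl
  have hlat : (l : Filter ℕ) ≤ atTop := Nat.hyperfilter_le_atTop
  have hex : ∀ t : ℝ, ∃ η : ProbabilityMeasure X, Tendsto (fun j => Γ j t) l (𝓝 η) := by
    intro t
    obtain ⟨η, -, hη⟩ := isCompact_univ.ultrafilter_le_nhds' (l.map fun j => Γ j t) univ_mem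
    exact ⟨η, hη⟩
  choose γ hγ using hex
  have hB : ∀ t, Tendsto (fun j => S.B (Γ j t)) l (𝓝 (S.B (γ t))) := fun t =>
    (S.continuous_B.tendsto _).comp (hγ t)
  have hτ := tendsto_one_div_add_atTop_nhds_zero_nat (𝕜 := ℝ)
  have hνμ : Tendsto (fun j => S.B (ν j)) atTop (𝓝 (S.B μ)) :=
    tendsto_iff_norm_sub_tendsto_zero.2
      (squeeze_zero (fun _ => norm_nonneg _) (fun j => (hν j).le) hτ)
  have hdist : ∀ j t, 0 ≤ t → ‖S.B (Γ j t) - S.B (γ t)‖ ≤ 1 / ((j : ℝ) + 1) := by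
    intro j t ht
    refine le_trans ?_ (hν j).le
    refine le_of_tendsto_of_tendsto' ((hB t).const_sub (S.B (Γ j t))).norm
      ((hνμ.mono_left hlat).const_sub (S.B (ν j))).norm fun i => ?_
    have := (hΓ j).norm_sub_le (hΓ i) le_rfl ht
    rwa [hΓ0, hΓ0] at this
  refine ⟨γ, ?_, isEvolution_of_increments ?_ ?_ ?_⟩
  · have h1 := hB 0
    simp only [hΓ0] at h1
    exact S.B_injective hS (tendsto_nhds_unique h1 (hνμ.mono_left hlat))
  · have h1 : TendstoUniformlyOn (fun j t => S.B (Γ j t)) (fun t => S.B (γ t)) atTop (Ici 0) := by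
      rw [Metric.tendstoUniformlyOn_iff]
      intro δ hδ
      filter_upwards [hτ.eventually_lt_const hδ] with j hj t ht
      rw [dist_comm, dist_eq_norm]
      exact (hdist j t ht).trans_lt hj
    exact h1.continuousOn (Eventually.of_forall fun j => (hΓ j).cont).frequently
  · intro a ha
    refine ⟨Real.sqrt (16 * ‖V‖ / (S.ε * a)), fun s t hs hst => ?_⟩
    exact le_of_tendsto ((hB t).sub (hB s)).norm (Eventually.of_forall fun j =>
      (hΓ j).norm_sub_le_sqrt_mul hS ha hs hst)
  · intro s hs x δ hδ
    obtain ⟨r, hr, h1⟩ := exists_increments (V := V) hS hs x hδ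
    refine ⟨r, hr, fun t ht => ?_⟩
    have t1 := ((S.continuous_eval x).tendsto _).comp (hB t)
    have t2 := ((S.continuous_eval x).tendsto _).comp (hB s)
    have t4 := ((((continuous_drift (S := S) (V := V) x).comp S.continuous_alpha).tendsto _).comp
      (hγ s)).add_const δ
    exact ge_of_tendsto ((t1.sub t2).add (t4.const_mul (2 / S.ε * (t - s))))
      (Eventually.of_forall fun j => h1 (Γ j) (hΓ j) t ht)

end Cost
namespace Cost

variable {X : Type*} [MetricSpace X] [CompactSpace X] [MeasurableSpace X] [BorelSpace X]
variable {S : Cost X} {V : C(X, ℝ)}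

/-! ### Existence and uniqueness of the flow, and its properties -/

theorem extend_coe (μ : ℝ≥0 → ProbabilityMeasure X) (t : ℝ≥0) : extend μ t = μ t := by
  rw [extend, Real.toNNReal_coe]

theorem IsEvolution.congr {γ γ' : ℝ → ProbabilityMeasure X} (h : S.IsEvolution V γ)
    (heq : ∀ t, 0 ≤ t → γ' t = γ t) : S.IsEvolution V γ' := by
  refine ⟨h.cont.congr fun t ht => by simp only [heq t ht], fun a b ha hab => ?_, ?_⟩
  · obtain ⟨m, hm, h1⟩ := h.ac a b ha hab
    refine ⟨m, hm, fun s hs t ht hst => ?_⟩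
    rw [heq s (ha.le.trans hs.1), heq t (ha.le.trans ht.1)]
    exact h1 s hs t ht hst
  · filter_upwards [h.dir] with t ht ht0
    obtain ⟨w, hw, hwd⟩ := ht ht0
    refine ⟨w, hw.congr_of_eventuallyEq ?_, by rwa [heq t ht0.le]⟩
    filter_upwards [lt_mem_nhds ht0] with s hs
    rw [heq s hs.le]

theorem IsFlow.antitone_norm_sub (hS : S.IsUniversal) {μ₀ ν₀ : ProbabilityMeasure X}
    {μ ν : ℝ≥0 → ProbabilityMeasure X} (hμ : S.IsFlow V μ₀ μ) (hν : S.IsFlow V ν₀ ν) :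
    Antitone fun t => ‖S.B (μ t) - S.B (ν t)‖ := by
  intro s t hst
  have := (hμ.isEvolution hS).norm_sub_le (hν.isEvolution hS) s.2 (NNReal.coe_le_coe.2 hst)
  simpa only [extend_coe, NNReal.val_eq_coe] using this

theorem IsFlow.unique (hS : S.IsUniversal) {μ₀ : ProbabilityMeasure X}
    {μ ν : ℝ≥0 → ProbabilityMeasure X} (hμ : S.IsFlow V μ₀ μ) (hν : S.IsFlow V μ₀ ν) : μ = ν := by
  ext1 t
  have h := hμ.antitone_norm_sub hS hν (zero_le (a := t))
  simp only [hμ.init, hν.init, sub_self, norm_zero] at h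
  exact S.B_injective hS (sub_eq_zero.1 (norm_le_zero_iff.1 h))

theorem exists_isFlow (hS : S.IsUniversal) (V : C(X, ℝ)) (μ₀ : ProbabilityMeasure X) :
    ∃ μ : ℝ≥0 → ProbabilityMeasure X, S.IsFlow V μ₀ μ := by
  obtain ⟨γ, h0, hγ⟩ := exists_isEvolution hS V μ₀
  have h1 : S.IsEvolution V (extend fun t : ℝ≥0 => γ t) := hγ.congr fun t ht => by
    rw [extend, Real.coe_toNNReal _ ht]
  have h2 := h1.isFlow hS
  rw [NNReal.coe_zero, h0] at h2
  exact ⟨_, h2⟩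

theorem isLeast_range_energy {x : X} (hx : ∀ y, V x ≤ V y) :
    IsLeast (range fun ν : ProbabilityMeasure X => energy V ν) (V x) := by
  refine ⟨⟨diracProba x, ?_⟩, ?_⟩
  · change ∫ y, V y ∂(Measure.dirac x) = V x
    rw [integral_dirac]
  · rintro _ ⟨ν, rfl⟩
    exact le_energy hx ν

end Cost
end Sinkhorn
end

open Sinkhorn in
theorem mainTheorem1 {X : Type*} [MetricSpace X] [CompactSpace X] [MeasurableSpace X]
    [BorelSpace X] (S : Cost X) (hS : S.IsUniversal) (V : C(X, ℝ)) :
    -- existence and uniqueness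
    (∀ μ₀ : ProbabilityMeasure X, ∃! μ : ℝ≥0 → ProbabilityMeasure X, S.IsFlow V μ₀ μ) ∧
    (∀ (μ₀ : ProbabilityMeasure X) (μ : ℝ≥0 → ProbabilityMeasure X), S.IsFlow V μ₀ μ →
      -- energy dissipation
      IsACCurve 1 (Ici 0) edist (fun t => energy V (Cost.extend μ t)) ∧
      Antitone (fun t => energy V (μ t)) ∧
      (∀ᵐ t : ℝ, 0 < t → ∃ σ : StrongDual ℝ (S.Hμ (Cost.extend μ t)),
        S.HasVelocity (Cost.extend μ) t σ ∧
        HasDerivAt (fun s => energy V (Cost.extend μ s))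
          (-S.metricTensor (Cost.extend μ t) σ σ) t) ∧
      -- long term behavior
      (∃ m : ℝ, IsLeast (range V) m ∧
        IsLeast (range (fun ν : ProbabilityMeasure X => energy V ν)) m ∧
        Tendsto (fun t => energy V (μ t)) atTop (𝓝 m)) ∧
      (∀ x : X, (∀ y, y ≠ x → V x < V y) → Tendsto μ atTop (𝓝 (diracProba x)))) ∧
    -- non-expansiveness
    (∀ (μ₀ ν₀ : ProbabilityMeasure X) (μ ν : ℝ≥0 → ProbabilityMeasure X),
      S.IsFlow V μ₀ μ → S.IsFlow V ν₀ ν → Antitone (fun t => ‖S.B (μ t) - S.B (ν t)‖)) := by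
  refine ⟨fun μ₀ => ?_, fun μ₀ μ hμ => ?_, fun μ₀ ν₀ μ ν hμ hν => hμ.antitone_norm_sub hS hν⟩
  · obtain ⟨μ, hμ⟩ := Cost.exists_isFlow hS V μ₀
    exact ⟨μ, hμ, fun ν hν => hν.unique hS hμ⟩
  have hγ := hμ.isEvolution hS
  refine ⟨hγ.isACCurve_energy hS, fun s t hst => ?_, ?_, ?_, fun x hx => ?_⟩
  · have := hγ.antitoneOn_energy hS (mem_Ici.2 s.2) (mem_Ici.2 t.2) (NNReal.coe_le_coe.2 hst)
    simpa only [Cost.extend_coe, NNReal.val_eq_coe] using this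
  · filter_upwards [hγ.hasDerivAt_energy hS] with t ht ht0
    obtain ⟨w, hw, -, hd⟩ := ht ht0
    exact ⟨_, (S.hasVelocity_iff hS hw _).2 rfl, hd⟩
  · have : Nonempty X := μ₀.nonempty
    obtain ⟨x, -, hx⟩ := isCompact_univ.exists_isMinOn univ_nonempty V.continuous.continuousOn
    have hx' : ∀ y, V x ≤ V y := fun y => hx (mem_univ y)
    refine ⟨V x, ⟨⟨x, rfl⟩, ?_⟩, Cost.isLeast_range_energy hx', ?_⟩
    · rintro _ ⟨y, rfl⟩
      exact hx' y
    · have := (hγ.tendsto_energy hS hx').comp (NNReal.tendsto_coe_atTop.2 tendsto_id)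
      simpa [Function.comp_def, Cost.extend_coe] using this
  · have := (hγ.tendsto_diracProba hS hx).comp (NNReal.tendsto_coe_atTop.2 tendsto_id)
    simpa [Function.comp_def, Cost.extend_coe] using this
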